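/- Let $n_1,m,n_2,q$ be integers with $1<n_1<m$, $\gcd(m,n_1)=1$, $q>0$, $n_2>1$, $\gcd(q,n_2)=1$, and put $D=mn_1n_2+q$, $N_k=(m+n_1)n_2+q+k$. Let $\Gamma$ be the numerical semigroup generated by $n_1n_2$, $mn_2$, $D$. Put $$A_2=\Big\{-\tfrac{N_k}{n_2D}\;\Big|\;0\le k<n_2D,\ \tfrac{N_k}{D}\notin\mathbb Z,\ \tfrac{N_k}{n_2}\notin\mathbb Z\Big\},\qquad A_{21}=\Big\{-\tfrac{N_k}{n_2D}\in A_2\;\Big|\;N_k-q\in\Gamma\Big\},\qquad A_{22}=A_2\setminus A_{21}.$$ Let $a,b\ge 0$ be integers with $am+bn_1=mn_1n_2+q$, and let $\alpha=-\frac{N_k}{n_2D}\in A_{22}$. Then there are integers $a',b',\ell\ge 0$ with $$(a'm+b'n_1)n_2+\ell D=n_2D+k .$$ For any such $a',b',\ell$ and $t>0$ let $$f_{-t}(x,y)=(x^{n_1}-y^m)^{n_2}+x^ay^b+t\,(x^{n_1}-y^m)^{\ell}x^{a'}y^{b'} .$$ Let $Y(x^{1/m})=\big(x^{1/m}+a_1x^{2/m}+\dots+a_rx^{(r+1)/m}\big)^{n_1}$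 with $a_i\in\mathbb R$ be such that $x^{n_1}-Y(x^{1/m})^m$ has order $>\frac{D}{mn_2}$ in $x$ and $Y(x^{1/m})>0$ for $0<x\le 1$ (for instance $Y=x^{n_1/m}$). Let $\mathcal D_Y=\{0\le x\le 1,\ 0\le y\le Y(x^{1/m})\}$, assume $f_{-t}>0$ on $\mathcal D_Y\setminus\{(0,0)\}$ (automatic for $Y=x^{n_1/m}$), and let $$\mathcal I(f_{-t},1,1,0)(s)=\iint_{\mathcal D_Y}f_{-t}(x,y)^s\,dx\,dy .$$ This integral converges absolutely for $\operatorname{Re}s>-\frac{m+n_1}{mn_1n_2}$ and has a meromorphic continuation to $\mathbb C$. There is a polynomial $P(t)=c_0+c_1t$ of degree exactly one, depending on neither $t$ nor $Y$, such that for all such $t$ and $Y$ the continuation has at most a simple pole at $s=\alpha$, with residue $P(t)$; in particular $\alpha$ is a simple pole whenever $P(t)\neq 0$, that is, for every such $t$ with at most one exception. The coefficient of $t$ is $$c_1=\frac{\alpha}{n_2(mn_1n_2+q)}\,\boldsymbol B\Big(\frac{\ell+1}{n_2},\,-\alpha+1-\frac{\ell+1}{n_2}\Big)\neq 0,$$ where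 $\boldsymbol B$ is the beta function. -/

import Mathlib

namespace TwoPuiseux

open Polynomial MeasureTheory

/-- The number `D = m n₁ n₂ + q`. -/
def bigD (n₁ m n₂ q : ℕ) : ℕ := m * n₁ * n₂ + q

/-- The numerator `N_k = (m + n₁) n₂ + q + k`. -/
def numer (n₁ m n₂ q k : ℕ) : ℕ := (m + n₁) * n₂ + q + k

/-- The candidate `- N_k / (n₂ D)`. -/
def candidate (n₁ m n₂ q k : ℕ) : ℚ :=
  -((numer n₁ m n₂ q k : ℚ) / ((n₂ : ℚ) * (bigD n₁ m n₂ q : ℚ)))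

/-- The semigroup `Γ` generated by `n₁ n₂`, `m n₂` and `m n₁ n₂ + q`. -/
def semigroupΓ (n₁ m n₂ q : ℕ) : AddSubmonoid ℕ :=
  AddSubmonoid.closure {n₁ * n₂, m * n₂, bigD n₁ m n₂ q}

/-- The set `A₂` of opposite candidate exponents attached to the second Puiseux pair. -/
def A₂ (n₁ m n₂ q : ℕ) : Set ℚ :=
  {α | (∃ k : ℕ, k < n₂ * bigD n₁ m n₂ q ∧ α = candidate n₁ m n₂ q k) ∧
    (¬ ∃ z : ℤ, (n₂ : ℚ) * α = z) ∧ (¬ ∃ z : ℤ, (bigD n₁ m n₂ q : ℚ) * α = z)}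

/-- The subset `A₂₁` of those `- N_k / (n₂ D)` in `A₂` for which `N_k - q` lies in `Γ`
(the subtraction is exact, since `q ≤ N_k`). -/
def A₂₁ (n₁ m n₂ q : ℕ) : Set ℚ :=
  {α | α ∈ A₂ n₁ m n₂ q ∧ ∃ k : ℕ, α = candidate n₁ m n₂ q k ∧
    numer n₁ m n₂ q k - q ∈ semigroupΓ n₁ m n₂ q}

/-- `A₂₂` is the complement of `A₂₁` in `A₂`. -/
def A₂₂ (n₁ m n₂ q : ℕ) : Set ℚ := A₂ n₁ m n₂ q \ A₂₁ n₁ m n₂ q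

/-- The function `Y(x^{1/m}) = (x^{1/m} + a₁ x^{2/m} + ⋯ + a_r x^{(r+1)/m})^{n₁}` of `x ≥ 0`,
where the polynomial `R` is `z + a₁ z² + ⋯ + a_r z^{r+1}`. -/
noncomputable def branchY (n₁ m : ℕ) (R : ℝ[X]) (x : ℝ) : ℝ :=
  (R.eval (x ^ ((1 : ℝ) / (m : ℝ)))) ^ n₁

/-- The conditions on `Y` with respect to `g = x^{n₁} - y^m`: `Y = R(x^{1/m})^{n₁}` where
`R = z + a₁ z² + ⋯` is a real polynomial, `ord_x g(x, Y(x^{1/m})) > (m n₁ n₂ + q) / (m n₂)`,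
and `Y(x^{1/m}) > 0` for `0 < x ≤ 1`. The order is read off after the substitution `x = z^m`:
a monomial `z^i = x^{i/m}` occurs in `g(z^m, R(z)^{n₁})` only if `i / m > D / (m n₂)`. -/
structure IsBranch (n₁ m n₂ q : ℕ) (R : ℝ[X]) : Prop where
  coeff_zero : R.coeff 0 = 0
  coeff_one : R.coeff 1 = 1
  order : ∀ i : ℕ, n₂ * i ≤ bigD n₁ m n₂ q →
    (((X : ℝ[X]) ^ m) ^ n₁ - (R ^ n₁) ^ m).coeff i = 0
  pos : ∀ x : ℝ, 0 < x → x ≤ 1 → 0 < branchY n₁ m R x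

/-- The domain `𝒟_Y = {(x, y) | 0 ≤ x ≤ 1, 0 ≤ y ≤ Y(x^{1/m})}`. -/
def domainD (n₁ m : ℕ) (R : ℝ[X]) : Set (ℝ × ℝ) :=
  {p | 0 ≤ p.1 ∧ p.1 ≤ 1 ∧ 0 ≤ p.2 ∧ p.2 ≤ branchY n₁ m R p.1}

/-- The function `g_Y(x, y) = ∏_{ζ^m = 1} (y - Y(ζ x^{1/m}))`. -/
noncomputable def gY (n₁ m : ℕ) (R : ℝ[X]) (x y : ℝ) : ℂ :=
  ∏ ζ ∈ nthRootsFinset m (1 : ℂ),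
    ((y : ℂ) - (aeval (ζ * ((x ^ ((1 : ℝ) / (m : ℝ)) : ℝ) : ℂ)) R) ^ n₁)

/-- The integrand `f(x,y)^s x^{β₁} y^{β₂} g_Y(x,y)^{β₃} / (x y)`, for `β₁, β₂ ≥ 1`. -/
noncomputable def integrand (n₁ m : ℕ) (R : ℝ[X]) (f : ℝ → ℝ → ℝ) (β₁ β₂ β₃ : ℕ) (s : ℂ)
    (p : ℝ × ℝ) : ℂ :=
  ((f p.1 p.2 : ℝ) : ℂ) ^ s * (p.1 : ℂ) ^ (β₁ - 1) * (p.2 : ℂ) ^ (β₂ - 1) *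
    gY n₁ m R p.1 p.2 ^ β₃

/-- The integral `ℐ(f, β₁, β₂, β₃)(s)` of `f^s x^{β₁} y^{β₂} g_Y^{β₃} (dx/x) (dy/y)` over `𝒟_Y`,
for `β₁, β₂ ≥ 1`. -/
noncomputable def integralI (n₁ m : ℕ) (R : ℝ[X]) (f : ℝ → ℝ → ℝ) (β₁ β₂ β₃ : ℕ) (s : ℂ) : ℂ :=
  ∫ p in domainD n₁ m R, integrand n₁ m R f β₁ β₂ β₃ s p

/-- `F` is a meromorphic continuation to `ℂ` of `s ↦ ℐ(f, β₁, β₂, β₃)(s)`, the integral being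
absolutely convergent on the half-plane `Re s > σ`. -/
def IsContinuation (n₁ m : ℕ) (R : ℝ[X]) (f : ℝ → ℝ → ℝ) (β₁ β₂ β₃ : ℕ) (σ : ℝ)
    (F : ℂ → ℂ) : Prop :=
  Meromorphic F ∧ ∀ s : ℂ, σ < s.re →
    IntegrableOn (integrand n₁ m R f β₁ β₂ β₃ s) (domainD n₁ m R) ∧
      F s = integralI n₁ m R f β₁ β₂ β₃ s

/-- `f_{-t}(x,y) = (x^{n₁} - y^m)^{n₂} + x^a y^b + t (x^{n₁} - y^m)^ℓ x^{a'} y^{b'}`. -/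
def fMinus (n₁ m n₂ a b a' b' l : ℕ) (t x y : ℝ) : ℝ :=
  (x ^ n₁ - y ^ m) ^ n₂ + x ^ a * y ^ b + t * (x ^ n₁ - y ^ m) ^ l * x ^ a' * y ^ b'

end TwoPuiseux

open MeasureTheory Set Filter Topology Complex
open scoped ContDiff


/-! ### Parameter integrals, gluing over half-planes, integration by parts on the square. -/

namespace TwoPuiseux

/-! The substitution `x = z^m`, `y = z^n₁ u` turns `f_{-t}` into `z^(m n₁ n₂) f(z, u)` with `f = (1
- u^m)^n₂ + z^q u^b + t z^e (1 - u^m)^l u^b'`, with Jacobian `m z^(m + n₁ - 1)`. Write `g = 1 -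
u^m`. With weight `n₂` for `z` and `q` for `g`, the two leading terms near `(z, g) = (0, 0)` form
the model `F = g^n₂ + z^q` of weight `n₂ q`; the perturbation has weight `n₂ q + k`.

The order condition on `Y` makes the new domain `0 < z ≤ 1`, `0 ≤ u ≤ 1 - z^c T(z)` with `c > q /
n₂`. Its integral is the one over the unit square minus one over a signed strip near `u = 1`. On the
strip `f = z^q Q` with `Q` smooth and positive, so that the strip can have poles only where `D s` is
an integer, hence none at `α` (`integral_regionU`, `exists_entire_unitIntegral`). The dependence on
`Y` thus disappears from the residue.

On the square, integration by parts in `z` and along a weighted Euler field gives two recursions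
(`X_mul_J`, `W_mul_J`). Iterated, they show that the integral divided by a product of two Gamma
functions of affine arguments is entire (`exists_entire_J`), which is the continuation. For `t = 0`
the arguments can be divided by `q`; a common pole of the two Gamma factors at `α` would then force
`n₂ α` to be an integer. So the pole is at most simple, with a residue `c₀` (`exists_tendsto_zero`).

For `t > 0` one compares with `t = 0`. The difference of the two integrals still converges for `Re s
> α`, because the perturbation raises the weight by `k` and `α` is exactly where the new weight
vanishes. As `σ` decreases to `α` along the reals, `f^σ - f₀^σ` may be replaced by its linear part
`σ t z^e g^l u^(m-1) F^(σ-1)`, the error being dominated by one integrable function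
(`exists_integrable_bound_diffKernel_sub_model`). The exact Euler identity for this model leaves two
boundary integrals, which together make up the beta integral (`mul_integral_modelIntegrand`,
`add_bdry_model_eq_betaIntegral`). Since a meromorphic function is controlled by its limit along one
ray, this difference is the full contribution of `t`: the residue is exactly affine in `t`.

The hypothesis `α ∈ A₂₂` enters through `l < n₂` and `k > 0`, and through `n₂ α` and `D α` not being
integers. -/

/-- Holomorphy of an integral depending on a complex parameter, from a local integrable bound. -/
theorem differentiableAt_integral_of_bound {β : Type*} [MeasurableSpace β] {μ : Measure β}
    {φ : ℂ → β → ℂ} {s₀ : ℂ} {r : ℝ} (hr : 0 < r) {bound : β → ℝ}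
    (hmeas : ∀ s ∈ Metric.ball s₀ r, AEStronglyMeasurable (φ s) μ)
    (hd : ∀ᵐ x ∂μ, DifferentiableOn ℂ (fun s => φ s x) (Metric.ball s₀ r))
    (hbound : Integrable bound μ)
    (hb : ∀ᵐ x ∂μ, ∀ s ∈ Metric.ball s₀ r, ‖φ s x‖ ≤ bound x) :
    DifferentiableAt ℂ (fun s => ∫ x, φ s x ∂μ) s₀ := by
  have hr2 : 0 < r / 2 := by positivity
  have hsub : ∀ s ∈ Metric.ball s₀ (r / 2), Metric.closedBall s (r / 3) ⊆ Metric.ball s₀ r := by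
    intro s hs y hy
    rw [Metric.mem_ball] at *
    rw [Metric.mem_closedBall] at hy
    linarith [dist_triangle y s s₀]
  refine (hasDerivAt_integral_of_dominated_loc_of_deriv_le (μ := μ) (F := φ)
    (F' := fun s x => deriv (fun s => φ s x) s) (x₀ := s₀)
    (bound := fun x => bound x / (r / 3)) (Metric.ball_mem_nhds s₀ hr2) ?_ ?_ ?_ ?_ ?_ ?_).2
    |>.differentiableAt
  · filter_upwards [Metric.ball_mem_nhds s₀ hr] with s hs using hmeas s hs
  · refine hbound.mono' (hmeas s₀ (Metric.mem_ball_self hr)) ?_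
    filter_upwards [hb] with x hx using hx s₀ (Metric.mem_ball_self hr)
  -- The derivative in `s` is measurable as a limit of difference quotients; the `+ 2` keeps every
  -- increment inside the ball.
  · set v : ℕ → ℂ := fun j => ((r / (j + 2) : ℝ) : ℂ) with hv
    have hv0 : ∀ j, v j ≠ 0 := by
      intro j
      simp only [hv, ne_eq, ofReal_eq_zero]
      positivity
    have hvr : ∀ j, s₀ + v j ∈ Metric.ball s₀ r := by
      intro j
      simp only [hv, Metric.mem_ball, dist_self_add_left, Complex.norm_real, Real.norm_eq_abs]
      rw [abs_of_pos (by positivity)]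
      exact div_lt_self hr (by linarith [(Nat.cast_nonneg j : (0 : ℝ) ≤ j)])
    have hvt : Tendsto v atTop (𝓝[≠] 0) := by
      refine tendsto_nhdsWithin_iff.2 ⟨?_, Eventually.of_forall hv0⟩
      rw [← Complex.ofReal_zero]
      refine (Complex.continuous_ofReal.tendsto 0).comp ?_
      refine tendsto_const_nhds.div_atTop ?_
      exact tendsto_atTop_add_const_right _ _ tendsto_natCast_atTop_atTop
    refine aestronglyMeasurable_of_tendsto_ae (u := atTop)
      (f := fun j x => (v j)⁻¹ • (φ (s₀ + v j) x - φ s₀ x)) ?_ ?_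
    · intro j
      exact ((hmeas _ (hvr j)).sub (hmeas _ (Metric.mem_ball_self hr))).const_smul (v j)⁻¹
    · filter_upwards [hd] with x hx
      have h1 := ((hx s₀ (Metric.mem_ball_self hr)).differentiableAt
        (Metric.ball_mem_nhds s₀ hr)).hasDerivAt
      exact (hasDerivAt_iff_tendsto_slope_zero.1 h1).comp hvt
  -- Cauchy's estimate on a circle of radius `r / 3`, which stays in the ball because `r / 2 + r / 3
  -- < r`.
  · filter_upwards [hd, hb] with x hx hbx s hs
    refine Complex.norm_deriv_le_of_forall_mem_sphere_norm_le (by positivity) ?_ ?_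
    · exact (hx.mono (hsub s hs)).diffContOnCl_ball subset_rfl
    · intro y hy
      exact hbx y (hsub s hs (Metric.sphere_subset_closedBall hy))
  · exact hbound.div_const _
  · filter_upwards [hd] with x hx s hs
    have : s ∈ Metric.ball s₀ r := Metric.ball_subset_ball (by linarith) hs
    exact ((hx s this).differentiableAt (Metric.isOpen_ball.mem_nhds this)).hasDerivAt

/-- Holomorphic functions on all right half-planes that agree far to the right glue. -/
theorem exists_entire_of_forall_halfPlane {J : ℂ → ℂ} {σ : ℝ}
    (h : ∀ τ : ℝ, ∃ H : ℂ → ℂ, DifferentiableOn ℂ H {s | τ < s.re} ∧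
      ∀ s : ℂ, σ < s.re → H s = J s) :
    ∃ H : ℂ → ℂ, Differentiable ℂ H ∧ ∀ s : ℂ, σ < s.re → H s = J s := by
  choose G hG hGJ using h
  have hopen : ∀ τ : ℝ, IsOpen {s : ℂ | τ < s.re} := fun τ =>
    isOpen_lt continuous_const Complex.continuous_re
  have key : ∀ τ τ' : ℝ, ∀ s : ℂ, τ < s.re → τ' < s.re → G τ s = G τ' s := by
    intro τ τ' s h1 h2
    have hpre : IsPreconnected {s : ℂ | max τ τ' < s.re} :=
      (convex_halfSpace_re_gt _).isPreconnected
    have hA : AnalyticOnNhd ℂ (G τ) {s : ℂ | max τ τ' < s.re} :=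
      DifferentiableOn.analyticOnNhd
        ((hG τ).mono fun s hs => lt_of_le_of_lt (le_max_left τ τ') hs) (hopen _)
    have hB : AnalyticOnNhd ℂ (G τ') {s : ℂ | max τ τ' < s.re} :=
      DifferentiableOn.analyticOnNhd
        ((hG τ').mono fun s hs => lt_of_le_of_lt (le_max_right τ τ') hs) (hopen _)
    set p : ℂ := ((max (max τ τ') σ + 1 : ℝ) : ℂ) with hp
    have hpre' : p.re = max (max τ τ') σ + 1 := by rw [hp, Complex.ofReal_re]
    have hp1 : max τ τ' < p.re := by
      rw [hpre']; linarith [le_max_left (max τ τ') σ]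
    have hp2 : σ < p.re := by
      rw [hpre']; linarith [le_max_right (max τ τ') σ]
    have hev : G τ =ᶠ[𝓝 p] G τ' := by
      filter_upwards [(hopen σ).mem_nhds hp2] with w hw
      rw [hGJ τ w hw, hGJ τ' w hw]
    exact hA.eqOn_of_preconnected_of_eventuallyEq hB hpre hp1 hev (max_lt h1 h2)
  -- Near `s` all members of the family defined there agree, so the choice of half-plane is
  -- immaterial.
  refine ⟨fun s => G (s.re - 1) s, ?_, fun s hs => hGJ _ s hs⟩
  intro s
  have h1 : DifferentiableAt ℂ (G (s.re - 1)) s :=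
    (hG (s.re - 1)).differentiableAt ((hopen _).mem_nhds (by simp))
  refine h1.congr_of_eventuallyEq ?_
  filter_upwards [(hopen (s.re - 1)).mem_nhds (by simp : s.re - 1 < s.re)] with w hw
  exact key _ _ w (by simp) hw

/-- Rising factorials relate values of the Gamma function. -/
theorem Gamma_add_nat_eq_prod_of_ne_zero {w : ℂ} {j : ℕ} (hw : ∀ i < j, w + (i : ℕ) ≠ 0) :
    Gamma (w + j) = (∏ i ∈ Finset.range j, (w + i)) * Gamma w := by
  induction j with
  | zero => simp
  | succ j ih =>
    rw [Nat.cast_succ, ← add_assoc, Gamma_add_one _ (hw j (Nat.lt_succ_self j)),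
      ih fun i hi => hw i (hi.trans (Nat.lt_succ_self j)), Finset.prod_range_succ]
    ring

theorem Gamma_add_nat_eq_prod (w : ℂ) (hw : 0 < w.re) (j : ℕ) :
    Gamma (w + j) = (∏ i ∈ Finset.range j, (w + i)) * Gamma w := by
  refine Gamma_add_nat_eq_prod_of_ne_zero fun i _ h => ?_
  have := congrArg Complex.re h
  simp at this
  linarith [(Nat.cast_nonneg i : (0 : ℝ) ≤ i)]

/-- The open unit square. -/
def openSquare : Set (ℝ × ℝ) := Ioo 0 1 ×ˢ Ioo 0 1

theorem measurableSet_openSquare : MeasurableSet openSquare :=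
  measurableSet_Ioo.prod measurableSet_Ioo

theorem restrict_openSquare : (volume : Measure (ℝ × ℝ)).restrict openSquare =
    ((volume : Measure ℝ).restrict (Ioo 0 1)).prod ((volume : Measure ℝ).restrict (Ioo 0 1)) := by
  rw [openSquare, Measure.prod_restrict, Measure.volume_eq_prod]

/-- Fubini and the fundamental theorem of calculus on each line; the primitive dies at `z = 0`, so
only the side `z = 1` remains. -/
theorem integral_openSquare_deriv_fst {E : Type*} [NormedAddCommGroup E] [NormedSpace ℝ E]
    [CompleteSpace E] {G G' : ℝ → ℝ → E} {b : ℝ → E}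
    (hint : IntegrableOn (fun p : ℝ × ℝ => G' p.1 p.2) openSquare)
    (hd : ∀ u ∈ Ioo (0 : ℝ) 1, ∀ z ∈ Ioo (0 : ℝ) 1, HasDerivAt (fun z => G z u) (G' z u) z)
    (h0 : ∀ u ∈ Ioo (0 : ℝ) 1, Tendsto (fun z => G z u) (𝓝[>] 0) (𝓝 0))
    (h1 : ∀ u ∈ Ioo (0 : ℝ) 1, Tendsto (fun z => G z u) (𝓝[<] 1) (𝓝 (b u))) :
    ∫ p in openSquare, G' p.1 p.2 = ∫ u in Ioo (0 : ℝ) 1, b u := by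
  rw [IntegrableOn, restrict_openSquare] at hint
  rw [restrict_openSquare, integral_prod_symm _ hint]
  refine integral_congr_ae ?_
  filter_upwards [hint.prod_left_ae, ae_restrict_mem measurableSet_Ioo] with u hu hmem
  have hii : IntervalIntegrable (fun z => G' z u) volume 0 1 := by
    rw [intervalIntegrable_iff_integrableOn_Ioo_of_le zero_le_one]
    exact hu
  have := intervalIntegral.integral_eq_sub_of_hasDerivAt_of_tendsto zero_lt_one
    (hd u hmem) hii (h0 u hmem) (h1 u hmem)
  rw [sub_zero, intervalIntegral.integral_of_le zero_le_one, integral_Ioc_eq_integral_Ioo] at this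
  exact this

theorem integral_openSquare_deriv_snd {E : Type*} [NormedAddCommGroup E] [NormedSpace ℝ E]
    [CompleteSpace E] {G G' : ℝ → ℝ → E} {a b : ℝ → E}
    (hint : IntegrableOn (fun p : ℝ × ℝ => G' p.1 p.2) openSquare)
    (hd : ∀ z ∈ Ioo (0 : ℝ) 1, ∀ u ∈ Ioo (0 : ℝ) 1, HasDerivAt (fun u => G z u) (G' z u) u)
    (h0 : ∀ z ∈ Ioo (0 : ℝ) 1, Tendsto (fun u => G z u) (𝓝[>] 0) (𝓝 (a z)))
    (h1 : ∀ z ∈ Ioo (0 : ℝ) 1, Tendsto (fun u => G z u) (𝓝[<] 1) (𝓝 (b z))) :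
    ∫ p in openSquare, G' p.1 p.2 = ∫ z in Ioo (0 : ℝ) 1, (b z - a z) := by
  rw [IntegrableOn, restrict_openSquare] at hint
  rw [restrict_openSquare, integral_prod _ hint]
  refine integral_congr_ae ?_
  filter_upwards [hint.prod_right_ae, ae_restrict_mem measurableSet_Ioo] with z hz hmem
  have hii : IntervalIntegrable (fun u => G' z u) volume 0 1 := by
    rw [intervalIntegrable_iff_integrableOn_Ioo_of_le zero_le_one]
    exact hz
  have := intervalIntegral.integral_eq_sub_of_hasDerivAt_of_tendsto zero_lt_one
    (hd z hmem) hii (h0 z hmem) (h1 z hmem)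
  rw [intervalIntegral.integral_of_le zero_le_one, integral_Ioc_eq_integral_Ioo] at this
  exact this

end TwoPuiseux

/-! ### The quasi-homogeneous model, the integrals over the square and their convergence. -/

namespace TwoPuiseux

theorem one_sub_le_one_sub_pow {m : ℕ} (hm : 0 < m) {u : ℝ} (h0 : 0 ≤ u) (h1 : u ≤ 1) :
    1 - u ≤ 1 - u ^ m := by
  have := pow_le_of_le_one h0 h1 hm.ne'
  linarith

theorem one_sub_pow_nonneg {m : ℕ} {u : ℝ} (h0 : 0 ≤ u) (h1 : u ≤ 1) : 0 ≤ 1 - u ^ m := by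
  have := pow_le_one₀ (n := m) h0 h1
  linarith

theorem one_sub_pow_le_one {m : ℕ} {u : ℝ} (h0 : 0 ≤ u) : 1 - u ^ m ≤ 1 := by
  have := pow_nonneg h0 m
  linarith

/-- The quasi-homogeneous model `(1 - u^m)^n + z^q`. -/
def modelF (m n q : ℕ) (z u : ℝ) : ℝ := (1 - u ^ m) ^ n + z ^ q

theorem modelF_pos {m n q : ℕ} {z u : ℝ} (hz : 0 < z) (h0 : 0 ≤ u) (h1 : u ≤ 1) :
    0 < modelF m n q z u := by
  have := pow_nonneg (one_sub_pow_nonneg (m := m) h0 h1) n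
  have := pow_pos hz q
  unfold modelF
  linarith

theorem modelF_le_two {m n q : ℕ} {z u : ℝ} (hz : 0 ≤ z) (hz1 : z ≤ 1) (h0 : 0 ≤ u) (h1 : u ≤ 1) :
    modelF m n q z u ≤ 2 := by
  have := pow_le_one₀ (n := n) (one_sub_pow_nonneg (m := m) h0 h1) (one_sub_pow_le_one h0)
  have := pow_le_one₀ (n := q) hz hz1
  unfold modelF
  linarith

theorem integrableOn_rpow_Ioo {a : ℝ} (ha : 0 < a + 1) :
    IntegrableOn (fun z : ℝ => z ^ a) (Ioo 0 1) :=
  (intervalIntegral.integrableOn_Ioo_rpow_iff zero_lt_one).2 (by linarith)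

theorem integrableOn_one_sub_rpow_Ioo {a : ℝ} (ha : 0 < a + 1) :
    IntegrableOn (fun z : ℝ => (1 - z) ^ a) (Ioo 0 1) := by
  have h := (intervalIntegral.intervalIntegrable_rpow' (a := 0) (b := 1)
    (by linarith : -1 < a)).comp_sub_left 1
  simp only [sub_zero, sub_self] at h
  exact (intervalIntegrable_iff_integrableOn_Ioo_of_le zero_le_one).1 h.symm

/-- Both `z^q` and `(1 - u^m)^n` are lower bounds for the model. Splitting `r` between them in
proportion to `(a + 1) / q` and `(B + 1) / n` decouples the variables, and both resulting exponents
exceed `-1` exactly because the total weight is positive. -/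
theorem integrableOn_model {m n q : ℕ} (hm : 0 < m) (hn : 0 < n) (hq : 0 < q) (B : ℕ) {a r : ℝ}
    (hr : r ≤ 0) (ha : 0 < a + 1) (hW : 0 < n * (a + 1) + q * (B + 1) + n * q * r) :
    IntegrableOn (fun p : ℝ × ℝ => p.1 ^ a * (1 - p.2 ^ m) ^ B * modelF m n q p.1 p.2 ^ r)
      openSquare := by
  have hn' : (0 : ℝ) < n := by exact_mod_cast hn
  have hq' : (0 : ℝ) < q := by exact_mod_cast hq
  have hB : (0 : ℝ) < (B : ℝ) + 1 := by positivity
  set x : ℝ := (a + 1) / q with hx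
  set y : ℝ := (B + 1) / n with hy
  have hx0 : 0 < x := by positivity
  have hy0 : 0 < y := by positivity
  have hqx : q * x = a + 1 := by rw [hx]; field_simp
  have hny : n * y = B + 1 := by rw [hy]; field_simp
  have hxy : 0 < x + y + r := by
    have : n * q * (x + y + r) = n * (a + 1) + q * (B + 1) + n * q * r := by
      rw [← hqx, ← hny]; ring
    rw [← this] at hW
    exact pos_of_mul_pos_right hW (by positivity)
  have hsum : 0 < x + y := by linarith
  set μ : ℝ := r * (x / (x + y)) with hμ
  set ν : ℝ := r * (y / (x + y)) with hν
  have hμν : μ + ν = r := by rw [hμ, hν]; field_simp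
  have hμ0 : μ ≤ 0 := mul_nonpos_of_nonpos_of_nonneg hr (by positivity)
  have hν0 : ν ≤ 0 := mul_nonpos_of_nonpos_of_nonneg hr (by positivity)
  have hxμ : 0 < x + μ := by
    have : x + μ = x / (x + y) * (x + y + r) := by rw [hμ]; field_simp
    rw [this]; positivity
  have hyν : 0 < y + ν := by
    have : y + ν = y / (x + y) * (x + y + r) := by rw [hν]; field_simp
    rw [this]; positivity
  have hz1 : 0 < (a + q * μ) + 1 := by
    have : (a + q * μ) + 1 = q * (x + μ) := by rw [mul_add, hqx]; ring
    rw [this]; positivity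
  have hu1 : 0 < (B + n * ν) + 1 := by
    have : (B + n * ν) + 1 = n * (y + ν) := by rw [mul_add, hny]; ring
    rw [this]; positivity
  -- The minimum with `0` is needed because `1 - u ≤ 1 - u^m` reverses only for nonpositive
  -- exponents; positive powers are bounded by `1`.
  have hdom : IntegrableOn
      (fun p : ℝ × ℝ => p.1 ^ (a + q * μ) * (1 - p.2) ^ (min (B + n * ν) 0)) openSquare := by
    rw [IntegrableOn, restrict_openSquare]
    refine Integrable.mul_prod (integrableOn_rpow_Ioo hz1) (integrableOn_one_sub_rpow_Ioo ?_)
    rcases min_choice (B + n * ν) 0 with h | h <;> rw [h] <;> linarith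
  refine Integrable.mono' hdom ?_ ?_
  · refine Measurable.aestronglyMeasurable ?_
    unfold modelF
    fun_prop
  · filter_upwards [ae_restrict_mem measurableSet_openSquare] with p hp
    obtain ⟨⟨hz, hz'⟩, hu, hu'⟩ := hp
    have hg1 : 1 - p.2 ≤ 1 - p.2 ^ m := one_sub_le_one_sub_pow hm hu.le hu'.le
    have hu2 : 0 < 1 - p.2 := by linarith
    have hg : 0 < 1 - p.2 ^ m := by linarith
    have hgle : 1 - p.2 ^ m ≤ 1 := one_sub_pow_le_one hu.le
    have hF : 0 < modelF m n q p.1 p.2 := modelF_pos hz hu.le hu'.le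
    have hzq := pow_pos hz q
    have hgn := pow_pos hg n
    rw [Real.norm_of_nonneg (by positivity)]
    have e1 : modelF m n q p.1 p.2 ^ μ ≤ p.1 ^ (q * μ) := by
      rw [Real.rpow_mul hz.le, Real.rpow_natCast]
      exact Real.rpow_le_rpow_of_nonpos hzq (by unfold modelF; linarith) hμ0
    have e2 : modelF m n q p.1 p.2 ^ ν ≤ (1 - p.2 ^ m) ^ (n * ν) := by
      rw [Real.rpow_mul hg.le, Real.rpow_natCast]
      exact Real.rpow_le_rpow_of_nonpos hgn (by unfold modelF; linarith) hν0
    have e3 : (1 - p.2 ^ m) ^ (B + n * ν) ≤ (1 - p.2) ^ (min (B + n * ν) 0) :=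
      (Real.rpow_le_rpow_of_exponent_ge hg hgle (min_le_left _ _)).trans
        (Real.rpow_le_rpow_of_nonpos hu2 hg1 (min_le_right _ _))
    calc p.1 ^ a * (1 - p.2 ^ m) ^ B * modelF m n q p.1 p.2 ^ r
        = p.1 ^ a * (1 - p.2 ^ m) ^ B * (modelF m n q p.1 p.2 ^ μ * modelF m n q p.1 p.2 ^ ν) := by
          rw [← Real.rpow_add hF, hμν]
      _ ≤ p.1 ^ a * (1 - p.2 ^ m) ^ B * (p.1 ^ (q * μ) * (1 - p.2 ^ m) ^ (n * ν)) := by gcongr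
      _ = p.1 ^ (a + q * μ) * (1 - p.2 ^ m) ^ (B + n * ν) := by
          rw [Real.rpow_add hz, Real.rpow_add hg, Real.rpow_natCast]; ring
      _ ≤ _ := by gcongr

/-- One power of `F` dominates all exponents in a compact interval: the nonpositive part uses the
lower bound for `y`, the rest its upper bound. -/
theorem exists_rpow_le_mul_rpow_min {c T : ℝ} (hc : 0 < c) (hT : 1 ≤ T) (σ₁ σ₂ : ℝ) :
    ∃ K : ℝ, 0 ≤ K ∧ ∀ r ∈ Icc σ₁ σ₂, ∀ F : ℝ, 0 < F → ∀ y : ℝ, c * F ≤ y → y ≤ T →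
      y ^ r ≤ K * F ^ (min σ₁ 0) := by
  refine ⟨(c ^ (min σ₁ 0)) * T ^ |σ₂ - min σ₁ 0|, by positivity, ?_⟩
  rintro r ⟨hr1, hr2⟩ F hF y hy hyT
  have hcF : 0 < c * F := mul_pos hc hF
  have hy0 : 0 < y := hcF.trans_le hy
  have hr3 : 0 ≤ r - min σ₁ 0 := by linarith [min_le_left σ₁ 0]
  have e1 : y ^ (min σ₁ 0) ≤ (c * F) ^ (min σ₁ 0) :=
    Real.rpow_le_rpow_of_nonpos hcF hy (min_le_right _ _)
  have e2 : y ^ (r - min σ₁ 0) ≤ T ^ |σ₂ - min σ₁ 0| :=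
    (Real.rpow_le_rpow hy0.le hyT hr3).trans
      (Real.rpow_le_rpow_of_exponent_le hT (le_trans (by linarith) (le_abs_self _)))
  calc y ^ r = y ^ (min σ₁ 0) * y ^ (r - min σ₁ 0) := by
        rw [← Real.rpow_add hy0]; congr 1; ring
    _ ≤ (c * F) ^ (min σ₁ 0) * T ^ |σ₂ - min σ₁ 0| := by gcongr
    _ = _ := by rw [Real.mul_rpow hc.le hF.le]; ring

/-- Exponents of `f = (1 - u^m)^n + z^q u^b + t z^e (1 - u^m)^l u^c`, whose last monomial has
weight `n q + k` when `z` has weight `n` and `1 - u^m` has weight `q`, together with the exponent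
`M` of the extra factor `z^M` and a common divisor `d` of all shifts of weights. -/
structure Datum where
  m : ℕ
  n : ℕ
  q : ℕ
  b : ℕ
  e : ℕ
  l : ℕ
  c : ℕ
  k : ℕ
  M : ℕ
  d : ℕ
  t : ℝ
  hm : 0 < m
  hn : 0 < n
  hq : 0 < q
  he : 0 < e
  hk : 0 < k
  hM : 0 < M
  hd : 0 < d
  ht : 0 ≤ t
  weight : n * e + q * l = n * q + k
  dvd_q : d ∣ q
  dvd_e : d ∣ e
  dvd_k : d ∣ k

namespace Datum

variable (S : Datum)

/-- The function `(1 - u^m)^n + z^q u^b + t z^e (1 - u^m)^l u^c`. -/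
def f (z u : ℝ) : ℝ :=
  (1 - u ^ S.m) ^ S.n + z ^ S.q * u ^ S.b + S.t * z ^ S.e * (1 - u ^ S.m) ^ S.l * u ^ S.c

/-- The factor `u^b` degenerates only at `u = 0`, where `1 - u^m` is bounded below. Hence the cut at
`u = 1 / 2`: above it `u^b ≥ 2^(-b)`, below it the first term alone beats the bounded model. -/
theorem const_mul_modelF_le {z u : ℝ} (hz : 0 ≤ z) (hz1 : z ≤ 1) (h0 : 0 ≤ u) (h1 : u ≤ 1) :
    (1 / 2 : ℝ) ^ (S.b + S.n + 1) * modelF S.m S.n S.q z u ≤ S.f z u := by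
  have hg := one_sub_pow_nonneg (m := S.m) h0 h1
  have hgn := pow_nonneg hg S.n
  have hzq := pow_nonneg hz S.q
  have ht := S.ht
  have hlast : 0 ≤ S.t * z ^ S.e * (1 - u ^ S.m) ^ S.l * u ^ S.c := by positivity
  rcases le_total (1 / 2) u with h | h
  · have hub : (1 / 2 : ℝ) ^ (S.b + S.n + 1) ≤ u ^ S.b := by
      calc (1 / 2 : ℝ) ^ (S.b + S.n + 1) ≤ (1 / 2) ^ S.b :=
            pow_le_pow_of_le_one (by norm_num) (by norm_num) (by omega)
        _ ≤ u ^ S.b := by gcongr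
    have h1' : (1 / 2 : ℝ) ^ (S.b + S.n + 1) ≤ 1 := pow_le_one₀ (by norm_num) (by norm_num)
    unfold modelF f
    nlinarith [mul_le_mul_of_nonneg_right hub hzq, mul_le_mul_of_nonneg_right h1' hgn]
  · have hg2 : (1 / 2 : ℝ) ^ S.n ≤ (1 - u ^ S.m) ^ S.n := by
      have := one_sub_le_one_sub_pow S.hm h0 h1
      exact pow_le_pow_left₀ (by norm_num) (by linarith) _
    have hF := modelF_le_two (m := S.m) (n := S.n) (q := S.q) hz hz1 h0 h1
    have hF0 : 0 ≤ modelF S.m S.n S.q z u := by unfold modelF; positivity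
    calc (1 / 2 : ℝ) ^ (S.b + S.n + 1) * modelF S.m S.n S.q z u
        ≤ (1 / 2 : ℝ) ^ (S.n + 1) * 2 := by
          have : (1 / 2 : ℝ) ^ (S.b + S.n + 1) ≤ (1 / 2) ^ (S.n + 1) :=
            pow_le_pow_of_le_one (by norm_num) (by norm_num) (by omega)
          gcongr
      _ = (1 / 2 : ℝ) ^ S.n := by rw [pow_succ]; ring
      _ ≤ (1 - u ^ S.m) ^ S.n := hg2
      _ ≤ S.f z u := by
          have : 0 ≤ z ^ S.q * u ^ S.b := by positivity
          unfold f
          linarith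

theorem f_pos {z u : ℝ} (hz : 0 < z) (hz1 : z ≤ 1) (h0 : 0 ≤ u) (h1 : u ≤ 1) : 0 < S.f z u :=
  lt_of_lt_of_le (mul_pos (by positivity) (modelF_pos hz h0 h1))
    (S.const_mul_modelF_le hz.le hz1 h0 h1)

theorem f_le {z u : ℝ} (hz : 0 ≤ z) (hz1 : z ≤ 1) (h0 : 0 ≤ u) (h1 : u ≤ 1) :
    S.f z u ≤ 2 + S.t := by
  have hg := one_sub_pow_nonneg (m := S.m) h0 h1
  have hg1 := one_sub_pow_le_one (m := S.m) h0
  have ht := S.ht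
  have e1 : (1 - u ^ S.m) ^ S.n ≤ 1 := pow_le_one₀ hg hg1
  have e2 : z ^ S.q * u ^ S.b ≤ 1 :=
    mul_le_one₀ (pow_le_one₀ hz hz1) (by positivity) (pow_le_one₀ h0 h1)
  have e3 : z ^ S.e * ((1 - u ^ S.m) ^ S.l * u ^ S.c) ≤ 1 :=
    mul_le_one₀ (pow_le_one₀ hz hz1) (by positivity)
      (mul_le_one₀ (pow_le_one₀ hg hg1) (by positivity) (pow_le_one₀ h0 h1))
  have := mul_le_mul_of_nonneg_left e3 ht
  unfold f
  linarith

theorem exists_f_rpow_le (σ₁ σ₂ : ℝ) : ∃ K : ℝ, 0 ≤ K ∧ ∀ r ∈ Icc σ₁ σ₂, ∀ z ∈ Ioc (0 : ℝ) 1,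
    ∀ u ∈ Icc (0 : ℝ) 1, S.f z u ^ r ≤ K * modelF S.m S.n S.q z u ^ (min σ₁ 0) := by
  obtain ⟨K, hK0, hK⟩ := exists_rpow_le_mul_rpow_min (c := (1 / 2 : ℝ) ^ (S.b + S.n + 1))
    (T := 2 + S.t) (by positivity) (by linarith [S.ht]) σ₁ σ₂
  refine ⟨K, hK0, fun r hr z hz u hu => ?_⟩
  exact hK r hr _ (modelF_pos hz.1 hu.1 hu.2) _ (S.const_mul_modelF_le hz.1.le hz.2 hu.1 hu.2)
    (S.f_le hz.1.le hz.2 hu.1 hu.2)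

/-- The integrand `z^(M s + A) (1 - u^m)^B u^C f^(s - N)`. -/
noncomputable def kernel (A B C N : ℕ) (s : ℂ) (p : ℝ × ℝ) : ℂ :=
  (p.1 : ℂ) ^ ((S.M : ℂ) * s + A) * (((1 - p.2 ^ S.m) ^ B * p.2 ^ C : ℝ) : ℂ) *
    ((S.f p.1 p.2 : ℝ) : ℂ) ^ (s - N)

/-- The integral of `kernel` over the open unit square. -/
noncomputable def J (A B C N : ℕ) (s : ℂ) : ℂ := ∫ p in openSquare, S.kernel A B C N s p

/-- The affine function vanishing at the first pole contributed by `z = 0`. -/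
def X (A : ℕ) (s : ℂ) : ℂ := S.M * s + A + 1

/-- The affine function vanishing at the first pole contributed by the quasi-homogeneous blow-up. -/
def W (A B N : ℕ) (s : ℂ) : ℂ := S.n * S.X A s + S.q * (B + 1) + S.n * S.q * (s - N)

theorem X_re (A : ℕ) (s : ℂ) : (S.X A s).re = S.M * s.re + A + 1 := by simp [X]

theorem W_re (A B N : ℕ) (s : ℂ) :
    (S.W A B N s).re = S.n * (S.M * s.re + A + 1) + S.q * (B + 1) + S.n * S.q * (s.re - N) := by
  have : S.W A B N s = (S.n * (S.X A s)) + ((S.q * (B + 1) : ℝ) : ℂ) +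
      ((S.n * S.q : ℝ) : ℂ) * (s - N) := by
    simp [W]
  rw [this, add_re, add_re, re_ofReal_mul, ofReal_re, ← X_re]
  have h2 : ((S.n : ℂ) * S.X A s).re = S.n * (S.X A s).re := by
    rw [← ofReal_natCast, re_ofReal_mul]
  rw [h2]
  simp

theorem measurable_f : Measurable fun p : ℝ × ℝ => S.f p.1 p.2 := by
  unfold f; fun_prop

theorem measurable_kernel (A B C N : ℕ) (s : ℂ) : Measurable (S.kernel A B C N s) := by
  have := S.measurable_f
  unfold kernel
  fun_prop

theorem norm_kernel {z u : ℝ} (hz : 0 < z) (hz1 : z ≤ 1) (h0 : 0 ≤ u) (h1 : u ≤ 1)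
    (A B C N : ℕ) (s : ℂ) : ‖S.kernel A B C N s (z, u)‖ =
      z ^ (S.M * s.re + A) * ((1 - u ^ S.m) ^ B * u ^ C) * S.f z u ^ (s.re - N) := by
  have hg := one_sub_pow_nonneg (m := S.m) h0 h1
  have hf := S.f_pos hz hz1 h0 h1
  rw [kernel, norm_mul, norm_mul, norm_cpow_eq_rpow_re_of_pos hz, norm_cpow_eq_rpow_re_of_pos hf,
    norm_real, Real.norm_of_nonneg (by positivity)]
  simp

/-- The bound is uniform on a vertical strip, which is what holomorphy in `s` requires. -/
theorem exists_norm_kernel_le (A B C N : ℕ) (σ₁ σ₂ : ℝ) : ∃ K : ℝ, 0 ≤ K ∧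
    ∀ s : ℂ, s.re ∈ Icc σ₁ σ₂ → ∀ p ∈ openSquare, ‖S.kernel A B C N s p‖ ≤
      K * (p.1 ^ (S.M * σ₁ + A) * (1 - p.2 ^ S.m) ^ B *
        modelF S.m S.n S.q p.1 p.2 ^ (min (σ₁ - N) 0)) := by
  obtain ⟨K, hK0, hK⟩ := S.exists_f_rpow_le (σ₁ - N) (σ₂ - N)
  refine ⟨K, hK0, ?_⟩
  rintro s ⟨hs1, hs2⟩ ⟨z, u⟩ ⟨⟨hz, hz1⟩, hu, hu1⟩
  dsimp only at hz hz1 hu hu1 ⊢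
  rw [S.norm_kernel hz hz1.le hu.le hu1.le]
  have hg := one_sub_pow_nonneg (m := S.m) hu.le hu1.le
  have hF := modelF_pos (m := S.m) (n := S.n) (q := S.q) hz hu.le hu1.le
  have e1 : z ^ (S.M * s.re + A) ≤ z ^ (S.M * σ₁ + A) :=
    Real.rpow_le_rpow_of_exponent_ge hz hz1.le (by gcongr)
  have e2 : (1 - u ^ S.m) ^ B * u ^ C ≤ (1 - u ^ S.m) ^ B :=
    mul_le_of_le_one_right (by positivity) (pow_le_one₀ hu.le hu1.le)
  have e3 := hK (s.re - N) ⟨by linarith, by linarith⟩ z ⟨hz, hz1.le⟩ u ⟨hu.le, hu1.le⟩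
  calc _ ≤ z ^ (S.M * σ₁ + A) * (1 - u ^ S.m) ^ B *
        (K * modelF S.m S.n S.q z u ^ (min (σ₁ - N) 0)) := by
        have := (Real.rpow_pos_of_pos (S.f_pos hz hz1.le hu.le hu1.le) (s.re - N)).le
        gcongr
    _ = _ := by ring

theorem integrableOn_model_min (A B N : ℕ) {σ : ℝ} (hX : 0 < S.M * σ + A + 1)
    (hW : 0 < S.n * (S.M * σ + A + 1) + S.q * (B + 1) + S.n * S.q * (σ - N)) :
    IntegrableOn (fun p : ℝ × ℝ => p.1 ^ (S.M * σ + A) * (1 - p.2 ^ S.m) ^ B *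
        modelF S.m S.n S.q p.1 p.2 ^ (min (σ - N) 0)) openSquare := by
  refine integrableOn_model S.hm S.hn S.hq B (min_le_right _ _) hX ?_
  have hn' : (0 : ℝ) < S.n := by exact_mod_cast S.hn
  rcases min_choice (σ - N) 0 with h | h <;> rw [h]
  · exact hW
  · rw [mul_zero, add_zero]; positivity

theorem integrableOn_kernel (A B C N : ℕ) {s : ℂ} (hX : 0 < (S.X A s).re)
    (hW : 0 < (S.W A B N s).re) : IntegrableOn (S.kernel A B C N s) openSquare := by
  rw [X_re] at hX
  rw [W_re] at hW
  obtain ⟨K, -, hK⟩ := S.exists_norm_kernel_le A B C N s.re s.re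
  refine Integrable.mono' ((S.integrableOn_model_min A B N hX hW).const_mul K)
    (S.measurable_kernel A B C N s).aestronglyMeasurable ?_
  filter_upwards [ae_restrict_mem measurableSet_openSquare] with p hp
  exact hK s ⟨le_rfl, le_rfl⟩ p hp

theorem differentiable_kernel (A B C N : ℕ) {p : ℝ × ℝ} (hp : p ∈ openSquare) :
    Differentiable ℂ fun s => S.kernel A B C N s p := by
  obtain ⟨⟨hz, hz1⟩, hu, hu1⟩ := hp
  have hf := S.f_pos hz hz1.le hu.le hu1.le
  have hz' : (p.1 : ℂ) ≠ 0 := by exact_mod_cast hz.ne'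
  have hf' : ((S.f p.1 p.2 : ℝ) : ℂ) ≠ 0 := by exact_mod_cast hf.ne'
  unfold kernel
  intro s
  refine ((DifferentiableAt.const_cpow (by fun_prop) (Or.inl hz')).mul_const _).mul
    (DifferentiableAt.const_cpow (by fun_prop) (Or.inl hf'))

/-- A linear inequality that holds strictly at `σ` holds slightly to the left of `σ`. -/
theorem exists_lt_affine_pos {a b a' b' σ : ℝ} (h : 0 < a * σ + b) (h' : 0 < a' * σ + b') :
    ∃ ε > 0, 0 < a * (σ - ε) + b ∧ 0 < a' * (σ - ε) + b' := by
  have hc : ∀ a b : ℝ, 0 < a * σ + b → ∀ᶠ ε in 𝓝[>] (0 : ℝ), 0 < a * (σ - ε) + b := by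
    intro a b h
    have : Tendsto (fun ε : ℝ => a * (σ - ε) + b) (𝓝 0) (𝓝 (a * (σ - 0) + b)) :=
      Continuous.tendsto (by fun_prop) 0
    exact nhdsWithin_le_nhds (this.eventually_const_lt (by simpa using h))
  obtain ⟨ε, h1, h2, h3⟩ := ((hc a b h).and ((hc a' b' h').and self_mem_nhdsWithin)).exists
  exact ⟨ε, h3, h1, h2⟩

theorem differentiableAt_J (A B C N : ℕ) {s : ℂ} (hX : 0 < (S.X A s).re)
    (hW : 0 < (S.W A B N s).re) : DifferentiableAt ℂ (S.J A B C N) s := by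
  rw [X_re] at hX
  rw [W_re] at hW
  obtain ⟨ε, hε, h1, h2⟩ := exists_lt_affine_pos (a := S.M) (b := A + 1) (σ := s.re)
    (a' := S.n * S.M + S.n * S.q) (b' := S.n * (A + 1) + S.q * (B + 1) - S.n * S.q * N)
    (by linarith) (by linarith)
  obtain ⟨K, -, hK⟩ := S.exists_norm_kernel_le A B C N (s.re - ε) (s.re + ε)
  refine differentiableAt_integral_of_bound hε
    (fun s _ => (S.measurable_kernel A B C N s).aestronglyMeasurable) ?_
    ((S.integrableOn_model_min A B N (σ := s.re - ε) (by linarith) (by linarith)).const_mul K) ?_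
  · filter_upwards [ae_restrict_mem measurableSet_openSquare] with p hp
    exact (S.differentiable_kernel A B C N hp).differentiableOn
  · filter_upwards [ae_restrict_mem measurableSet_openSquare] with p hp w hw
    refine hK w ?_ p hp
    have := (abs_re_le_norm (w - s)).trans_lt (mem_ball_iff_norm.1 hw)
    rw [sub_re, abs_lt] at this
    exact ⟨by linarith, by linarith⟩

end Datum

end TwoPuiseux

/-! ### Differentiating the kernel: the `z` direction, the `u` direction, the Euler identity. -/

namespace TwoPuiseux

theorem natCast_mul_pow_sub_one_mul {R : Type*} [CommRing R] (b : ℕ) (x : R) :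
    (b : R) * x ^ (b - 1) * x = b * x ^ b := by
  cases b with
  | zero => simp
  | succ b => rw [Nat.add_sub_cancel, mul_assoc, ← pow_succ]

theorem hasDerivAt_ofReal_cpow_comp {g : ℝ → ℝ} {g' x : ℝ} (hg : HasDerivAt g g' x)
    (hpos : 0 < g x) (c : ℂ) :
    HasDerivAt (fun x => ((g x : ℝ) : ℂ) ^ c) (c * ((g x : ℝ) : ℂ) ^ (c - 1) * (g' : ℂ)) x := by
  have h1 := (hasDerivAt_id ((g x : ℝ) : ℂ)).cpow_const (c := c) (ofReal_mem_slitPlane.2 hpos)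
  have h2 := HasDerivAt.comp x h1 hg.ofReal_comp
  simpa [Function.comp_def] using h2

theorem cpow_eq_cpow_sub_one_mul {x : ℂ} (hx : x ≠ 0) (c : ℂ) : x ^ c = x ^ (c - 1) * x := by
  rw [cpow_sub _ _ hx, cpow_one, div_mul_cancel₀ _ hx]

namespace Datum

variable (S : Datum)

/-- The boundary integral of `(1 - u^m)^B u^C f^(s - N)` over the side `z = 1`. -/
noncomputable def bdry (B C N : ℕ) (s : ℂ) : ℂ :=
  ∫ u in Ioo (0 : ℝ) 1, (((1 - u ^ S.m) ^ B * u ^ C : ℝ) : ℂ) * ((S.f 1 u : ℝ) : ℂ) ^ (s - N)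

theorem differentiable_bdry (B C N : ℕ) : Differentiable ℂ (S.bdry B C N) := by
  intro s
  obtain ⟨K, hK0, hK⟩ := S.exists_f_rpow_le (s.re - 1 - N) (s.re + 1 - N)
  refine differentiableAt_integral_of_bound (r := 1) one_pos (bound := fun _ => K) ?_ ?_ ?_ ?_
  · intro w _
    have : Measurable fun u => S.f 1 u := by unfold f; fun_prop
    exact Measurable.aestronglyMeasurable (by fun_prop)
  · filter_upwards [ae_restrict_mem measurableSet_Ioo] with u hu w hw
    have hf : ((S.f 1 u : ℝ) : ℂ) ≠ 0 := by
      exact_mod_cast (S.f_pos one_pos le_rfl hu.1.le hu.2.le).ne'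
    exact ((DifferentiableAt.const_cpow (by fun_prop) (Or.inl hf)).const_mul
      _).differentiableWithinAt
  · exact integrable_const K
  · filter_upwards [ae_restrict_mem measurableSet_Ioo] with u hu w hw
    have hf := S.f_pos one_pos le_rfl hu.1.le hu.2.le
    have hg := one_sub_pow_nonneg (m := S.m) hu.1.le hu.2.le
    have hw' := (abs_re_le_norm (w - s)).trans_lt (mem_ball_iff_norm.1 hw)
    rw [sub_re, abs_lt] at hw'
    have h1 := hK (w.re - N) ⟨by linarith, by linarith⟩ 1 ⟨one_pos, le_rfl⟩ u ⟨hu.1.le, hu.2.le⟩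
    have h2 : modelF S.m S.n S.q 1 u ^ (min (s.re - 1 - N) 0) ≤ 1 := by
      refine Real.rpow_le_one_of_one_le_of_nonpos ?_ (min_le_right _ _)
      have := pow_nonneg hg S.n
      unfold modelF
      rw [one_pow]
      linarith
    have h3 : (1 - u ^ S.m) ^ B * u ^ C ≤ 1 :=
      mul_le_one₀ (pow_le_one₀ hg (one_sub_pow_le_one hu.1.le)) (pow_nonneg hu.1.le _)
        (pow_le_one₀ hu.1.le hu.2.le)
    rw [norm_mul, norm_cpow_eq_rpow_re_of_pos hf, norm_real,
      Real.norm_of_nonneg (mul_nonneg (pow_nonneg hg _) (pow_nonneg hu.1.le _))]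
    simp only [sub_re, natCast_re]
    calc _ ≤ 1 * (K * 1) := by
          have := (Real.rpow_pos_of_pos hf (w.re - N)).le
          gcongr
          exact h1.trans (by gcongr)
      _ = K := by ring

theorem kernel_add (A B C N i j h : ℕ) (s : ℂ) {z u : ℝ} (hz : 0 < z) :
    S.kernel (A + i) (B + j) (C + h) N s (z, u) =
      S.kernel A B C N s (z, u) * ((z : ℂ) ^ i * (1 - (u : ℂ) ^ S.m) ^ j * (u : ℂ) ^ h) := by
  have hz' : (z : ℂ) ≠ 0 := by exact_mod_cast hz.ne'
  have e : (z : ℂ) ^ ((S.M : ℂ) * s + (A + i : ℕ)) = (z : ℂ) ^ ((S.M : ℂ) * s + A) * (z : ℂ) ^ i := by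
    rw [Nat.cast_add, ← add_assoc, cpow_add _ _ hz', cpow_natCast]
  simp only [kernel, e]
  push_cast
  ring

theorem kernel_eq_mul_f (A B C N : ℕ) (s : ℂ) {z u : ℝ} (hf : 0 < S.f z u) :
    S.kernel A B C N s (z, u) = S.kernel A B C (N + 1) s (z, u) * ((S.f z u : ℝ) : ℂ) := by
  have hf' : ((S.f z u : ℝ) : ℂ) ≠ 0 := by exact_mod_cast hf.ne'
  have e : ((S.f z u : ℝ) : ℂ) ^ (s - N) =
      ((S.f z u : ℝ) : ℂ) ^ (s - (N + 1 : ℕ)) * ((S.f z u : ℝ) : ℂ) := by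
    nth_rewrite 3 [← cpow_one ((S.f z u : ℝ) : ℂ)]
    rw [← cpow_add _ _ hf']
    congr 1
    push_cast
    ring
  simp only [kernel, e]
  ring

theorem ofReal_f (z u : ℝ) : ((S.f z u : ℝ) : ℂ) = (1 - (u : ℂ) ^ S.m) ^ S.n +
    (z : ℂ) ^ S.q * (u : ℂ) ^ S.b +
    S.t * (z : ℂ) ^ S.e * (1 - (u : ℂ) ^ S.m) ^ S.l * (u : ℂ) ^ S.c := by
  simp [f]

/-- The derivative of `z * kernel` in the direction of `z`. -/
noncomputable def kernelZ (A B C N : ℕ) (s : ℂ) (p : ℝ × ℝ) : ℂ :=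
  S.X A s * S.kernel A B C N s p + (s - N) * (S.q * S.kernel (A + S.q) B (C + S.b) (N + 1) s p +
    S.t * S.e * S.kernel (A + S.e) (B + S.l) (C + S.c) (N + 1) s p)

theorem hasDerivAt_kernelZ (A B C N : ℕ) (s : ℂ) {z u : ℝ} (hz : 0 < z) (hf : 0 < S.f z u) :
    HasDerivAt (fun z : ℝ => (z : ℂ) * S.kernel A B C N s (z, u)) (S.kernelZ A B C N s (z, u)) z := by
  have hz' : (z : ℂ) ≠ 0 := by exact_mod_cast hz.ne'
  have hf1 : HasDerivAt (fun z => S.f z u) (S.q * z ^ (S.q - 1) * u ^ S.b +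
      S.t * (S.e * z ^ (S.e - 1)) * (1 - u ^ S.m) ^ S.l * u ^ S.c) z := by
    unfold f
    exact ((((hasDerivAt_pow S.q z).mul_const _).const_add _).add
      ((((hasDerivAt_pow S.e z).const_mul _).mul_const _).mul_const _))
  have hF := hasDerivAt_ofReal_cpow_comp hf1 hf (s - N)
  have hZ := hasDerivAt_ofReal_cpow_comp (hasDerivAt_id z) hz ((S.M : ℂ) * s + A)
  have hZ1 := (hasDerivAt_id z).ofReal_comp
  have := hZ1.mul ((hZ.mul_const (((1 - u ^ S.m) ^ B * u ^ C : ℝ) : ℂ)).mul hF)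
  refine this.congr_deriv ?_
  have hf' : ((S.f z u : ℝ) : ℂ) ≠ 0 := by exact_mod_cast hf.ne'
  have e1 := cpow_eq_cpow_sub_one_mul hz' ((S.M : ℂ) * s + A)
  have e2 := cpow_eq_cpow_sub_one_mul hf' (s - N)
  have e3 : s - (N + 1 : ℕ) = s - N - 1 := by push_cast; ring
  have q1 := natCast_mul_pow_sub_one_mul S.q (z : ℂ)
  have q2 := natCast_mul_pow_sub_one_mul S.e (z : ℂ)
  have k1 := S.kernel_add A B C (N + 1) S.q 0 S.b s (u := u) hz
  have k2 := S.kernel_add A B C (N + 1) S.e S.l S.c s (u := u) hz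
  rw [Nat.add_zero] at k1
  rw [kernelZ, k1, k2]
  simp only [kernel, X, id, e3, Pi.mul_apply]
  rw [e1, e2]
  push_cast
  generalize ((z : ℂ) ^ ((S.M : ℂ) * s + A - 1)) = a
  generalize ((S.f z u : ℝ) : ℂ) ^ (s - N - 1) = y
  generalize ((S.f z u : ℝ) : ℂ) = w
  linear_combination ((s - N) * a * z * (1 - (u : ℂ) ^ S.m) ^ B * (u : ℂ) ^ C * y) *
    ((u : ℂ) ^ S.b * q1 + S.t * (1 - (u : ℂ) ^ S.m) ^ S.l * (u : ℂ) ^ S.c * q2)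

/-- The derivative of `u (1 - u^m) * kernel` in the direction of `u`. -/
noncomputable def kernelU (A B C N : ℕ) (s : ℂ) (p : ℝ × ℝ) : ℂ :=
  -(S.m * (B + 1)) * S.kernel A B C N s p +
    (S.m * (B + 1) + (C + 1)) * S.kernel A (B + 1) C N s p +
    (s - N) * (-(S.n * S.m) * S.kernel A (B + S.n) C (N + 1) s p +
      S.n * S.m * S.kernel A (B + S.n + 1) C (N + 1) s p +
      S.b * S.kernel (A + S.q) (B + 1) (C + S.b) (N + 1) s p +
      S.t * (-(S.l * S.m) * S.kernel (A + S.e) (B + S.l) (C + S.c) (N + 1) s p +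
        (S.l * S.m + S.c) * S.kernel (A + S.e) (B + S.l + 1) (C + S.c) (N + 1) s p))

theorem hasDerivAt_kernelU (A B C N : ℕ) (s : ℂ) {z u : ℝ} (hz : 0 < z) (hf : 0 < S.f z u) :
    HasDerivAt (fun u : ℝ => (u : ℂ) * (1 - (u : ℂ) ^ S.m) * S.kernel A B C N s (z, u))
      (S.kernelU A B C N s (z, u)) u := by
  have hg : HasDerivAt (fun u : ℝ => 1 - u ^ S.m) (-(S.m * u ^ (S.m - 1))) u :=
    (hasDerivAt_pow S.m u).const_sub 1
  have hf1 : HasDerivAt (fun u => S.f z u)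
      (S.n * (1 - u ^ S.m) ^ (S.n - 1) * (-(S.m * u ^ (S.m - 1))) +
        z ^ S.q * (S.b * u ^ (S.b - 1)) +
        ((S.t * z ^ S.e) * (S.l * (1 - u ^ S.m) ^ (S.l - 1) * (-(S.m * u ^ (S.m - 1)))) * u ^ S.c +
          S.t * z ^ S.e * (1 - u ^ S.m) ^ S.l * (S.c * u ^ (S.c - 1)))) u := by
    unfold f
    exact ((hg.pow S.n).add ((hasDerivAt_pow S.b u).const_mul _)).add
      (((hg.pow S.l).const_mul (S.t * z ^ S.e)).mul (hasDerivAt_pow S.c u))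
  have hF := hasDerivAt_ofReal_cpow_comp hf1 hf (s - N)
  have hm1 : HasDerivAt (fun u : ℝ => (1 - u ^ S.m) ^ B * u ^ C) _ u :=
    (hg.pow B).mul (hasDerivAt_pow C u)
  have hU := (hasDerivAt_id u).ofReal_comp.mul hg.ofReal_comp
  have := hU.mul (((hm1.ofReal_comp).const_mul ((z : ℂ) ^ ((S.M : ℂ) * s + A))).mul hF)
  have hfun : (fun u : ℝ => (u : ℂ) * (1 - (u : ℂ) ^ S.m) * S.kernel A B C N s (z, u)) =
      fun u : ℝ => ((u : ℝ) : ℂ) * (((1 - u ^ S.m : ℝ)) : ℂ) *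
        ((z : ℂ) ^ ((S.M : ℂ) * s + A) * (((1 - u ^ S.m) ^ B * u ^ C : ℝ) : ℂ) *
          ((S.f z u : ℝ) : ℂ) ^ (s - N)) := by
    funext u
    simp only [kernel]
    push_cast
    ring
  rw [hfun]
  refine this.congr_deriv ?_
  have hf' : ((S.f z u : ℝ) : ℂ) ≠ 0 := by exact_mod_cast hf.ne'
  have e2 := cpow_eq_cpow_sub_one_mul hf' (s - N)
  have e3 : s - (N + 1 : ℕ) = s - N - 1 := by push_cast; ring
  have qm := natCast_mul_pow_sub_one_mul S.m (u : ℂ)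
  have qb := natCast_mul_pow_sub_one_mul S.b (u : ℂ)
  have qc := natCast_mul_pow_sub_one_mul S.c (u : ℂ)
  have qC := natCast_mul_pow_sub_one_mul C (u : ℂ)
  have qn := natCast_mul_pow_sub_one_mul S.n (1 - (u : ℂ) ^ S.m)
  have ql := natCast_mul_pow_sub_one_mul S.l (1 - (u : ℂ) ^ S.m)
  have qB := natCast_mul_pow_sub_one_mul B (1 - (u : ℂ) ^ S.m)
  have k0 := S.kernel_add A B C N 0 1 0 s (u := u) hz
  have k1 := S.kernel_add A B C (N + 1) 0 S.n 0 s (u := u) hz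
  have k2 := S.kernel_add A B C (N + 1) 0 (S.n + 1) 0 s (u := u) hz
  have k3 := S.kernel_add A B C (N + 1) S.q 1 S.b s (u := u) hz
  have k4 := S.kernel_add A B C (N + 1) S.e S.l S.c s (u := u) hz
  have k5 := S.kernel_add A B C (N + 1) S.e (S.l + 1) S.c s (u := u) hz
  simp only [Nat.add_zero, ← Nat.add_assoc] at k0 k1 k2 k3 k4 k5
  rw [kernelU, k0, k1, k2, k3, k4, k5]
  simp only [kernel, id, e3, Pi.mul_apply, Pi.pow_apply]
  rw [e2]
  push_cast
  generalize ((z : ℂ) ^ ((S.M : ℂ) * s + A)) = a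
  generalize ((S.f z u : ℝ) : ℂ) ^ (s - N - 1) = y
  generalize ((S.f z u : ℝ) : ℂ) = w
  -- From here `u^m` is eliminated as `1 - G`; this is where the extra terms with one more power of
  -- `1 - u^m` originate.
  generalize hG : 1 - (u : ℂ) ^ S.m = G at *
  have hum : (u : ℂ) ^ S.m = 1 - G := by rw [← hG]; ring
  rw [hum] at qm
  generalize (u : ℂ) ^ (S.m - 1) = v at *
  linear_combination
    (-(a * G ^ B * (u : ℂ) ^ C * y * w) - B * G ^ B * a * (u : ℂ) ^ C * y * w -
      (s - N) * a * G ^ B * (u : ℂ) ^ C * y *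
        (S.n * G ^ S.n + S.t * (z : ℂ) ^ S.e * S.l * G ^ S.l * (u : ℂ) ^ S.c)) * qm -
    (S.m * v * u) * a * (u : ℂ) ^ C * y * w * qB -
    (s - N) * a * G ^ B * (u : ℂ) ^ C * y * (S.m * v * u) *
      (qn + S.t * (z : ℂ) ^ S.e * (u : ℂ) ^ S.c * ql) +
    (s - N) * a * G ^ B * (u : ℂ) ^ C * y * G *
      ((z : ℂ) ^ S.q * qb + S.t * (z : ℂ) ^ S.e * G ^ S.l * qc) +
    a * G ^ B * G * y * w * qC

/-- The remainder of the Euler identity: all its terms have larger weight than `kernel`. -/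
noncomputable def kernelE (A B C N : ℕ) (s : ℂ) (p : ℝ × ℝ) : ℂ :=
  S.q / S.m * (S.m * (B + 1) + (C + 1)) * S.kernel A (B + 1) C N s p -
    S.t * S.k * (s - N) * S.kernel (A + S.e) (B + S.l) (C + S.c) (N + 1) s p +
    (s - N) * (S.n * S.q * S.kernel A (B + S.n + 1) C (N + 1) s p +
      S.q * S.b / S.m * S.kernel (A + S.q) (B + 1) (C + S.b) (N + 1) s p +
      S.t * (S.q / S.m) * (S.l * S.m + S.c) *
        S.kernel (A + S.e) (B + S.l + 1) (C + S.c) (N + 1) s p)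

/-- One factor `f` is taken out of `f^(s - N)` and expanded into its three monomials. This
eliminates the leading terms in the Euler identity. -/
theorem kernel_eq_sum (A B C N : ℕ) (s : ℂ) {z u : ℝ} (hz : 0 < z) (hf : 0 < S.f z u) :
    S.kernel A B C N s (z, u) = S.kernel A (B + S.n) C (N + 1) s (z, u) +
      S.kernel (A + S.q) B (C + S.b) (N + 1) s (z, u) +
      S.t * S.kernel (A + S.e) (B + S.l) (C + S.c) (N + 1) s (z, u) := by
  have k1 := S.kernel_add A B C (N + 1) 0 S.n 0 s (u := u) hz
  have k2 := S.kernel_add A B C (N + 1) S.q 0 S.b s (u := u) hz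
  have k3 := S.kernel_add A B C (N + 1) S.e S.l S.c s (u := u) hz
  simp only [Nat.add_zero] at k1 k2 k3
  rw [k1, k2, k3, S.kernel_eq_mul_f A B C N s hf, ofReal_f]
  ring

/-- Since `u g ∂_u g = -m g + m g²` for `g = 1 - u^m`, the field `-(1/m) u g ∂_u` acts as `g ∂_g` up
to higher order in `g`. So `n z ∂_z - (q/m) u g ∂_u` is an Euler field for the weights: it
multiplies the kernel by its weight `W`, up to terms of larger weight. The factor `u g` also removes
the boundary terms at `u = 0` and `u = 1`. -/
theorem euler_identity (A B C N : ℕ) (s : ℂ) {z u : ℝ} (hz : 0 < z) (hf : 0 < S.f z u) :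
    S.n * S.kernelZ A B C N s (z, u) - S.q / S.m * S.kernelU A B C N s (z, u) =
      S.W A B N s * S.kernel A B C N s (z, u) - S.kernelE A B C N s (z, u) := by
  have hm : (S.m : ℂ) ≠ 0 := by exact_mod_cast S.hm.ne'
  have hw : (S.n : ℂ) * S.e + S.q * S.l = S.n * S.q + S.k := by exact_mod_cast S.weight
  have hs := S.kernel_eq_sum A B C N s hz hf
  simp only [kernelZ, kernelU, kernelE, W]
  field_simp
  linear_combination (-(S.n : ℂ) * S.q * (s - N) * S.m) * hs + (s - N) * S.t * S.m *
    S.kernel (A + S.e) (B + S.l) (C + S.c) (N + 1) s (z, u) * hw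

end Datum

end TwoPuiseux

/-! ### The two recursions for the integrals over the square. -/

namespace TwoPuiseux

theorem continuousAt_ofReal_cpow_comp {g : ℝ → ℝ} {x : ℝ} (hg : ContinuousAt g x)
    (hpos : 0 < g x) (c : ℂ) : ContinuousAt (fun x => ((g x : ℝ) : ℂ) ^ c) x :=
  ContinuousAt.cpow (continuous_ofReal.continuousAt.comp hg) continuousAt_const
    (ofReal_mem_slitPlane.2 hpos)

/-- The function `φ` is integrable on the open unit square with integral `v`. -/
def HasSquareIntegral (φ : ℝ × ℝ → ℂ) (v : ℂ) : Prop :=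
  IntegrableOn φ openSquare ∧ ∫ p in openSquare, φ p = v

namespace HasSquareIntegral

variable {φ ψ : ℝ × ℝ → ℂ} {v w : ℂ}

theorem add (h : HasSquareIntegral φ v) (h' : HasSquareIntegral ψ w) :
    HasSquareIntegral (fun p => φ p + ψ p) (v + w) :=
  ⟨h.1.add h'.1, by rw [integral_add h.1 h'.1, h.2, h'.2]⟩

theorem sub (h : HasSquareIntegral φ v) (h' : HasSquareIntegral ψ w) :
    HasSquareIntegral (fun p => φ p - ψ p) (v - w) :=
  ⟨h.1.sub h'.1, by rw [integral_sub h.1 h'.1, h.2, h'.2]⟩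

theorem const_mul (h : HasSquareIntegral φ v) (c : ℂ) :
    HasSquareIntegral (fun p => c * φ p) (c * v) :=
  ⟨h.1.const_mul c, by rw [integral_const_mul, h.2]⟩

theorem congr (h : HasSquareIntegral φ v) (h' : ∀ p ∈ openSquare, φ p = ψ p) :
    HasSquareIntegral ψ v := by
  have hae : φ =ᵐ[volume.restrict openSquare] ψ := by
    filter_upwards [ae_restrict_mem measurableSet_openSquare] with p hp using h' p hp
  exact ⟨h.1.congr hae, by rw [← integral_congr_ae hae, h.2]⟩

end HasSquareIntegral

namespace Datum

variable (S : Datum)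

theorem X_re_add {A : ℕ} {s : ℂ} (hX : 0 < (S.X A s).re) (i : ℕ) : 0 < (S.X (A + i) s).re := by
  rw [X_re] at *
  push_cast
  linarith [(Nat.cast_nonneg i : (0 : ℝ) ≤ i)]

/-- The integer inequality says that the shift does not lower the weight, so the shifted integrals
converge wherever the original one does. -/
theorem W_re_add {A B N : ℕ} {s : ℂ} (hW : 0 < (S.W A B N s).re) {i j h : ℕ}
    (hij : S.n * S.q * h ≤ S.n * i + S.q * j) : 0 < (S.W (A + i) (B + j) (N + h) s).re := by
  have : (S.n * S.q * h : ℝ) ≤ S.n * i + S.q * j := by exact_mod_cast hij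
  rw [W_re] at *
  push_cast
  linarith

theorem hasSquareIntegral_kernel_add {A B C N : ℕ} {s : ℂ} (hX : 0 < (S.X A s).re)
    (hW : 0 < (S.W A B N s).re) (i j h c : ℕ) (hij : S.n * S.q * h ≤ S.n * i + S.q * j) :
    HasSquareIntegral (S.kernel (A + i) (B + j) (C + c) (N + h) s)
      (S.J (A + i) (B + j) (C + c) (N + h) s) :=
  ⟨S.integrableOn_kernel _ _ _ _ (S.X_re_add hX i) (S.W_re_add hW hij), rfl⟩

theorem hasSquareIntegral_kernelZ {A B C N : ℕ} {s : ℂ} (hX : 0 < (S.X A s).re)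
    (hW : 0 < (S.W A B N s).re) : HasSquareIntegral (S.kernelZ A B C N s)
      (S.X A s * S.J A B C N s + (s - N) * (S.q * S.J (A + S.q) B (C + S.b) (N + 1) s +
        S.t * S.e * S.J (A + S.e) (B + S.l) (C + S.c) (N + 1) s)) := by
  have h0 := S.hasSquareIntegral_kernel_add (C := C) hX hW 0 0 0 0 (by simp)
  have h1 := S.hasSquareIntegral_kernel_add (C := C) hX hW S.q 0 1 S.b (by simp)
  have h2 := S.hasSquareIntegral_kernel_add (C := C) hX hW S.e S.l 1 S.c (by rw [S.weight]; omega)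
  exact (h0.const_mul _).add (((h1.const_mul _).add (h2.const_mul _)).const_mul _)

/-- The integral of `kernelE`. -/
noncomputable def remainderE (A B C N : ℕ) (s : ℂ) : ℂ :=
  S.q / S.m * (S.m * (B + 1) + (C + 1)) * S.J A (B + 1) C N s -
    S.t * S.k * (s - N) * S.J (A + S.e) (B + S.l) (C + S.c) (N + 1) s +
    (s - N) * (S.n * S.q * S.J A (B + S.n + 1) C (N + 1) s +
      S.q * S.b / S.m * S.J (A + S.q) (B + 1) (C + S.b) (N + 1) s +
      S.t * (S.q / S.m) * (S.l * S.m + S.c) *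
        S.J (A + S.e) (B + S.l + 1) (C + S.c) (N + 1) s)

theorem hasSquareIntegral_kernelE {A B C N : ℕ} {s : ℂ} (hX : 0 < (S.X A s).re)
    (hW : 0 < (S.W A B N s).re) :
    HasSquareIntegral (S.kernelE A B C N s) (S.remainderE A B C N s) := by
  have h2 := S.hasSquareIntegral_kernel_add (C := C) hX hW S.e S.l 1 S.c (by rw [S.weight]; omega)
  have h3 := S.hasSquareIntegral_kernel_add (C := C) hX hW 0 1 0 0 (by simp)
  have h4 := S.hasSquareIntegral_kernel_add (C := C) hX hW 0 (S.n + 1) 1 0 (by ring_nf; omega)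
  have h5 := S.hasSquareIntegral_kernel_add (C := C) hX hW S.q 1 1 S.b (by ring_nf; omega)
  have h6 := S.hasSquareIntegral_kernel_add (C := C) hX hW S.e (S.l + 1) 1 S.c (by
      rw [mul_add, ← add_assoc, S.weight]; omega)
  exact ((h3.const_mul _).sub (h2.const_mul _)).add
    ((((h4.const_mul _).add (h5.const_mul _)).add (h6.const_mul _)).const_mul _)

theorem integral_kernelZ {A B C N : ℕ} {s : ℂ} (hX : 0 < (S.X A s).re)
    (hW : 0 < (S.W A B N s).re) : ∫ p in openSquare, S.kernelZ A B C N s p = S.bdry B C N s := by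
  refine integral_openSquare_deriv_fst (G := fun z u => (z : ℂ) * S.kernel A B C N s (z, u))
    (G' := fun z u => S.kernelZ A B C N s (z, u)) (S.hasSquareIntegral_kernelZ hX hW).1
    ?_ ?_ ?_
  · intro u hu z hz
    exact S.hasDerivAt_kernelZ A B C N s hz.1 (S.f_pos hz.1 hz.2.le hu.1.le hu.2.le)
  · intro u hu
    have hg : 0 < 1 - u ^ S.m := by
      linarith [one_sub_le_one_sub_pow S.hm hu.1.le hu.2.le, hu.2]
    have hf0 : 0 < S.f 0 u := by
      have h1 := pow_pos hg S.n
      simp [f, S.hq.ne', S.he.ne', h1]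
    have hzx : Tendsto (fun z : ℝ => (z : ℂ) ^ (S.X A s)) (𝓝[>] 0) (𝓝 0) := by
      rw [tendsto_zero_iff_norm_tendsto_zero]
      have : Tendsto (fun z : ℝ => z ^ (S.X A s).re) (𝓝[>] 0) (𝓝 0) := by
        have h := (Real.continuousAt_rpow_const 0 (S.X A s).re (Or.inr hX.le)).tendsto
        rw [Real.zero_rpow hX.ne'] at h
        exact h.mono_left nhdsWithin_le_nhds
      refine this.congr' ?_
      filter_upwards [self_mem_nhdsWithin] with z hz
      rw [norm_cpow_eq_rpow_re_of_pos hz]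
    have hfc : Tendsto (fun z : ℝ => (((1 - u ^ S.m) ^ B * u ^ C : ℝ) : ℂ) *
        ((S.f z u : ℝ) : ℂ) ^ (s - N)) (𝓝[>] 0) (𝓝 ((((1 - u ^ S.m) ^ B * u ^ C : ℝ) : ℂ) *
        ((S.f 0 u : ℝ) : ℂ) ^ (s - N))) := by
      refine Tendsto.mono_left (ContinuousAt.tendsto ?_) nhdsWithin_le_nhds
      have hfc : ContinuousAt (fun z => S.f z u) 0 := by unfold f; fun_prop
      exact continuousAt_const.fun_mul (continuousAt_ofReal_cpow_comp hfc hf0 (s - N))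
    have := hzx.mul hfc
    rw [zero_mul] at this
    refine this.congr' ?_
    filter_upwards [self_mem_nhdsWithin] with z hz
    have hz' : (z : ℂ) ≠ 0 := by exact_mod_cast (ne_of_gt hz)
    rw [X, cpow_add _ _ hz', cpow_one]
    simp only [kernel]
    ring
  · intro u hu
    refine Tendsto.mono_left ?_ nhdsWithin_le_nhds
    have : ContinuousAt (fun z : ℝ => (z : ℂ) * S.kernel A B C N s (z, u)) 1 := by
      have hf : ContinuousAt (fun z => S.f z u) 1 := by unfold f; fun_prop
      have h1 := continuousAt_ofReal_cpow_comp (g := fun z => z) (x := 1) continuousAt_id one_pos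
        ((S.M : ℂ) * s + A)
      have h2 := continuousAt_ofReal_cpow_comp hf
        (S.f_pos one_pos le_rfl hu.1.le hu.2.le) (s - N)
      simp only [kernel]
      exact continuous_ofReal.continuousAt.fun_mul ((h1.fun_mul continuousAt_const).fun_mul h2)
    have h := this.tendsto
    simpa only [kernel, ofReal_one, one_cpow, one_mul] using h

/-- On the right every integral has a larger `X` and a weight that is not smaller, while `bdry` is
entire: one step of continuation in the direction of `X`. -/
theorem X_mul_J {A B C N : ℕ} {s : ℂ} (hX : 0 < (S.X A s).re) (hW : 0 < (S.W A B N s).re) :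
    S.X A s * S.J A B C N s = S.bdry B C N s - (s - N) * (S.q * S.J (A + S.q) B (C + S.b) (N + 1) s +
      S.t * S.e * S.J (A + S.e) (B + S.l) (C + S.c) (N + 1) s) := by
  have := (S.hasSquareIntegral_kernelZ (C := C) hX hW).2
  rw [S.integral_kernelZ hX hW] at this
  linear_combination -this

theorem continuousAt_kernelU_primitive (A B C N : ℕ) (s : ℂ) {z u : ℝ} (hf : 0 < S.f z u) :
    ContinuousAt (fun u : ℝ => (u : ℂ) * (1 - (u : ℂ) ^ S.m) * S.kernel A B C N s (z, u)) u := by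
  have hfc : ContinuousAt (fun u => S.f z u) u := by unfold f; fun_prop
  have h1 : ContinuousAt (fun u : ℝ => (u : ℂ) * (1 - (u : ℂ) ^ S.m)) u := by fun_prop
  have h2 : ContinuousAt (fun u : ℝ => (((1 - u ^ S.m) ^ B * u ^ C : ℝ) : ℂ)) u := by fun_prop
  simp only [kernel]
  exact h1.fun_mul ((continuousAt_const.fun_mul h2).fun_mul
    (continuousAt_ofReal_cpow_comp hfc hf (s - N)))

theorem integral_kernelU {A B C N : ℕ} {s : ℂ} (hX : 0 < (S.X A s).re)
    (hW : 0 < (S.W A B N s).re) : ∫ p in openSquare, S.kernelU A B C N s p = 0 := by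
  have hm : (S.m : ℂ) ≠ 0 := by exact_mod_cast S.hm.ne'
  have hq : (S.q : ℂ) ≠ 0 := by exact_mod_cast S.hq.ne'
  -- Integrability of the `u` derivative is read off the Euler identity, whose other terms are
  -- already integrable.
  have hint : IntegrableOn (fun p => S.kernelU A B C N s (p.1, p.2)) openSquare := by
    have h := (((S.hasSquareIntegral_kernelZ (C := C) hX hW).const_mul (S.n : ℂ)).sub
      (((S.hasSquareIntegral_kernel_add (C := C) hX hW 0 0 0 0 (by simp)).const_mul
      (S.W A B N s)).sub (S.hasSquareIntegral_kernelE (C := C) hX hW))).const_mul ((S.m : ℂ) / S.q)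
    refine (h.congr fun p hp => ?_).1
    have := S.euler_identity A B C N s hp.1.1 (S.f_pos hp.1.1 hp.1.2.le hp.2.1.le hp.2.2.le)
    simp only [Nat.add_zero]
    rw [← this]
    field_simp
    ring
  have := integral_openSquare_deriv_snd
    (G := fun z u => (u : ℂ) * (1 - (u : ℂ) ^ S.m) * S.kernel A B C N s (z, u))
    (G' := fun z u => S.kernelU A B C N s (z, u)) (a := fun _ => 0) (b := fun _ => 0) hint ?_ ?_ ?_
  · simpa using this
  · intro z hz u hu
    exact S.hasDerivAt_kernelU A B C N s hz.1 (S.f_pos hz.1 hz.2.le hu.1.le hu.2.le)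
  · intro z hz
    have := (S.continuousAt_kernelU_primitive A B C N s
      (S.f_pos hz.1 hz.2.le le_rfl zero_le_one)).tendsto
    simp only [ofReal_zero, zero_mul] at this
    exact this.mono_left nhdsWithin_le_nhds
  · intro z hz
    have := (S.continuousAt_kernelU_primitive A B C N s
      (S.f_pos hz.1 hz.2.le zero_le_one le_rfl)).tendsto
    simp only [ofReal_one, one_pow, sub_self, mul_zero, zero_mul] at this
    exact this.mono_left nhdsWithin_le_nhds

/-- The integrated Euler identity. Every integral in the remainder has strictly larger weight `W`,
so this is one step of continuation in the direction of `W`. -/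
theorem W_mul_J {A B C N : ℕ} {s : ℂ} (hX : 0 < (S.X A s).re) (hW : 0 < (S.W A B N s).re) :
    S.W A B N s * S.J A B C N s = S.n * S.bdry B C N s + S.remainderE A B C N s := by
  have hU : ∫ p in openSquare, (S.n * S.kernelZ A B C N s p -
      S.W A B N s * S.kernel A B C N s p + S.kernelE A B C N s p) = 0 := by
    rw [← mul_zero ((S.q : ℂ) / S.m), ← S.integral_kernelU (C := C) hX hW, ← integral_const_mul]
    refine setIntegral_congr_fun measurableSet_openSquare fun p hp => ?_
    have := S.euler_identity A B C N s hp.1.1 (S.f_pos hp.1.1 hp.1.2.le hp.2.1.le hp.2.2.le)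
    linear_combination this
  have h := (((S.hasSquareIntegral_kernelZ (C := C) hX hW).const_mul (S.n : ℂ)).sub
      ((S.hasSquareIntegral_kernel_add (C := C) hX hW 0 0 0 0 (by simp)).const_mul
      (S.W A B N s))).add (S.hasSquareIntegral_kernelE (C := C) hX hW)
  have h2 := h.2
  simp only [Nat.add_zero] at h2
  rw [hU, ← (S.hasSquareIntegral_kernelZ (C := C) hX hW).2, S.integral_kernelZ hX hW] at h2
  linear_combination h2

end Datum

end TwoPuiseux

/-! ### Meromorphic continuation by two Gamma factors. -/

namespace TwoPuiseux

/-- The quotient of `T` by `Γ(x) Γ(w)`, defined where `x` and `w` have positive real parts, extends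
holomorphically to the region `-i < re x`, `-j < re w`. -/
def GammaExtends (x w : ℂ → ℂ) (i j : ℕ) (T : ℂ → ℂ) : Prop :=
  ∃ H : ℂ → ℂ, DifferentiableOn ℂ H {s | -(i : ℝ) < (x s).re ∧ -(j : ℝ) < (w s).re} ∧
    ∀ s, 0 < (x s).re → 0 < (w s).re → T s = Gamma (x s) * Gamma (w s) * H s

namespace GammaExtends

variable {x w T T' g : ℂ → ℂ} {i j : ℕ}

theorem swap (h : GammaExtends x w i j T) : GammaExtends w x j i T := by
  obtain ⟨H, hH, hT⟩ := h
  refine ⟨H, hH.mono fun s hs => ⟨hs.2, hs.1⟩, fun s h1 h2 => ?_⟩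
  rw [hT s h2 h1, mul_comm (Gamma (x s))]

theorem add (h : GammaExtends x w i j T) (h' : GammaExtends x w i j T') :
    GammaExtends x w i j fun s => T s + T' s := by
  obtain ⟨H, hH, hT⟩ := h
  obtain ⟨H', hH', hT'⟩ := h'
  refine ⟨fun s => H s + H' s, hH.add hH', fun s h1 h2 => ?_⟩
  simp only [hT s h1 h2, hT' s h1 h2]
  ring

theorem entire_mul (hg : Differentiable ℂ g) (h : GammaExtends x w i j T) :
    GammaExtends x w i j fun s => g s * T s := by
  obtain ⟨H, hH, hT⟩ := h
  refine ⟨fun s => g s * H s, hg.differentiableOn.mul hH, fun s h1 h2 => ?_⟩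
  simp only [hT s h1 h2]
  ring

theorem const_mul (c : ℂ) (h : GammaExtends x w i j T) :
    GammaExtends x w i j fun s => c * T s :=
  h.entire_mul (differentiable_const c)

theorem of_differentiableOn (hx : Differentiable ℂ x) (hw : Differentiable ℂ w)
    (hT : DifferentiableOn ℂ T {s | -(i : ℝ) < (x s).re ∧ -(j : ℝ) < (w s).re}) :
    GammaExtends x w i j T := by
  refine ⟨fun s => T s * ((Gamma (x s))⁻¹ * (Gamma (w s))⁻¹), hT.mul
    (Differentiable.differentiableOn ?_), fun s h1 h2 => ?_⟩
  · exact (differentiable_one_div_Gamma.comp hx).mul (differentiable_one_div_Gamma.comp hw)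
  · have := Gamma_ne_zero_of_re_pos h1
    have := Gamma_ne_zero_of_re_pos h2
    field_simp

/-- By `Γ(x + a) = x (x + 1) ⋯ (x + a - 1) Γ(x)`, fewer possible poles are a special case of more.
-/
theorem shift (hx : Differentiable ℂ x) (hw : Differentiable ℂ w) (a b : ℕ)
    (h : GammaExtends (fun s => x s + a) (fun s => w s + b) i j T) : GammaExtends x w i j T := by
  obtain ⟨H, hH, hT⟩ := h
  have ha := (Nat.cast_nonneg a : (0 : ℝ) ≤ a)
  have hb := (Nat.cast_nonneg b : (0 : ℝ) ≤ b)
  refine ⟨fun s => ((∏ r ∈ Finset.range a, (x s + r)) * (∏ r ∈ Finset.range b, (w s + r))) * H s,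
    DifferentiableOn.mul (Differentiable.differentiableOn ?_) (hH.mono ?_), fun s h1 h2 => ?_⟩
  · exact (Differentiable.fun_finsetProd fun r _ => hx.add_const _).mul
      (Differentiable.fun_finsetProd fun r _ => hw.add_const _)
  · rintro s ⟨h1, h2⟩
    constructor
    · rw [add_re, natCast_re]; linarith
    · rw [add_re, natCast_re]; linarith
  · rw [hT s (by rw [add_re, natCast_re]; linarith) (by rw [add_re, natCast_re]; linarith),
      Gamma_add_nat_eq_prod _ h1, Gamma_add_nat_eq_prod _ h2]
    ring

/-- Division by `x` is absorbed by `Γ(x + 1) = x Γ(x)`, and gains one unit of half-plane. -/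
theorem of_mul_left (h : GammaExtends (fun s => x s + 1) w i j T')
    (hT : ∀ s, 0 < (x s).re → 0 < (w s).re → x s * T s = T' s) :
    GammaExtends x w (i + 1) j T := by
  obtain ⟨H, hH, hT'⟩ := h
  refine ⟨H, hH.mono ?_, fun s h1 h2 => ?_⟩
  · rintro s ⟨h1, h2⟩
    refine ⟨?_, h2⟩
    push_cast at h1
    rw [add_re, one_re]
    linarith
  · have hx0 : x s ≠ 0 := fun h0 => by simp [h0] at h1
    have := hT s h1 h2
    rw [hT' s (by rw [add_re, one_re]; linarith) h2, Gamma_add_one _ hx0] at this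
    refine mul_left_cancel₀ hx0 (this.trans ?_)
    ring

theorem of_mul_right (h : GammaExtends x (fun s => w s + 1) i j T')
    (hT : ∀ s, 0 < (x s).re → 0 < (w s).re → w s * T s = T' s) :
    GammaExtends x w i (j + 1) T :=
  (h.swap.of_mul_left fun s h1 h2 => hT s h2 h1).swap

end GammaExtends

namespace Datum

variable (S : Datum)

theorem differentiable_X (A : ℕ) : Differentiable ℂ (S.X A) := by unfold X; fun_prop

theorem differentiable_W (A B N : ℕ) : Differentiable ℂ (S.W A B N) := by
  have := S.differentiable_X A
  unfold W
  fun_prop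

/-- `X / d`. -/
noncomputable def x (A : ℕ) (s : ℂ) : ℂ := S.X A s / S.d

/-- `W / d`. -/
noncomputable def w (A B N : ℕ) (s : ℂ) : ℂ := S.W A B N s / S.d

theorem differentiable_x (A : ℕ) : Differentiable ℂ (S.x A) :=
  (S.differentiable_X A).div_const _

theorem differentiable_w (A B N : ℕ) : Differentiable ℂ (S.w A B N) :=
  (S.differentiable_W A B N).div_const _

theorem x_re (A : ℕ) (s : ℂ) : (S.x A s).re = (S.X A s).re / S.d := by
  rw [x, div_natCast_re]

theorem w_re (A B N : ℕ) (s : ℂ) : (S.w A B N s).re = (S.W A B N s).re / S.d := by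
  rw [w, div_natCast_re]

theorem x_re_pos {A : ℕ} {s : ℂ} : 0 < (S.x A s).re ↔ 0 < (S.X A s).re := by
  have hd : (0 : ℝ) < S.d := by exact_mod_cast S.hd
  rw [x_re, div_pos_iff_of_pos_right hd]

theorem w_re_pos {A B N : ℕ} {s : ℂ} : 0 < (S.w A B N s).re ↔ 0 < (S.W A B N s).re := by
  have hd : (0 : ℝ) < S.d := by exact_mod_cast S.hd
  rw [w_re, div_pos_iff_of_pos_right hd]

theorem x_shift (A a i : ℕ) (hi : i = S.d * a) : S.x (A + i) = fun s => S.x A s + a := by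
  have hd : (S.d : ℂ) ≠ 0 := by exact_mod_cast S.hd.ne'
  funext s
  simp only [x, X, hi]
  push_cast
  field_simp
  ring

theorem w_shift (A B N i j h a : ℕ) (hij : S.n * i + S.q * j = S.n * S.q * h + S.d * a) :
    S.w (A + i) (B + j) (N + h) = fun s => S.w A B N s + a := by
  have hd : (S.d : ℂ) ≠ 0 := by exact_mod_cast S.hd.ne'
  have hij' : (S.n * i + S.q * j : ℂ) = S.n * S.q * h + S.d * a := by exact_mod_cast hij
  funext s
  simp only [w, W, X]
  push_cast
  field_simp
  linear_combination hij'

/-- The shifted integrals that occur on the right-hand sides of the two recursions. -/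
theorem gammaExtends_shift {i j : ℕ} (h : ∀ A B C N : ℕ,
      GammaExtends (S.x A) (S.w A B N) i j (S.J A B C N)) (A B C N : ℕ) {i' j' c' h' a b : ℕ}
    (hi : i' = S.d * a) (hij : S.n * i' + S.q * j' = S.n * S.q * h' + S.d * b) :
    GammaExtends (fun s => S.x A s + a) (fun s => S.w A B N s + b) i j
      (S.J (A + i') (B + j') (C + c') (N + h')) := by
  have := h (A + i') (B + j') (C + c') (N + h')
  rwa [S.x_shift A a i' hi, S.w_shift A B N i' j' h' b hij] at this

/-- In `X_mul_J` the integrals have `X` shifted by `q` or `e`, positive multiples of `d`. After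
division by `d` the shift is at least `1`, and any excess is absorbed by `GammaExtends.shift`. -/
theorem gammaExtends_succ_left {i j : ℕ} (h : ∀ A B C N : ℕ,
      GammaExtends (S.x A) (S.w A B N) i j (S.J A B C N)) (A B C N : ℕ) :
    GammaExtends (S.x A) (S.w A B N) (i + 1) j (S.J A B C N) := by
  have hd : (S.d : ℂ) ≠ 0 := by exact_mod_cast S.hd.ne'
  have hdx := S.differentiable_x A
  have hdw := S.differentiable_w A B N
  obtain ⟨a, ha⟩ := S.dvd_q
  obtain ⟨e, he⟩ := S.dvd_e
  obtain ⟨k, hk⟩ := S.dvd_k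
  have ha1 : 1 ≤ a := Nat.one_le_iff_ne_zero.2 fun h0 => S.hq.ne' (by rw [ha, h0, mul_zero])
  have he1 : 1 ≤ e := Nat.one_le_iff_ne_zero.2 fun h0 => S.he.ne' (by rw [he, h0, mul_zero])
  obtain ⟨a, rfl⟩ := Nat.exists_eq_add_of_le ha1
  obtain ⟨e, rfl⟩ := Nat.exists_eq_add_of_le he1
  have h1 := S.gammaExtends_shift h A B C N (c' := S.b) (h' := 1) (j' := 0) (b := 0) ha (by ring)
  have h2 := S.gammaExtends_shift h A B C N (c' := S.c) (h' := 1) (j' := S.l) (b := k) he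
    (by rw [S.weight, ← hk, mul_one])
  have hadd : ∀ r : ℕ, (fun s => S.x A s + ((1 + r : ℕ) : ℂ)) = fun s => S.x A s + 1 + r := by
    intro r
    funext s
    push_cast
    ring
  have h1' : GammaExtends (fun s => S.x A s + 1) (S.w A B N) i j
      (S.J (A + S.q) B (C + S.b) (N + 1)) := by
    refine GammaExtends.shift (hdx.add_const _) hdw a 0 ?_
    rwa [hadd] at h1
  have h2' : GammaExtends (fun s => S.x A s + 1) (S.w A B N) i j
      (S.J (A + S.e) (B + S.l) (C + S.c) (N + 1)) := by
    refine GammaExtends.shift (hdx.add_const _) hdw e k ?_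
    rwa [hadd] at h2
  have h0 : GammaExtends (fun s => S.x A s + 1) (S.w A B N) i j (S.bdry B C N) :=
    GammaExtends.of_differentiableOn (hdx.add_const _) hdw
      (S.differentiable_bdry B C N).differentiableOn
  have hs : Differentiable ℂ fun s : ℂ => -(s - N) := by fun_prop
  refine ((h0.add (((h1'.const_mul S.q).add (h2'.const_mul (S.t * S.e))).entire_mul hs)).const_mul
    ((S.d : ℂ)⁻¹)).of_mul_left fun s hx hw => ?_
  have := S.X_mul_J (C := C) (S.x_re_pos.1 hx) (S.w_re_pos.1 hw)
  rw [x, div_mul_eq_mul_div, this]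
  field_simp
  ring

/-- In `W_mul_J` the shifts of `W` are `q`, `k` or `k + q`, all positive multiples of `d`, and those
of `X` are nonnegative multiples of `d`. -/
theorem gammaExtends_succ_right {i j : ℕ} (h : ∀ A B C N : ℕ,
      GammaExtends (S.x A) (S.w A B N) i j (S.J A B C N)) (A B C N : ℕ) :
    GammaExtends (S.x A) (S.w A B N) i (j + 1) (S.J A B C N) := by
  have hd : (S.d : ℂ) ≠ 0 := by exact_mod_cast S.hd.ne'
  have hdx := S.differentiable_x A
  have hdw := S.differentiable_w A B N
  obtain ⟨a, ha⟩ := S.dvd_q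
  obtain ⟨e, he⟩ := S.dvd_e
  obtain ⟨k, hk⟩ := S.dvd_k
  have ha1 : 1 ≤ a := Nat.one_le_iff_ne_zero.2 fun h0 => S.hq.ne' (by rw [ha, h0, mul_zero])
  have hk1 : 1 ≤ k := Nat.one_le_iff_ne_zero.2 fun h0 => S.hk.ne' (by rw [hk, h0, mul_zero])
  obtain ⟨a', rfl⟩ := Nat.exists_eq_add_of_le ha1
  obtain ⟨k', rfl⟩ := Nat.exists_eq_add_of_le hk1
  have hadd : ∀ r : ℕ, (fun s => S.w A B N s + ((1 + r : ℕ) : ℂ)) =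
      fun s => S.w A B N s + 1 + r := by
    intro r
    funext s
    push_cast
    ring
  have key : ∀ i' j' c' h' p r : ℕ, i' = S.d * p →
      S.n * i' + S.q * j' = S.n * S.q * h' + S.d * (1 + r) →
      GammaExtends (S.x A) (fun s => S.w A B N s + 1) i j
        (S.J (A + i') (B + j') (C + c') (N + h')) := by
    intro i' j' c' h' p r hp hr
    refine GammaExtends.shift hdx (hdw.add_const _) p r ?_
    have := S.gammaExtends_shift h A B C N (c' := c') hp hr
    rwa [hadd] at this
  have h1 := key 0 1 0 0 0 a' (by simp) (by rw [← ha]; ring)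
  have h2 := key S.e S.l S.c 1 e k' he (by rw [S.weight, ← hk]; ring)
  have h3 := key 0 (S.n + 1) 0 1 0 a' (by simp) (by rw [← ha]; ring)
  have h4 := key S.q 1 S.b 1 (1 + a') a' ha (by rw [← ha]; ring)
  have h5 := key S.e (S.l + 1) S.c 1 e (1 + k' + a') he (by
    rw [mul_add, ← add_assoc, S.weight]
    conv_lhs => rw [hk]
    have : S.d * (1 + (1 + k' + a')) = S.d * (1 + k') + S.d * (1 + a') := by ring
    rw [this, ← ha]
    ring)
  have h0 : GammaExtends (S.x A) (fun s => S.w A B N s + 1) i j (S.bdry B C N) :=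
    GammaExtends.of_differentiableOn hdx (hdw.add_const _)
      (S.differentiable_bdry B C N).differentiableOn
  have hs : Differentiable ℂ fun s : ℂ => s - N := by fun_prop
  have hE := ((h1.const_mul (S.q / S.m * (S.m * (B + 1) + (C + 1)))).add
    ((h2.entire_mul hs).const_mul (-(S.t * S.k)))).add
    ((((h3.const_mul (S.n * S.q)).add (h4.const_mul (S.q * S.b / S.m))).add
      (h5.const_mul (S.t * (S.q / S.m) * (S.l * S.m + S.c)))).entire_mul hs)
  refine (((h0.const_mul S.n).add hE).const_mul ((S.d : ℂ)⁻¹)).of_mul_right fun s hx hw => ?_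
  have := S.W_mul_J (C := C) (S.x_re_pos.1 hx) (S.w_re_pos.1 hw)
  rw [w, div_mul_eq_mul_div, this, remainderE]
  simp only [Nat.add_zero, ← Nat.add_assoc]
  field_simp
  ring

/-- The induction must range over all exponents at once, because each recursion changes all of them.
The case `i = j = 0` is the domain of convergence. -/
theorem gammaExtends_J (i j : ℕ) (A B C N : ℕ) :
    GammaExtends (S.x A) (S.w A B N) i j (S.J A B C N) := by
  induction i generalizing A B C N with
  | succ i ih => exact S.gammaExtends_succ_left ih A B C N
  | zero =>
    induction j generalizing A B C N with
    | succ j ih => exact S.gammaExtends_succ_right ih A B C N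
    | zero =>
      refine GammaExtends.of_differentiableOn (S.differentiable_x A) (S.differentiable_w A B N) ?_
      rintro s ⟨h1, h2⟩
      rw [Nat.cast_zero, neg_zero] at h1 h2
      exact (S.differentiableAt_J A B C N (S.x_re_pos.1 h1)
        (S.w_re_pos.1 h2)).differentiableWithinAt

/-- The abscissa of convergence of `J`. -/
noncomputable def abscissa (A B N : ℕ) : ℝ :=
  max (-(A + 1) / S.M) (-(S.n * (A + 1) + S.q * (B + 1) - S.n * S.q * N) / (S.n * (S.M + S.q)))

theorem abscissa_lt_iff (A B N : ℕ) (s : ℂ) :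
    S.abscissa A B N < s.re ↔ 0 < (S.X A s).re ∧ 0 < (S.W A B N s).re := by
  have hM : (0 : ℝ) < S.M := by exact_mod_cast S.hM
  have hn : (0 : ℝ) < S.n := by exact_mod_cast S.hn
  have hq : (0 : ℝ) < S.q := by exact_mod_cast S.hq
  rw [abscissa, max_lt_iff, div_lt_iff₀ hM, div_lt_iff₀ (by positivity), X_re, W_re]
  constructor <;> rintro ⟨h1, h2⟩ <;> constructor <;> linarith

theorem exists_entire_J (A B C N : ℕ) : ∃ H : ℂ → ℂ, Differentiable ℂ H ∧
    ∀ s, 0 < (S.X A s).re → 0 < (S.W A B N s).re →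
      S.J A B C N s = Gamma (S.x A s) * Gamma (S.w A B N s) * H s := by
  have hd : (0 : ℝ) < S.d := by exact_mod_cast S.hd
  have hext : ∀ τ : ℝ, ∃ H : ℂ → ℂ, DifferentiableOn ℂ H {s | τ < s.re} ∧
      ∀ s : ℂ, S.abscissa A B N < s.re →
        H s = S.J A B C N s * ((Gamma (S.x A s))⁻¹ * (Gamma (S.w A B N s))⁻¹) := by
    intro τ
    -- The real parts of `x` and `w` increase with `Re s`, so enough recursion steps cover any given
    -- right half-plane.
    obtain ⟨i, hi⟩ := exists_nat_ge (-(S.x A τ).re)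
    obtain ⟨j, hj⟩ := exists_nat_ge (-(S.w A B N τ).re)
    obtain ⟨H, hH, hJ⟩ := S.gammaExtends_J i j A B C N
    refine ⟨H, hH.mono ?_, fun s hs => ?_⟩
    · intro s (hs : τ < s.re)
      have hM : (0 : ℝ) < S.M := by exact_mod_cast S.hM
      have hn : (0 : ℝ) < S.n := by exact_mod_cast S.hn
      have hq : (0 : ℝ) < S.q := by exact_mod_cast S.hq
      constructor
      · refine lt_of_le_of_lt (neg_le.1 hi) ?_
        rw [x_re, x_re, X_re, X_re, ofReal_re]
        gcongr
      · refine lt_of_le_of_lt (neg_le.1 hj) ?_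
        rw [w_re, w_re, W_re, W_re, ofReal_re]
        gcongr
    · obtain ⟨hX, hW⟩ := (S.abscissa_lt_iff A B N s).1 hs
      have h1 := Gamma_ne_zero_of_re_pos (S.x_re_pos.2 hX)
      have h2 := Gamma_ne_zero_of_re_pos (S.w_re_pos.2 hW)
      rw [hJ s (S.x_re_pos.2 hX) (S.w_re_pos.2 hW)]
      field_simp
  obtain ⟨H, hH, hJ⟩ := exists_entire_of_forall_halfPlane hext
  refine ⟨H, hH, fun s hX hW => ?_⟩
  rw [hJ s ((S.abscissa_lt_iff A B N s).2 ⟨hX, hW⟩)]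
  have := Gamma_ne_zero_of_re_pos (S.x_re_pos.2 hX)
  have := Gamma_ne_zero_of_re_pos (S.w_re_pos.2 hW)
  field_simp

end Datum

end TwoPuiseux

/-! ### Integrals of a power of `z` times a power of a smooth positive function. -/

namespace TwoPuiseux

/-- The partial derivative in the first variable. -/
noncomputable def partialFst (h : ℝ × ℝ → ℝ) (p : ℝ × ℝ) : ℝ := fderiv ℝ h p (1, 0)

theorem contDiff_partialFst {h : ℝ × ℝ → ℝ} (hh : ContDiff ℝ ∞ h) :
    ContDiff ℝ ∞ (partialFst h) :=
  (hh.fderiv_right (m := ∞) le_rfl).clm_apply contDiff_const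

theorem hasDerivAt_partialFst {h : ℝ × ℝ → ℝ} (hh : ContDiff ℝ ∞ h) (z u : ℝ) :
    HasDerivAt (fun z => h (z, u)) (partialFst h (z, u)) z := by
  have h1 : HasFDerivAt h (fderiv ℝ h (z, u)) (z, u) :=
    (hh.differentiable (by simp) _).hasFDerivAt
  have h2 : HasDerivAt (fun z : ℝ => (z, u)) ((1 : ℝ), (0 : ℝ)) z :=
    (hasDerivAt_id z).prodMk (hasDerivAt_const z u)
  exact h1.comp_hasDerivAt z h2

/-- The closed unit square. -/
def closedSquare : Set (ℝ × ℝ) := Icc 0 1 ×ˢ Icc 0 1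

theorem openSquare_subset_closedSquare : openSquare ⊆ closedSquare :=
  prod_mono Ioo_subset_Icc_self Ioo_subset_Icc_self

/-- The integrand `z^(D s + A) h Q^(s - N)`. -/
noncomputable def unitKernel (D : ℕ) (Q h : ℝ × ℝ → ℝ) (N A : ℕ) (s : ℂ) (p : ℝ × ℝ) : ℂ :=
  (p.1 : ℂ) ^ ((D : ℂ) * s + A) * ((h p : ℝ) : ℂ) * ((Q p : ℝ) : ℂ) ^ (s - N)

/-- The integral of `unitKernel` over the open unit square. -/
noncomputable def unitIntegral (D : ℕ) (Q h : ℝ × ℝ → ℝ) (N A : ℕ) (s : ℂ) : ℂ :=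
  ∫ p in openSquare, unitKernel D Q h N A s p

section

variable {D : ℕ} {Q h : ℝ × ℝ → ℝ}

/-- Compactness: a positive continuous base keeps the complex power continuous, hence bounded, on
the closed square and a ball of `s`. -/
theorem exists_norm_mul_cpow_le (hQ : ContDiff ℝ ∞ Q) (hpos : ∀ p ∈ closedSquare, 0 < Q p)
    (hh : ContDiff ℝ ∞ h) (N : ℕ) (s₀ : ℂ) : ∃ K : ℝ, ∀ s ∈ Metric.ball s₀ 1,
      ∀ p ∈ closedSquare, ‖((h p : ℝ) : ℂ) * ((Q p : ℝ) : ℂ) ^ (s - N)‖ ≤ K := by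
  have hc : IsCompact (Metric.closedBall s₀ 1 ×ˢ closedSquare) :=
    (isCompact_closedBall s₀ 1).prod (isCompact_Icc.prod isCompact_Icc)
  have hcont : ContinuousOn (fun x : ℂ × (ℝ × ℝ) =>
      ((h x.2 : ℝ) : ℂ) * ((Q x.2 : ℝ) : ℂ) ^ (x.1 - N)) (Metric.closedBall s₀ 1 ×ˢ closedSquare) := by
    have h1 := hh.continuous
    have h2 := hQ.continuous
    refine ContinuousOn.mul (Continuous.continuousOn (by fun_prop))
      (ContinuousOn.cpow (Continuous.continuousOn (by fun_prop))
        (Continuous.continuousOn (by fun_prop)) ?_)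
    rintro ⟨s, p⟩ hx
    exact ofReal_mem_slitPlane.2 (hpos p hx.2)
  obtain ⟨K, hK⟩ := hc.exists_bound_of_continuousOn hcont
  exact ⟨K, fun s hs p hp => hK (s, p) ⟨Metric.ball_subset_closedBall hs, hp⟩⟩

theorem measurable_unitKernel (hQ : ContDiff ℝ ∞ Q) (hh : ContDiff ℝ ∞ h) (N A : ℕ) (s : ℂ) :
    Measurable (unitKernel D Q h N A s) := by
  have := hQ.continuous.measurable
  have := hh.continuous.measurable
  unfold unitKernel
  fun_prop

theorem integrableOn_rpow_fst_openSquare {a : ℝ} (ha : 0 < a + 1) :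
    IntegrableOn (fun p : ℝ × ℝ => p.1 ^ a) openSquare := by
  rw [IntegrableOn, restrict_openSquare]
  have h1 : Integrable (fun _ : ℝ => (1 : ℝ)) ((volume : Measure ℝ).restrict (Ioo 0 1)) :=
    integrable_const 1
  simpa using (integrableOn_rpow_Ioo ha).mul_prod h1

theorem norm_unitKernel_le {N A : ℕ} {K : ℝ} {s : ℂ} {σ : ℝ} {p : ℝ × ℝ} (hp : p ∈ openSquare)
    (hσ : σ ≤ s.re) (hK : ‖((h p : ℝ) : ℂ) * ((Q p : ℝ) : ℂ) ^ (s - N)‖ ≤ K) :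
    ‖unitKernel D Q h N A s p‖ ≤ p.1 ^ (D * σ + A) * K := by
  rw [unitKernel, mul_assoc, norm_mul, norm_cpow_eq_rpow_re_of_pos hp.1.1]
  have e1 : ((D : ℂ) * s + A).re = D * s.re + A := by simp
  rw [e1]
  have e2 : p.1 ^ (D * s.re + A) ≤ p.1 ^ (D * σ + A) :=
    Real.rpow_le_rpow_of_exponent_ge hp.1.1 hp.1.2.le (by gcongr)
  have := Real.rpow_nonneg hp.1.1.le (D * σ + A)
  gcongr

theorem integrableOn_unitKernel (hQ : ContDiff ℝ ∞ Q) (hpos : ∀ p ∈ closedSquare, 0 < Q p)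
    (hh : ContDiff ℝ ∞ h) (N A : ℕ) {s : ℂ} (hs : 0 < D * s.re + A + 1) :
    IntegrableOn (unitKernel D Q h N A s) openSquare := by
  obtain ⟨K, hK⟩ := exists_norm_mul_cpow_le hQ hpos hh N s
  refine Integrable.mono' ((integrableOn_rpow_fst_openSquare hs).mul_const K)
    (measurable_unitKernel hQ hh N A s).aestronglyMeasurable ?_
  filter_upwards [ae_restrict_mem measurableSet_openSquare] with p hp
  exact norm_unitKernel_le hp le_rfl
    (hK s (Metric.mem_ball_self one_pos) p (openSquare_subset_closedSquare hp))

theorem differentiableAt_unitIntegral (hQ : ContDiff ℝ ∞ Q) (hpos : ∀ p ∈ closedSquare, 0 < Q p)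
    (hh : ContDiff ℝ ∞ h) (N A : ℕ) {s : ℂ} (hs : 0 < D * s.re + A + 1) :
    DifferentiableAt ℂ (unitIntegral D Q h N A) s := by
  obtain ⟨ε, hε, h1, -⟩ := Datum.exists_lt_affine_pos (a := D) (b := A + 1) (σ := s.re)
    (a' := D) (b' := A + 1) (by linarith) (by linarith)
  obtain ⟨K, hK⟩ := exists_norm_mul_cpow_le hQ hpos hh N s
  have hr : 0 < min ε 1 := lt_min hε one_pos
  refine differentiableAt_integral_of_bound hr
    (fun s _ => (measurable_unitKernel hQ hh N A s).aestronglyMeasurable) ?_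
    ((integrableOn_rpow_fst_openSquare (a := D * (s.re - ε) + A) (by linarith)).mul_const K) ?_
  · filter_upwards [ae_restrict_mem measurableSet_openSquare] with p hp
    have hz : (p.1 : ℂ) ≠ 0 := by exact_mod_cast hp.1.1.ne'
    have hQp : ((Q p : ℝ) : ℂ) ≠ 0 := by
      exact_mod_cast (hpos p (openSquare_subset_closedSquare hp)).ne'
    intro w _
    unfold unitKernel
    exact (((DifferentiableAt.const_cpow (by fun_prop) (Or.inl hz)).mul_const _).mul
      (DifferentiableAt.const_cpow (by fun_prop) (Or.inl hQp))).differentiableWithinAt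
  · filter_upwards [ae_restrict_mem measurableSet_openSquare] with p hp w hw
    have h2 := (abs_re_le_norm (w - s)).trans_lt
      ((mem_ball_iff_norm.1 hw).trans_le (min_le_left _ _))
    rw [sub_re, abs_lt] at h2
    exact norm_unitKernel_le hp (by linarith) (hK w (Metric.ball_subset_ball (min_le_right _ _) hw)
      p (openSquare_subset_closedSquare hp))

/-- The boundary integral of `h Q^(s - N)` over the side `z = 1`. -/
noncomputable def unitBdry (Q h : ℝ × ℝ → ℝ) (N : ℕ) (s : ℂ) : ℂ :=
  ∫ u in Ioo (0 : ℝ) 1, ((h (1, u) : ℝ) : ℂ) * ((Q (1, u) : ℝ) : ℂ) ^ (s - N)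

theorem differentiable_unitBdry (hQ : ContDiff ℝ ∞ Q) (hpos : ∀ p ∈ closedSquare, 0 < Q p)
    (hh : ContDiff ℝ ∞ h) (N : ℕ) : Differentiable ℂ (unitBdry Q h N) := by
  intro s
  obtain ⟨K, hK⟩ := exists_norm_mul_cpow_le hQ hpos hh N s
  have hmem : ∀ u ∈ Ioo (0 : ℝ) 1, ((1 : ℝ), u) ∈ closedSquare := fun u hu =>
    ⟨⟨zero_le_one, le_rfl⟩, hu.1.le, hu.2.le⟩
  refine differentiableAt_integral_of_bound (r := 1) one_pos (bound := fun _ => K) ?_ ?_ ?_ ?_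
  · intro w _
    have h1 := hQ.continuous.measurable
    have h2 := hh.continuous.measurable
    exact Measurable.aestronglyMeasurable (by fun_prop)
  · filter_upwards [ae_restrict_mem measurableSet_Ioo] with u hu w hw
    have hf : ((Q (1, u) : ℝ) : ℂ) ≠ 0 := by exact_mod_cast (hpos _ (hmem u hu)).ne'
    exact ((DifferentiableAt.const_cpow (by fun_prop) (Or.inl hf)).const_mul
      _).differentiableWithinAt
  · exact integrable_const K
  · filter_upwards [ae_restrict_mem measurableSet_Ioo] with u hu w hw
    exact hK w hw _ (hmem u hu)

theorem tendsto_ofReal_cpow_zero {c : ℂ} (hc : 0 < c.re) :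
    Tendsto (fun z : ℝ => (z : ℂ) ^ c) (𝓝[>] 0) (𝓝 0) := by
  rw [tendsto_zero_iff_norm_tendsto_zero]
  have : Tendsto (fun z : ℝ => z ^ c.re) (𝓝[>] 0) (𝓝 0) := by
    have h := (Real.continuousAt_rpow_const 0 c.re (Or.inr hc.le)).tendsto
    rw [Real.zero_rpow hc.ne'] at h
    exact h.mono_left nhdsWithin_le_nhds
  refine this.congr' ?_
  filter_upwards [self_mem_nhdsWithin] with z hz
  rw [norm_cpow_eq_rpow_re_of_pos hz]

/-- Integration by parts in `z` alone. Positivity of `Q` up to the boundary leaves `z = 0` as the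
only source of poles, and the derivatives of `h` and `Q` keep the same form of integrand. -/
theorem unitIntegral_recursion (hQ : ContDiff ℝ ∞ Q) (hpos : ∀ p ∈ closedSquare, 0 < Q p)
    (hh : ContDiff ℝ ∞ h) (N A : ℕ) {s : ℂ} (hs : 0 < D * s.re + A + 1) :
    (D * s + A + 1) * unitIntegral D Q h N A s = unitBdry Q h N s -
      unitIntegral D Q (partialFst h) N (A + 1) s -
      (s - N) * unitIntegral D Q (fun p => h p * partialFst Q p) (N + 1) (A + 1) s := by
  have hh' := contDiff_partialFst hh
  have hQ' := contDiff_partialFst hQ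
  have hs' : 0 < D * s.re + (A + 1 : ℕ) + 1 := by push_cast; linarith
  have h1 : HasSquareIntegral _ _ := ⟨integrableOn_unitKernel hQ hpos hh N A hs, rfl⟩
  have h2 : HasSquareIntegral _ _ := ⟨integrableOn_unitKernel hQ hpos hh' N (A + 1) hs', rfl⟩
  have h3 : HasSquareIntegral _ _ :=
    ⟨integrableOn_unitKernel hQ hpos (hh.mul hQ') (N + 1) (A + 1) hs', rfl⟩
  have h4 := ((h1.const_mul (D * s + A + 1)).add h2).add (h3.const_mul (s - N))
  have h5 := integral_openSquare_deriv_fst (b := fun u => ((h (1, u) : ℝ) : ℂ) *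
    ((Q (1, u) : ℝ) : ℂ) ^ (s - N)) (G := fun z u => (z : ℂ) ^ ((D : ℂ) * s + A + 1) *
      (((h (z, u) : ℝ) : ℂ) * ((Q (z, u) : ℝ) : ℂ) ^ (s - N)))
    (G' := fun z u => (D * s + A + 1) * unitKernel D Q h N A s (z, u) +
      unitKernel D Q (partialFst h) N (A + 1) s (z, u) +
      (s - N) * unitKernel D Q (fun p => h p * partialFst Q p) (N + 1) (A + 1) s (z, u)) h4.1
    ?_ ?_ ?_
  · have h6 := h4.2
    rw [h5] at h6
    change unitBdry Q h N s = (D * s + A + 1) * unitIntegral D Q h N A s +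
      unitIntegral D Q (partialFst h) N (A + 1) s +
      (s - N) * unitIntegral D Q (fun p => h p * partialFst Q p) (N + 1) (A + 1) s at h6
    linear_combination -h6
  · intro u hu z hz
    have hp : 0 < Q (z, u) := hpos _ ⟨⟨hz.1.le, hz.2.le⟩, hu.1.le, hu.2.le⟩
    have hz' : (z : ℂ) ≠ 0 := by exact_mod_cast hz.1.ne'
    have hQp : ((Q (z, u) : ℝ) : ℂ) ≠ 0 := by exact_mod_cast hp.ne'
    have d1 := hasDerivAt_ofReal_cpow_comp (g := fun z => z) (hasDerivAt_id z) hz.1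
      ((D : ℂ) * s + A + 1)
    have d2 := hasDerivAt_ofReal_cpow_comp (hasDerivAt_partialFst hQ z u) hp (s - N)
    have d3 := (hasDerivAt_partialFst hh z u).ofReal_comp
    refine (d1.mul (d3.mul d2)).congr_deriv ?_
    have e1 := cpow_eq_cpow_sub_one_mul hz' ((D : ℂ) * s + A + 1)
    have e2 := cpow_eq_cpow_sub_one_mul hQp (s - N)
    have e3 : s - (N + 1 : ℕ) = s - N - 1 := by push_cast; ring
    have e4 : (D : ℂ) * s + (A + 1 : ℕ) = D * s + A + 1 := by push_cast; ring
    have e5 : (D : ℂ) * s + A + 1 - 1 = D * s + A := by ring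
    simp only [unitKernel, e3, e4, Pi.mul_apply]
    rw [e1, e5]
    push_cast
    ring
  · intro u hu
    have hp : 0 < Q (0, u) := hpos _ ⟨⟨le_rfl, zero_le_one⟩, hu.1.le, hu.2.le⟩
    have c1 := tendsto_ofReal_cpow_zero (c := (D : ℂ) * s + A + 1) (by simpa using hs)
    have c2 : ContinuousAt (fun z => Q (z, u)) 0 := by
      have := hQ.continuous
      fun_prop
    have c3 : ContinuousAt (fun z => ((h (z, u) : ℝ) : ℂ)) 0 := by
      have := hh.continuous
      fun_prop
    have c4 := (c3.fun_mul (continuousAt_ofReal_cpow_comp c2 hp (s - N))).tendsto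
    simpa using c1.mul (c4.mono_left nhdsWithin_le_nhds)
  · intro u hu
    have hp : 0 < Q (1, u) := hpos _ ⟨⟨zero_le_one, le_rfl⟩, hu.1.le, hu.2.le⟩
    have c1 := continuousAt_ofReal_cpow_comp (g := fun z => z) (x := 1) continuousAt_id one_pos
        ((D : ℂ) * s + A + 1)
    have c2 : ContinuousAt (fun z => Q (z, u)) 1 := by
      have := hQ.continuous
      fun_prop
    have c3 : ContinuousAt (fun z => ((h (z, u) : ℝ) : ℂ)) 1 := by
      have := hh.continuous
      fun_prop
    have c4 := (c1.fun_mul (c3.fun_mul (continuousAt_ofReal_cpow_comp c2 hp (s - N)))).tendsto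
    simp only [ofReal_one, one_cpow, one_mul] at c4
    exact c4.mono_left nhdsWithin_le_nhds

/-- Only one Gamma factor is needed; the constant second argument `1` contributes the trivial factor
`Γ(1) = 1`. -/
theorem gammaExtends_unitIntegral (hQ : ContDiff ℝ ∞ Q) (hpos : ∀ p ∈ closedSquare, 0 < Q p)
    (i : ℕ) {h : ℝ × ℝ → ℝ} (hh : ContDiff ℝ ∞ h) (N A : ℕ) :
    GammaExtends (fun s => D * s + A + 1) (fun _ => 1) i 0 (unitIntegral D Q h N A) := by
  induction i generalizing h N A with
  | zero =>
    refine GammaExtends.of_differentiableOn (by fun_prop) (by fun_prop) ?_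
    rintro s ⟨h1, -⟩
    exact (differentiableAt_unitIntegral hQ hpos hh N A
      (by simpa using h1)).differentiableWithinAt
  | succ i ih =>
    have hadd : (fun s : ℂ => D * s + (A + 1 : ℕ) + 1) = fun s : ℂ => D * s + A + 1 + 1 := by
      funext s; push_cast; ring
    have h1 := ih (contDiff_partialFst hh) N (A + 1)
    have h2 := ih (hh.mul (contDiff_partialFst hQ)) (N + 1) (A + 1)
    rw [hadd] at h1 h2
    have h0 : GammaExtends (fun s : ℂ => D * s + A + 1 + 1) (fun _ => 1) i 0 (unitBdry Q h N) :=
      GammaExtends.of_differentiableOn (by fun_prop) (by fun_prop)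
        (differentiable_unitBdry hQ hpos hh N).differentiableOn
    have hs : Differentiable ℂ fun s : ℂ => -(s - N) := by fun_prop
    refine ((h0.add (h1.const_mul (-1))).add (h2.entire_mul hs)).of_mul_left fun s hx _ => ?_
    rw [unitIntegral_recursion hQ hpos hh N A (by simpa using hx)]
    ring

theorem exists_entire_unitIntegral (hD : 0 < D) (hQ : ContDiff ℝ ∞ Q)
    (hpos : ∀ p ∈ closedSquare, 0 < Q p) (hh : ContDiff ℝ ∞ h) (N A : ℕ) :
    ∃ H : ℂ → ℂ, Differentiable ℂ H ∧ ∀ s : ℂ, 0 < D * s.re + A + 1 →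
      unitIntegral D Q h N A s = Gamma (D * s + A + 1) * H s := by
  have hD' : (0 : ℝ) < D := by exact_mod_cast hD
  have hiff : ∀ s : ℂ, -(A + 1) / D < s.re ↔ 0 < D * s.re + A + 1 := by
    intro s
    rw [div_lt_iff₀ hD']
    constructor <;> intro h <;> linarith
  have hre : ∀ s : ℂ, ((D : ℂ) * s + A + 1).re = D * s.re + A + 1 := by intro s; simp
  have hext : ∀ τ : ℝ, ∃ H : ℂ → ℂ, DifferentiableOn ℂ H {s | τ < s.re} ∧
      ∀ s : ℂ, -(A + 1) / D < s.re →
        H s = unitIntegral D Q h N A s * (Gamma (D * s + A + 1))⁻¹ := by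
    intro τ
    obtain ⟨i, hi⟩ := exists_nat_ge (-(D * τ + A + 1))
    obtain ⟨H, hH, hJ⟩ := gammaExtends_unitIntegral (D := D) hQ hpos i hh N A
    refine ⟨H, hH.mono ?_, fun s hs => ?_⟩
    · intro s (hs : τ < s.re)
      constructor
      · rw [hre]
        refine lt_of_le_of_lt (neg_le.1 hi) ?_
        gcongr
      · simp
    · have h1 := (hiff s).1 hs
      rw [← hre] at h1
      have h2 := Gamma_ne_zero_of_re_pos h1
      rw [hJ s h1 (by simp), Gamma_one]
      field_simp
  obtain ⟨H, hH, hJ⟩ := exists_entire_of_forall_halfPlane hext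
  refine ⟨H, hH, fun s hs => ?_⟩
  rw [hJ s ((hiff s).2 hs)]
  rw [← hre] at hs
  have := Gamma_ne_zero_of_re_pos hs
  field_simp

end

end TwoPuiseux

/-! ### The beta integral as two boundary integrals of the model. -/

namespace TwoPuiseux

/-- The real integrand of the beta function. -/
noncomputable def betaFun (p p' x : ℝ) : ℝ := x ^ (p - 1) * (1 - x) ^ (p' - 1)

theorem ofReal_betaFun {p p' x : ℝ} (hx : 0 ≤ x) (hx1 : x ≤ 1) :
    ((betaFun p p' x : ℝ) : ℂ) = (x : ℂ) ^ ((p : ℂ) - 1) * (1 - (x : ℂ)) ^ ((p' : ℂ) - 1) := by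
  have h1 : (0 : ℝ) ≤ 1 - x := by linarith
  rw [betaFun, ofReal_mul, ofReal_cpow hx, ofReal_cpow h1]
  push_cast
  rfl

theorem intervalIntegrable_betaFun {p p' : ℝ} (hp : 0 < p) (hp' : 0 < p') :
    IntervalIntegrable (betaFun p p') volume 0 1 := by
  have h := Integrable.re
    (betaIntegral_convergent (u := p) (v := p') (by simpa using hp) (by simpa using hp')).1
  rw [intervalIntegrable_iff_integrableOn_Ioc_of_le zero_le_one]
  refine h.congr ?_
  filter_upwards [ae_restrict_mem measurableSet_Ioc] with x hx
  rw [← ofReal_betaFun hx.1.le hx.2, RCLike.re_eq_complex_re, ofReal_re]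

theorem betaIntegral_eq_ofReal {p p' : ℝ} :
    betaIntegral p p' = ((∫ x in (0 : ℝ)..1, betaFun p p' x : ℝ) : ℂ) := by
  rw [betaIntegral, ← intervalIntegral.integral_ofReal]
  refine intervalIntegral.integral_congr fun x hx => ?_
  rw [uIcc_of_le zero_le_one] at hx
  rw [ofReal_betaFun hx.1 hx.2]

theorem continuousOn_betaFun (p p' : ℝ) : ContinuousOn (betaFun p p') (Ioo 0 1) := by
  intro x hx
  have h1 : x ≠ 0 := hx.1.ne'
  have h2 : 1 - x ≠ 0 := by have := hx.2; intro h; linarith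
  unfold betaFun
  exact ((continuousAt_id.rpow_const (Or.inl h1)).mul
    ((continuousAt_const.sub continuousAt_id).rpow_const (Or.inl h2))).continuousWithinAt

/-- Substitution `x = φ u` in a part of the beta integral. -/
theorem integral_betaFun_comp {p p' : ℝ} (hp : 0 < p) (hp' : 0 < p') {φ φ' ψ : ℝ → ℝ}
    (hφ : ContinuousOn φ (Icc 0 1)) (hd : ∀ u ∈ Ioo (0 : ℝ) 1, HasDerivAt φ (φ' u) u)
    (hmaps : ∀ u ∈ Ioo (0 : ℝ) 1, φ u ∈ Ioo (0 : ℝ) 1)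
    (hψ : ∀ u ∈ Ioo (0 : ℝ) 1, betaFun p p' (φ u) * φ' u = -ψ u)
    (hint : IntegrableOn ψ (Ioo 0 1)) :
    ∫ u in Ioo (0 : ℝ) 1, ψ u = ∫ x in (φ 1)..(φ 0), betaFun p p' x := by
  have hint' : IntegrableOn (fun u => (betaFun p p' ∘ φ) u * φ' u) (Ioo 0 1) := by
    refine hint.neg.congr ?_
    filter_upwards [ae_restrict_mem measurableSet_Ioo] with u hu
    simp only [Function.comp, Pi.neg_apply, hψ u hu]
  have hmaps' : MapsTo φ (Icc 0 1) (Icc 0 1) := by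
    have h := (show MapsTo φ (Ioo 0 1) (Ioo 0 1) from hmaps).closure_of_continuousOn (f := φ)
      (by rwa [closure_Ioo zero_ne_one])
    rwa [closure_Ioo zero_ne_one] at h
  have key := intervalIntegral.integral_comp_mul_deriv''' (a := 0) (b := 1) (f := φ) (f' := φ')
    (g := betaFun p p') ?_ ?_ ?_ ?_ ?_
  · rw [intervalIntegral.integral_symm, ← key, intervalIntegral.integral_of_le zero_le_one,
      integral_Ioc_eq_integral_Ioo, ← integral_neg]
    refine setIntegral_congr_fun measurableSet_Ioo fun u hu => ?_
    simp only [Function.comp, hψ u hu, neg_neg]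
  · rwa [uIcc_of_le zero_le_one]
  · rw [min_eq_left zero_le_one, max_eq_right zero_le_one]
    exact fun u hu => (hd u hu).hasDerivWithinAt
  · rw [min_eq_left zero_le_one, max_eq_right zero_le_one]
    refine (continuousOn_betaFun p p').mono ?_
    rintro _ ⟨u, hu, rfl⟩
    exact hmaps u hu
  · rw [uIcc_of_le zero_le_one]
    refine IntegrableOn.mono_set ?_ hmaps'.image_subset
    exact (intervalIntegrable_iff_integrableOn_Icc_of_le zero_le_one).1
      (intervalIntegrable_betaFun hp hp')
  · rw [uIcc_of_le zero_le_one, integrableOn_Icc_iff_integrableOn_Ioo]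
    exact hint'

/-- The beta density in the coordinate `x = y / (1 + y)`, for which `y` will be the ratio `g^n /
z^q` or its inverse on one side of the square. -/
theorem rpow_div_one_add {y : ℝ} (hy : 0 < y) (p p' : ℝ) :
    betaFun p p' (y / (1 + y)) * (1 / (1 + y) ^ 2) = y ^ (p - 1) * (1 + y) ^ (-(p + p')) := by
  have h1 : 0 < 1 + y := by linarith
  have e1 : 1 - y / (1 + y) = (1 + y)⁻¹ := by field_simp; ring
  have e2 : (1 + y) ^ (-(p + p')) =
      (1 + y) ^ (-(p - 1)) * (1 + y) ^ (-(p' - 1)) * (1 + y) ^ (-(2 : ℝ)) := by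
    rw [← Real.rpow_add h1, ← Real.rpow_add h1]
    congr 1
    ring
  rw [betaFun, e1, e2, Real.div_rpow hy.le h1.le, Real.inv_rpow h1.le, Real.rpow_neg h1.le (p - 1),
    Real.rpow_neg h1.le (p' - 1), Real.rpow_neg h1.le 2, Real.rpow_two]
  field_simp

theorem betaFun_symm (p p' x : ℝ) : betaFun p p' (1 - x) = betaFun p' p x := by
  rw [betaFun, betaFun, sub_sub_cancel, mul_comm]

/-- Substitution `y = (1 - u^m)^n` on the side `z = 1`: here `0 ≤ y ≤ 1`, so `y / (1 + y)` covers
`(0, 1/2)`. The model with exponent `0` for `z` is just its value at `z = 1`. -/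
theorem integral_bdry_model_snd {m n l : ℕ} (hm : 0 < m) (hn : 0 < n) {p p' : ℝ} (hp : 0 < p)
    (hp' : 0 < p') (hl : (l : ℝ) + 1 = n * p) :
    n * ∫ u in Ioo (0 : ℝ) 1, (m * u ^ (m - 1) * (1 - u ^ m) ^ l *
      modelF m n 0 1 u ^ (-(p + p'))) = ∫ x in (0 : ℝ)..(1 / 2), betaFun p p' x := by
  have hgd : ∀ u : ℝ, HasDerivAt (fun u : ℝ => (1 - u ^ m) ^ n)
      (n * (1 - u ^ m) ^ (n - 1) * (-(m * u ^ (m - 1)))) u := fun u =>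
    ((hasDerivAt_pow m u).const_sub 1).pow n
  have hpos : ∀ u ∈ Icc (0 : ℝ) 1, 0 < 1 + (1 - u ^ m) ^ n := fun u hu => by
    have := pow_nonneg (one_sub_pow_nonneg (m := m) hu.1 hu.2) n
    linarith
  rw [← integral_const_mul]
  have := integral_betaFun_comp hp hp' (φ := fun u => (1 - u ^ m) ^ n / (1 + (1 - u ^ m) ^ n))
    (φ' := fun u => n * (1 - u ^ m) ^ (n - 1) * (-(m * u ^ (m - 1))) *
      (1 / (1 + (1 - u ^ m) ^ n) ^ 2)) (ψ := fun u => n * (m * u ^ (m - 1) * (1 - u ^ m) ^ l *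
      modelF m n 0 1 u ^ (-(p + p')))) ?_ ?_ ?_ ?_ ?_
  · rw [this]
    congr 1
    · simp [hn.ne']
    · simp [hm.ne']; norm_num
  · exact ContinuousOn.div (by fun_prop) (by fun_prop) fun u hu => (hpos u hu).ne'
  · intro u hu
    have hne := (hpos u (Ioo_subset_Icc_self hu)).ne'
    refine ((hgd u).div ((hgd u).const_add 1) hne).congr_deriv ?_
    field_simp
    ring
  · intro u hu
    have h1 := one_sub_le_one_sub_pow hm hu.1.le hu.2.le
    have hy : 0 < (1 - u ^ m) ^ n := pow_pos (by linarith [hu.2]) n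
    exact ⟨by positivity, by rw [div_lt_one (by linarith)]; linarith⟩
  · intro u hu
    have h1 := one_sub_le_one_sub_pow hm hu.1.le hu.2.le
    have hg : 0 < 1 - u ^ m := by linarith [hu.2]
    have hy : 0 < (1 - u ^ m) ^ n := pow_pos hg n
    have e := rpow_div_one_add hy p p'
    have e1 : ((1 - u ^ m) ^ n) ^ (p - 1) * (1 - u ^ m) ^ (n - 1) = (1 - u ^ m) ^ l := by
      rw [← Real.rpow_natCast _ n, ← Real.rpow_mul hg.le, ← Real.rpow_natCast _ (n - 1),
        ← Real.rpow_add hg, ← Real.rpow_natCast _ l, Nat.cast_sub hn]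
      congr 1
      push_cast
      linarith
    have e2 : modelF m n 0 1 u = 1 + (1 - u ^ m) ^ n := by simp [modelF, add_comm]
    rw [e2, ← e1]
    linear_combination (-(n * (1 - u ^ m) ^ (n - 1) * (m * u ^ (m - 1)))) * e
  · have hc : ContinuousOn (fun u : ℝ => n * (m * u ^ (m - 1) * (1 - u ^ m) ^ l *
        modelF m n 0 1 u ^ (-(p + p')))) (Icc 0 1) := by
      refine continuousOn_const.mul (ContinuousOn.mul (by fun_prop) (ContinuousOn.rpow_const ?_ ?_))
      · unfold modelF; fun_prop
      · exact fun u hu => Or.inl (modelF_pos one_pos hu.1 hu.2).ne'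
    exact (hc.integrableOn_Icc).mono_set Ioo_subset_Icc_self

/-- On the side `u = 0` one has `g = 1`, and the inverse ratio `y = z^q` covers `(0, 1/2)`; the
reflection `x ↦ 1 - x` makes this the other half of the beta integral. -/
theorem integral_bdry_model_fst {q : ℕ} (hq : 0 < q) {p p' : ℝ} (hp : 0 < p) (hp' : 0 < p') :
    q * ∫ z in Ioo (0 : ℝ) 1, (z ^ (q * p' - 1) * (1 + z ^ q) ^ (-(p + p'))) =
      ∫ x in (1 / 2 : ℝ)..1, betaFun p p' x := by
  have hq' : (0 : ℝ) < q := by exact_mod_cast hq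
  have hsymm : ∫ x in (1 / 2 : ℝ)..1, betaFun p p' x = ∫ x in (0 : ℝ)..(1 / 2), betaFun p' p x := by
    have := intervalIntegral.integral_comp_sub_left (a := 0) (b := 1 / 2) (betaFun p p') 1
    rw [sub_zero, show (1 : ℝ) - 1 / 2 = 1 / 2 by norm_num] at this
    rw [← this]
    exact intervalIntegral.integral_congr fun x _ => betaFun_symm p p' x
  rw [hsymm, ← integral_const_mul]
  have hpos : ∀ z ∈ Icc (0 : ℝ) 1, 0 < 1 + z ^ q := fun z hz => by
    have := pow_nonneg hz.1 q
    linarith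
  -- The substitution lemma is set up for a decreasing map, whereas this one increases.
  have hflip : ∫ z in Ioo (0 : ℝ) 1, q * (z ^ (q * p' - 1) * (1 + z ^ q) ^ (-(p + p'))) =
      -∫ z in Ioo (0 : ℝ) 1, -(q * (z ^ (q * p' - 1) * (1 + z ^ q) ^ (-(p + p')))) := by
    rw [integral_neg, neg_neg]
  have hb : ∀ z ∈ Ioo (0 : ℝ) 1, (1 + z ^ q) ^ (-(p + p')) ≤ 1 := fun z hz =>
    Real.rpow_le_one_of_one_le_of_nonpos (by linarith [pow_nonneg hz.1.le q]) (by linarith)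
  rw [hflip, intervalIntegral.integral_symm]
  congr 1
  have := integral_betaFun_comp hp' hp (φ := fun z => z ^ q / (1 + z ^ q))
    (φ' := fun z => q * z ^ (q - 1) * (1 / (1 + z ^ q) ^ 2))
    (ψ := fun z => -(q * (z ^ (q * p' - 1) * (1 + z ^ q) ^ (-(p + p'))))) ?_ ?_ ?_ ?_ ?_
  · rw [this]
    congr 1
    · norm_num
    · simp [hq.ne']
  · exact ContinuousOn.div (by fun_prop) (by fun_prop) fun z hz => (hpos z hz).ne'
  · intro z hz
    have hne := (hpos z (Ioo_subset_Icc_self hz)).ne'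
    refine ((hasDerivAt_pow q z).div ((hasDerivAt_pow q z).const_add 1) hne).congr_deriv ?_
    field_simp
    ring
  · intro z hz
    have hy := pow_pos hz.1 q
    exact ⟨by positivity, by rw [div_lt_one (by linarith)]; linarith⟩
  · intro z hz
    have hy := pow_pos hz.1 q
    have e := rpow_div_one_add hy p' p
    have e1 : (z ^ q) ^ (p' - 1) * z ^ (q - 1) = z ^ (q * p' - 1) := by
      rw [← Real.rpow_natCast _ q, ← Real.rpow_mul hz.1.le, ← Real.rpow_natCast _ (q - 1),
        ← Real.rpow_add hz.1, Nat.cast_sub hq]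
      congr 1
      push_cast
      ring
    rw [← e1, add_comm p p']
    linear_combination (q * z ^ (q - 1)) * e
  · refine IntegrableOn.neg (Integrable.const_mul ?_ _)
    refine Integrable.mono' (integrableOn_rpow_Ioo (a := q * p' - 1) (by
      rw [sub_add_cancel]; positivity)) (Measurable.aestronglyMeasurable (by fun_prop)) ?_
    filter_upwards [ae_restrict_mem measurableSet_Ioo] with z hz
    have h1 := Real.rpow_nonneg hz.1.le (q * p' - 1)
    have h2 := Real.rpow_nonneg (hpos z (Ioo_subset_Icc_self hz)).le (-(p + p'))
    rw [Real.norm_of_nonneg (by positivity)]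
    exact mul_le_of_le_one_right h1 (hb z hz)

/-- The two boundary integrals of the quasi-homogeneous model add up to a beta integral. -/
theorem add_bdry_model_eq_betaIntegral {m n q l : ℕ} (hm : 0 < m) (hn : 0 < n) (hq : 0 < q)
    {p p' : ℝ} (hp : 0 < p) (hp' : 0 < p') (hl : (l : ℝ) + 1 = n * p) :
    ((n * (∫ u in Ioo (0 : ℝ) 1, (m * u ^ (m - 1) * (1 - u ^ m) ^ l *
      modelF m n 0 1 u ^ (-(p + p')))) +
      q * ∫ z in Ioo (0 : ℝ) 1, (z ^ (q * p' - 1) * (1 + z ^ q) ^ (-(p + p'))) : ℝ) : ℂ) =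
      betaIntegral p p' := by
  rw [integral_bdry_model_snd hm hn hp hp' hl, integral_bdry_model_fst hq hp hp',
    betaIntegral_eq_ofReal]
  congr 1
  have h := intervalIntegrable_betaFun hp hp'
  refine intervalIntegral.integral_add_adjacent_intervals (h.mono_set ?_) (h.mono_set ?_) <;>
    rw [uIcc_of_le (by norm_num), uIcc_of_le (by norm_num)] <;>
    exact Icc_subset_Icc (by norm_num) (by norm_num)

end TwoPuiseux

/-! ### The residue of the quasi-homogeneous model. -/

namespace TwoPuiseux

/-- The integrand `z^a (1 - u^m)^l F^r` of the quasi-homogeneous model, with the density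
`m u^(m - 1)` that turns `1 - u^m` into a coordinate. -/
noncomputable def modelIntegrand (m n q l : ℕ) (a r : ℝ) (p : ℝ × ℝ) : ℝ :=
  p.1 ^ a * (m * p.2 ^ (m - 1)) * (1 - p.2 ^ m) ^ l * modelF m n q p.1 p.2 ^ r

section

variable {m n q l : ℕ} {a r : ℝ}

theorem modelIntegrand_nonneg {p : ℝ × ℝ} (hp : p ∈ openSquare) :
    0 ≤ modelIntegrand m n q l a r p := by
  have h1 := Real.rpow_nonneg hp.1.1.le a
  have h2 := one_sub_pow_nonneg (m := m) hp.2.1.le hp.2.2.le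
  have h3 := Real.rpow_nonneg (modelF_pos (m := m) (n := n) (q := q) hp.1.1 hp.2.1.le hp.2.2.le).le r
  have h4 := pow_nonneg hp.2.1.le (m - 1)
  unfold modelIntegrand
  positivity

theorem integrableOn_modelIntegrand (hm : 0 < m) (hn : 0 < n) (hq : 0 < q) (hr : r ≤ 0)
    (ha : 0 < a + 1) (hW : 0 < n * (a + 1) + q * (l + 1) + n * q * r) :
    IntegrableOn (modelIntegrand m n q l a r) openSquare := by
  refine Integrable.mono' ((integrableOn_model hm hn hq l hr ha hW).const_mul (m : ℝ))
    (Measurable.aestronglyMeasurable ?_) ?_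
  · unfold modelIntegrand modelF
    fun_prop
  · filter_upwards [ae_restrict_mem measurableSet_openSquare] with p hp
    rw [Real.norm_of_nonneg (modelIntegrand_nonneg hp)]
    have h1 := Real.rpow_nonneg hp.1.1.le a
    have h2 := one_sub_pow_nonneg (m := m) hp.2.1.le hp.2.2.le
    have h3 := Real.rpow_nonneg
      (modelF_pos (m := m) (n := n) (q := q) hp.1.1 hp.2.1.le hp.2.2.le).le r
    have h4 : p.2 ^ (m - 1) ≤ 1 := pow_le_one₀ hp.2.1.le hp.2.2.le
    calc modelIntegrand m n q l a r p
        = p.2 ^ (m - 1) * (m * (p.1 ^ a * (1 - p.2 ^ m) ^ l * modelF m n q p.1 p.2 ^ r)) := by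
          unfold modelIntegrand; ring
      _ ≤ 1 * (m * (p.1 ^ a * (1 - p.2 ^ m) ^ l * modelF m n q p.1 p.2 ^ r)) := by gcongr
      _ = _ := one_mul _

theorem hasDerivAt_modelF_fst {z u : ℝ} :
    HasDerivAt (fun z => modelF m n q z u) (q * z ^ (q - 1)) z :=
  (hasDerivAt_pow q z).const_add _

theorem hasDerivAt_modelF_snd {z u : ℝ} : HasDerivAt (fun u => modelF m n q z u)
    (n * (1 - u ^ m) ^ (n - 1) * (-(m * u ^ (m - 1)))) u :=
  (((hasDerivAt_pow m u).const_sub 1).pow n).add_const _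

theorem rpow_eq_rpow_sub_one_mul {x : ℝ} (hx : 0 < x) (c : ℝ) : x ^ c = x ^ (c - 1) * x := by
  rw [Real.rpow_sub_one hx.ne', div_mul_cancel₀ _ hx.ne']

/-- With the density `m u^(m - 1)` the function `g = 1 - u^m` is a true coordinate, so the Euler
identity has no remainder: weight times integral equals the boundary terms on `z = 1` and on `u =
0`. -/
theorem mul_integral_modelIntegrand (hm : 0 < m) (hn : 0 < n) (hq : 0 < q) (hr : r ≤ 0)
    (ha : 0 < a + 1) (hW : 0 < n * (a + 1) + q * (l + 1) + n * q * r) :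
    (n * (a + 1) + q * (l + 1) + n * q * r) * ∫ p in openSquare, modelIntegrand m n q l a r p =
      n * (∫ u in Ioo (0 : ℝ) 1, (m * u ^ (m - 1) * (1 - u ^ m) ^ l * modelF m n 0 1 u ^ r)) +
      q * ∫ z in Ioo (0 : ℝ) 1, (z ^ a * (1 + z ^ q) ^ r) := by
  have hT := integrableOn_modelIntegrand hm hn hq hr ha hW
  -- `T₁` and `T₂` are the two terms of `F · F^(r-1)`: they come from the `z` and the `u` derivative
  -- of `F^r`, and their sum restores the integrand.
  set T₁ : ℝ × ℝ → ℝ := fun p => p.1 ^ a * p.1 ^ q * (m * p.2 ^ (m - 1)) * (1 - p.2 ^ m) ^ l *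
    modelF m n q p.1 p.2 ^ (r - 1) with hT₁def
  set T₂ : ℝ × ℝ → ℝ := fun p => p.1 ^ a * (m * p.2 ^ (m - 1)) * (1 - p.2 ^ m) ^ (l + n) *
    modelF m n q p.1 p.2 ^ (r - 1) with hT₂def
  have hsum : ∀ p ∈ openSquare, modelIntegrand m n q l a r p = T₁ p + T₂ p := by
    intro p hp
    rw [modelIntegrand, rpow_eq_rpow_sub_one_mul (modelF_pos hp.1.1 hp.2.1.le hp.2.2.le) r]
    simp only [hT₁def, hT₂def]
    rw [pow_add]
    conv_lhs => rw [mul_comm (modelF m n q p.1 p.2 ^ (r - 1))]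
    rw [show modelF m n q p.1 p.2 * modelF m n q p.1 p.2 ^ (r - 1) =
      ((1 - p.2 ^ m) ^ n + p.1 ^ q) * modelF m n q p.1 p.2 ^ (r - 1) from rfl]
    ring
  have hnn : ∀ p ∈ openSquare, 0 ≤ T₁ p ∧ 0 ≤ T₂ p := by
    intro p hp
    have h1 := Real.rpow_nonneg hp.1.1.le a
    have h2 := one_sub_pow_nonneg (m := m) hp.2.1.le hp.2.2.le
    have h3 := Real.rpow_nonneg
      (modelF_pos (m := m) (n := n) (q := q) hp.1.1 hp.2.1.le hp.2.2.le).le (r - 1)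
    have h4 := pow_nonneg hp.2.1.le (m - 1)
    have h5 := pow_nonneg hp.1.1.le q
    simp only [hT₁def, hT₂def]
    constructor <;> positivity
  have hI₁ : IntegrableOn T₁ openSquare := by
    refine Integrable.mono' hT (Measurable.aestronglyMeasurable ?_) ?_
    · simp only [hT₁def]; unfold modelF; fun_prop
    · filter_upwards [ae_restrict_mem measurableSet_openSquare] with p hp
      rw [Real.norm_of_nonneg (hnn p hp).1, hsum p hp]
      linarith [(hnn p hp).2]
  have hI₂ : IntegrableOn T₂ openSquare := by
    refine Integrable.mono' hT (Measurable.aestronglyMeasurable ?_) ?_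
    · simp only [hT₂def]; unfold modelF; fun_prop
    · filter_upwards [ae_restrict_mem measurableSet_openSquare] with p hp
      rw [Real.norm_of_nonneg (hnn p hp).2, hsum p hp]
      linarith [(hnn p hp).1]
  have hZ := integral_openSquare_deriv_fst
    (G := fun z u => z ^ (a + 1) * ((m * u ^ (m - 1)) * (1 - u ^ m) ^ l) * modelF m n q z u ^ r)
    (G' := fun z u => (a + 1) * modelIntegrand m n q l a r (z, u) + r * q * T₁ (z, u))
    (b := fun u => m * u ^ (m - 1) * (1 - u ^ m) ^ l * modelF m n 0 1 u ^ r)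
    ((hT.const_mul _).add (hI₁.const_mul _)) ?_ ?_ ?_
  · have hU := integral_openSquare_deriv_snd
      (G := fun z u => -(z ^ a * (1 - u ^ m) ^ (l + 1) * modelF m n q z u ^ r))
      (G' := fun z u => (l + 1) * modelIntegrand m n q l a r (z, u) + r * n * T₂ (z, u))
      (a := fun z => -(z ^ a * (1 + z ^ q) ^ r)) (b := fun _ => 0)
      ((hT.const_mul _).add (hI₂.const_mul _)) ?_ ?_ ?_
    · rw [integral_add (hT.const_mul _) (hI₁.const_mul _), integral_const_mul,
        integral_const_mul] at hZ
      rw [integral_add (hT.const_mul _) (hI₂.const_mul _), integral_const_mul,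
        integral_const_mul] at hU
      have hS : ∫ p in openSquare, modelIntegrand m n q l a r p =
          (∫ p in openSquare, T₁ p) + ∫ p in openSquare, T₂ p := by
        rw [← integral_add hI₁ hI₂]
        exact setIntegral_congr_fun measurableSet_openSquare hsum
      simp only [zero_sub, neg_neg] at hU
      rw [← hZ, ← hU]
      linear_combination n * q * r * hS
    · intro z hz u hu
      have hF := modelF_pos (m := m) (n := n) (q := q) hz.1 hu.1.le hu.2.le
      have d1 : HasDerivAt (fun u : ℝ => z ^ a * (1 - u ^ m) ^ (l + 1))
          (z ^ a * ((l + 1 : ℕ) * (1 - u ^ m) ^ l * (-(m * u ^ (m - 1))))) u :=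
        (((hasDerivAt_pow m u).const_sub 1).pow (l + 1)).const_mul _
      have d2 := (hasDerivAt_modelF_snd (m := m) (n := n) (q := q) (z := z) (u := u)).rpow_const
        (p := r) (Or.inl hF.ne')
      refine ((d1.mul d2).neg).congr_deriv ?_
      have e1 : (n : ℝ) * (1 - u ^ m) ^ (n - 1) * (1 - u ^ m) ^ (l + 1) =
          n * (1 - u ^ m) ^ (l + n) := by
        have := natCast_mul_pow_sub_one_mul n (1 - u ^ m)
        rw [pow_succ, pow_add]
        linear_combination (1 - u ^ m) ^ l * this
      simp only [modelIntegrand, hT₂def]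
      push_cast
      linear_combination (z ^ a * (m * u ^ (m - 1)) * r * modelF m n q z u ^ (r - 1)) * e1
    · intro z hz
      have hF := modelF_pos (m := m) (n := n) (q := q) (u := 0) hz.1 le_rfl zero_le_one
      have hc : ContinuousAt (fun u => modelF m n q z u) 0 := by unfold modelF; fun_prop
      have c1 : ContinuousAt (fun u : ℝ => z ^ a * (1 - u ^ m) ^ (l + 1)) 0 := by fun_prop
      have := ((c1.fun_mul (hc.rpow_const (p := r) (Or.inl hF.ne'))).fun_neg).tendsto
      have h0 : modelF m n q z 0 = 1 + z ^ q := by simp [modelF, hm.ne']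
      rw [h0, zero_pow hm.ne', sub_zero, one_pow, mul_one] at this
      exact this.mono_left nhdsWithin_le_nhds
    · intro z hz
      have hF := modelF_pos (m := m) (n := n) (q := q) (u := 1) hz.1 zero_le_one le_rfl
      have hc : ContinuousAt (fun u => modelF m n q z u) 1 := by unfold modelF; fun_prop
      have c1 : ContinuousAt (fun u : ℝ => z ^ a * (1 - u ^ m) ^ (l + 1)) 1 := by fun_prop
      have := ((c1.fun_mul (hc.rpow_const (p := r) (Or.inl hF.ne'))).fun_neg).tendsto
      simp only [one_pow, sub_self, ne_eq, Nat.add_eq_zero_iff, one_ne_zero, and_false,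
        not_false_eq_true, zero_pow, mul_zero, zero_mul, neg_zero] at this
      exact this.mono_left nhdsWithin_le_nhds
  · intro u hu z hz
    have hF := modelF_pos (m := m) (n := n) (q := q) hz.1 hu.1.le hu.2.le
    have d1 := (Real.hasDerivAt_rpow_const (x := z) (p := a + 1) (Or.inl hz.1.ne')).mul_const
      ((m * u ^ (m - 1)) * (1 - u ^ m) ^ l)
    have d2 := (hasDerivAt_modelF_fst (m := m) (n := n) (q := q) (z := z) (u := u)).rpow_const
      (p := r) (Or.inl hF.ne')
    refine (d1.mul d2).congr_deriv ?_
    have e1 : z ^ (a + 1) = z ^ a * z := by rw [Real.rpow_add_one hz.1.ne']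
    have e2 := natCast_mul_pow_sub_one_mul q z
    simp only [modelIntegrand, hT₁def]
    rw [add_sub_cancel_right, e1]
    linear_combination (z ^ a * (m * u ^ (m - 1)) * (1 - u ^ m) ^ l * r *
      modelF m n q z u ^ (r - 1)) * e2
  · intro u hu
    have hg : 0 < 1 - u ^ m := by linarith [one_sub_le_one_sub_pow hm hu.1.le hu.2.le, hu.2]
    have hF : 0 < modelF m n q 0 u := by
      have := pow_pos hg n
      simp [modelF, hq.ne', this]
    have hc : ContinuousAt (fun z => modelF m n q z u) 0 := by unfold modelF; fun_prop
    have c1 : ContinuousAt (fun z : ℝ => z ^ (a + 1) * ((m * u ^ (m - 1)) * (1 - u ^ m) ^ l)) 0 :=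
      (Real.continuousAt_rpow_const 0 (a + 1) (Or.inr ha.le)).mul continuousAt_const
    have := (c1.fun_mul (hc.rpow_const (p := r) (Or.inl hF.ne'))).tendsto
    rw [Real.zero_rpow ha.ne', zero_mul, zero_mul] at this
    exact this.mono_left nhdsWithin_le_nhds
  · intro u hu
    have hF := modelF_pos (m := m) (n := n) (q := q) one_pos hu.1.le hu.2.le
    have hc : ContinuousAt (fun z => modelF m n q z u) 1 := by unfold modelF; fun_prop
    have c1 : ContinuousAt (fun z : ℝ => z ^ (a + 1) * ((m * u ^ (m - 1)) * (1 - u ^ m) ^ l)) 1 :=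
      (Real.continuousAt_rpow_const 1 (a + 1) (Or.inl one_ne_zero)).mul continuousAt_const
    have := (c1.fun_mul (hc.rpow_const (p := r) (Or.inl hF.ne'))).tendsto
    have h0 : modelF m n q 1 u = modelF m n 0 1 u := by simp [modelF]
    rw [Real.one_rpow, one_mul, h0] at this
    exact this.mono_left nhdsWithin_le_nhds

/-- The leading residue of the quasi-homogeneous model. -/
theorem tendsto_sub_mul_integral_modelIntegrand (hm : 0 < m) (hn : 0 < n) (hq : 0 < q) {M : ℕ}
    {A α : ℝ} (hα : α < 0) (hA : 0 < M * α + A + 1)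
    (hW : n * (M * α + A + 1) + q * (l + 1) + n * q * (α - 1) = 0) :
    Tendsto (fun σ : ℝ => (σ - α) * ∫ p in openSquare, modelIntegrand m n q l (M * σ + A) (σ - 1) p)
      (𝓝[>] α) (𝓝 ((n * (∫ u in Ioo (0 : ℝ) 1,
        (m * u ^ (m - 1) * (1 - u ^ m) ^ l * modelF m n 0 1 u ^ (α - 1))) +
      q * ∫ z in Ioo (0 : ℝ) 1, (z ^ (M * α + A) * (1 + z ^ q) ^ (α - 1))) / (n * (M + q)))) := by
  have hn' : (0 : ℝ) < n := by exact_mod_cast hn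
  have hq' : (0 : ℝ) < q := by exact_mod_cast hq
  have hmem : Ioo α 0 ∈ 𝓝[>] α := Ioo_mem_nhdsGT hα
  have lim1 : Tendsto (fun σ : ℝ => ∫ u in Ioo (0 : ℝ) 1,
      (m * u ^ (m - 1) * (1 - u ^ m) ^ l * modelF m n 0 1 u ^ (σ - 1))) (𝓝[>] α)
      (𝓝 (∫ u in Ioo (0 : ℝ) 1,
        (m * u ^ (m - 1) * (1 - u ^ m) ^ l * modelF m n 0 1 u ^ (α - 1)))) := by
    refine tendsto_integral_filter_of_dominated_convergence (fun _ => (m : ℝ)) ?_ ?_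
      (integrable_const _) ?_
    · refine Eventually.of_forall fun σ => Measurable.aestronglyMeasurable ?_
      unfold modelF; fun_prop
    · filter_upwards [hmem] with σ hσ
      filter_upwards [ae_restrict_mem measurableSet_Ioo] with u hu
      have hg := one_sub_pow_nonneg (m := m) hu.1.le hu.2.le
      have hF1 : 1 ≤ modelF m n 0 1 u := by
        have := pow_nonneg hg n
        simp only [modelF, pow_zero]; linarith
      have hF2 : modelF m n 0 1 u ^ (σ - 1) ≤ 1 :=
        Real.rpow_le_one_of_one_le_of_nonpos hF1 (by linarith [hσ.2])
      have hF3 := Real.rpow_nonneg (zero_le_one.trans hF1) (σ - 1)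
      have h4 := pow_nonneg hu.1.le (m - 1)
      rw [Real.norm_of_nonneg (by positivity)]
      calc _ ≤ (m : ℝ) * 1 * 1 * 1 := by
            gcongr
            · exact pow_le_one₀ hu.1.le hu.2.le
            · exact pow_le_one₀ hg (one_sub_pow_le_one hu.1.le)
        _ = m := by ring
    · filter_upwards [ae_restrict_mem measurableSet_Ioo] with u hu
      have hF := modelF_pos (m := m) (n := n) (q := 0) one_pos hu.1.le hu.2.le
      refine Tendsto.mono_left (Continuous.tendsto ?_ α) nhdsWithin_le_nhds
      refine continuous_const.mul (continuous_const.rpow (by fun_prop) fun _ => Or.inl hF.ne')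
  have lim2 : Tendsto (fun σ : ℝ => ∫ z in Ioo (0 : ℝ) 1, (z ^ (M * σ + A) * (1 + z ^ q) ^ (σ - 1)))
      (𝓝[>] α) (𝓝 (∫ z in Ioo (0 : ℝ) 1, (z ^ (M * α + A) * (1 + z ^ q) ^ (α - 1)))) := by
    refine tendsto_integral_filter_of_dominated_convergence (fun z => z ^ (M * α + A)) ?_ ?_
      (integrableOn_rpow_Ioo hA) ?_
    · exact Eventually.of_forall fun σ => Measurable.aestronglyMeasurable (by fun_prop)
    · filter_upwards [hmem] with σ hσ
      filter_upwards [ae_restrict_mem measurableSet_Ioo] with z hz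
      have h1 : 1 ≤ 1 + z ^ q := by linarith [pow_nonneg hz.1.le q]
      have h2 : (1 + z ^ q) ^ (σ - 1) ≤ 1 :=
        Real.rpow_le_one_of_one_le_of_nonpos h1 (by linarith [hσ.2])
      have h3 := Real.rpow_nonneg (zero_le_one.trans h1) (σ - 1)
      have h4 := Real.rpow_nonneg hz.1.le (M * σ + A)
      rw [Real.norm_of_nonneg (by positivity)]
      refine (mul_le_of_le_one_right h4 h2).trans
        (Real.rpow_le_rpow_of_exponent_ge hz.1 hz.2.le ?_)
      have := hσ.1.le
      gcongr
    · filter_upwards [ae_restrict_mem measurableSet_Ioo] with z hz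
      have h1 : 0 < 1 + z ^ q := by linarith [pow_nonneg hz.1.le q]
      refine Tendsto.mono_left (Continuous.tendsto ?_ α) nhdsWithin_le_nhds
      exact (continuous_const.rpow (by fun_prop) fun _ => Or.inl hz.1.ne').mul
        (continuous_const.rpow (by fun_prop) fun _ => Or.inl h1.ne')
  refine (((lim1.const_mul (n : ℝ)).add (lim2.const_mul (q : ℝ))).div_const _).congr' ?_
  filter_upwards [hmem] with σ hσ
  -- The weight is affine in `σ` and vanishes at `α`; its slope `n (M + q)` is the denominator of
  -- the residue.
  have hW' : (n * (M * σ + A + 1) + q * (l + 1) + n * q * (σ - 1) : ℝ) =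
      n * (M + q) * (σ - α) := by linear_combination hW
  have hpos : 0 < (n : ℝ) * (M + q) * (σ - α) := mul_pos (by positivity) (by linarith [hσ.1])
  have hA' : 0 < M * σ + A + 1 := by
    have : (M : ℝ) * α ≤ M * σ := by have := hσ.1.le; gcongr
    linarith
  have := mul_integral_modelIntegrand (l := l) (r := σ - 1) hm hn hq (by linarith [hσ.2]) hA'
    (by rw [hW']; exact hpos)
  rw [hW'] at this
  rw [← this]
  have : (n : ℝ) * (M + q) ≠ 0 := by positivity
  field_simp

end

end TwoPuiseux

/-! ### The difference between `t` and `t = 0`: convergence to the right of `α`. -/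

namespace TwoPuiseux

theorem norm_cpow_sub_cpow_le {a b K : ℝ} {s : ℂ} (ha : 0 < a) (hab : a ≤ b)
    (hK : ∀ y ∈ Icc a b, y ^ (s.re - 1) ≤ K) :
    ‖(b : ℂ) ^ s - (a : ℂ) ^ s‖ ≤ ‖s‖ * K * (b - a) := by
  refine norm_image_sub_le_of_norm_deriv_le_segment' (f := fun y : ℝ => (y : ℂ) ^ s)
    (f' := fun y : ℝ => s * (y : ℂ) ^ (s - 1)) (fun y hy => ?_) (fun y hy => ?_) b
    (right_mem_Icc.2 hab)
  · have hy0 : 0 < y := ha.trans_le hy.1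
    have := hasDerivAt_ofReal_cpow_comp (g := fun y => y) (hasDerivAt_id y) hy0 s
    simp only [ofReal_one, mul_one] at this
    exact this.hasDerivWithinAt
  · have hy0 : 0 < y := ha.trans_le hy.1
    rw [norm_mul, norm_cpow_eq_rpow_re_of_pos hy0, sub_re, one_re]
    exact mul_le_mul_of_nonneg_left (hK y (Ico_subset_Icc_self hy)) (norm_nonneg s)

namespace Datum

variable (S : Datum)

/-- The datum with `t = 0`. -/
def zero : Datum where
  m := S.m
  n := S.n
  q := S.q
  b := S.b
  -- With `t = 0` the perturbation is a dummy: `e = k = q` and `l = 1` satisfy the weight relation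
  -- and allow the common divisor `d = q`, which is the largest possible.
  e := S.q
  l := 1
  c := 0
  k := S.q
  M := S.M
  d := S.q
  t := 0
  hm := S.hm
  hn := S.hn
  hq := S.hq
  he := S.hq
  hk := S.hq
  hM := S.hM
  hd := S.hq
  ht := le_rfl
  weight := by rw [mul_one]
  dvd_q := dvd_rfl
  dvd_e := dvd_rfl
  dvd_k := dvd_rfl

theorem zero_f (z u : ℝ) : S.zero.f z u = (1 - u ^ S.m) ^ S.n + z ^ S.q * u ^ S.b := by
  simp [f, zero]

theorem f_eq_zero_f_add (z u : ℝ) :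
    S.f z u = S.zero.f z u + S.t * z ^ S.e * (1 - u ^ S.m) ^ S.l * u ^ S.c := by
  rw [zero_f, f]

/-- The difference of the integrands for the given `t` and for `t = 0`. -/
noncomputable def diffKernel (A : ℕ) (s : ℂ) (p : ℝ × ℝ) : ℂ :=
  (p.1 : ℂ) ^ ((S.M : ℂ) * s + A) *
    (((S.f p.1 p.2 : ℝ) : ℂ) ^ s - ((S.zero.f p.1 p.2 : ℝ) : ℂ) ^ s)

theorem diffKernel_eq (A : ℕ) (s : ℂ) (p : ℝ × ℝ) :
    S.diffKernel A s p = S.kernel A 0 0 0 s p - S.zero.kernel A 0 0 0 s p := by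
  have : S.zero.M = S.M := rfl
  simp [diffKernel, kernel, this]
  ring

theorem integral_diffKernel (A : ℕ) {s : ℂ} (hX : 0 < (S.X A s).re) (hW : 0 < (S.W A 0 0 s).re) :
    ∫ p in openSquare, S.diffKernel A s p = S.J A 0 0 0 s - S.zero.J A 0 0 0 s := by
  have h1 := S.integrableOn_kernel A 0 0 0 hX hW
  have h2 := S.zero.integrableOn_kernel A 0 0 0 (s := s) hX hW
  rw [J, J, ← integral_sub h1 h2]
  exact integral_congr_ae (Eventually.of_forall fun p => S.diffKernel_eq A s p)

/-- By the mean value inequality the difference of powers gains the factor `z^e (1 - u^m)^l` and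
loses one power of the model, a net gain of weight `k`. Hence the larger half-plane of convergence.
-/
theorem exists_norm_diffKernel_le (A : ℕ) (σ₁ σ₂ R : ℝ) : ∃ K : ℝ, 0 ≤ K ∧
    ∀ s : ℂ, s.re ∈ Icc σ₁ σ₂ → ‖s‖ ≤ R → ∀ p ∈ openSquare, ‖S.diffKernel A s p‖ ≤
      K * (p.1 ^ (S.M * σ₁ + (A + S.e : ℕ)) * (1 - p.2 ^ S.m) ^ S.l *
        modelF S.m S.n S.q p.1 p.2 ^ (min (σ₁ - (1 : ℕ)) 0)) := by
  obtain ⟨K, hK0, hK⟩ := exists_rpow_le_mul_rpow_min (c := (1 / 2 : ℝ) ^ (S.b + S.n + 1))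
    (T := 2 + S.t) (by positivity) (by linarith [S.ht]) (σ₁ - 1) (σ₂ - 1)
  have ht := S.ht
  refine ⟨|R| * K * S.t, by positivity, ?_⟩
  rintro s ⟨hs1, hs2⟩ hsR ⟨z, u⟩ ⟨⟨hz, hz1⟩, hu, hu1⟩
  dsimp only at hz hz1 hu hu1 ⊢
  have hg := one_sub_pow_nonneg (m := S.m) hu.le hu1.le
  have hF := modelF_pos (m := S.m) (n := S.n) (q := S.q) hz hu.le hu1.le
  have hFr := Real.rpow_nonneg hF.le (min (σ₁ - (1 : ℕ)) 0)
  have hδ : 0 ≤ S.t * z ^ S.e * (1 - u ^ S.m) ^ S.l * u ^ S.c := by positivity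
  have hle : S.zero.f z u ≤ S.f z u := by rw [S.f_eq_zero_f_add z u]; linarith
  have h1 := norm_cpow_sub_cpow_le (s := s) (S.zero.f_pos hz hz1.le hu.le hu1.le) hle
    (K := K * modelF S.m S.n S.q z u ^ (min (σ₁ - (1 : ℕ)) 0)) (fun y hy => by
      have := hK (s.re - 1) ⟨by linarith, by linarith⟩ _ hF y
        ((S.zero.const_mul_modelF_le hz.le hz1.le hu.le hu1.le).trans hy.1)
        (hy.2.trans (S.f_le hz.le hz1.le hu.le hu1.le))
      simpa using this)
  have h2 : S.f z u - S.zero.f z u ≤ S.t * z ^ S.e * (1 - u ^ S.m) ^ S.l := by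
    rw [S.f_eq_zero_f_add z u, add_sub_cancel_left]
    exact mul_le_of_le_one_right (by positivity) (pow_le_one₀ hu.le hu1.le)
  have h3 : ‖(z : ℂ) ^ ((S.M : ℂ) * s + A)‖ ≤ z ^ (S.M * σ₁ + A) := by
    rw [norm_cpow_eq_rpow_re_of_pos hz]
    have : ((S.M : ℂ) * s + A).re = S.M * s.re + A := by simp
    rw [this]
    exact Real.rpow_le_rpow_of_exponent_ge hz hz1.le (by gcongr)
  have h4 : z ^ (S.M * σ₁ + (A + S.e : ℕ)) = z ^ (S.M * σ₁ + A) * z ^ S.e := by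
    rw [Nat.cast_add, ← add_assoc, Real.rpow_add hz, Real.rpow_natCast]
  have h5 : 0 ≤ S.f z u - S.zero.f z u := by linarith
  have h6 := Real.rpow_nonneg hz.le (S.M * σ₁ + A)
  rw [diffKernel, norm_mul, h4]
  calc _ ≤ z ^ (S.M * σ₁ + A) * (‖s‖ * (K * modelF S.m S.n S.q z u ^ (min (σ₁ - (1 : ℕ)) 0)) *
        (S.f z u - S.zero.f z u)) := by gcongr
    _ ≤ z ^ (S.M * σ₁ + A) * (|R| * (K * modelF S.m S.n S.q z u ^ (min (σ₁ - (1 : ℕ)) 0)) *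
        (S.t * z ^ S.e * (1 - u ^ S.m) ^ S.l)) := by
        gcongr
        exact hsR.trans (le_abs_self R)
    _ = _ := by ring

theorem measurable_diffKernel (A : ℕ) (s : ℂ) : Measurable (S.diffKernel A s) := by
  have h1 := S.measurable_f
  have h2 := S.zero.measurable_f
  unfold diffKernel
  fun_prop

theorem integrableOn_diffKernel (A : ℕ) {s : ℂ} (hX : 0 < (S.X (A + S.e) s).re)
    (hW : 0 < (S.W (A + S.e) S.l 1 s).re) : IntegrableOn (S.diffKernel A s) openSquare := by
  rw [X_re] at hX
  rw [W_re] at hW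
  obtain ⟨K, -, hK⟩ := S.exists_norm_diffKernel_le A s.re s.re ‖s‖
  refine Integrable.mono' ((S.integrableOn_model_min (A + S.e) S.l 1 hX hW).const_mul K)
    (S.measurable_diffKernel A s).aestronglyMeasurable ?_
  filter_upwards [ae_restrict_mem measurableSet_openSquare] with p hp
  exact hK s ⟨le_rfl, le_rfl⟩ le_rfl p hp

theorem differentiableAt_integral_diffKernel (A : ℕ) {s : ℂ} (hX : 0 < (S.X (A + S.e) s).re)
    (hW : 0 < (S.W (A + S.e) S.l 1 s).re) :
    DifferentiableAt ℂ (fun s => ∫ p in openSquare, S.diffKernel A s p) s := by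
  rw [X_re] at hX
  rw [W_re] at hW
  obtain ⟨ε, hε, h1, h2⟩ := exists_lt_affine_pos (a := S.M) (b := (A + S.e : ℕ) + 1) (σ := s.re)
    (a' := S.n * S.M + S.n * S.q)
    (b' := S.n * ((A + S.e : ℕ) + 1) + S.q * (S.l + 1) - S.n * S.q * (1 : ℕ))
    (by linarith) (by linarith)
  obtain ⟨K, -, hK⟩ := S.exists_norm_diffKernel_le A (s.re - ε) (s.re + ε) (‖s‖ + ε)
  refine differentiableAt_integral_of_bound hε
    (fun s _ => (S.measurable_diffKernel A s).aestronglyMeasurable) ?_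
    ((S.integrableOn_model_min (A + S.e) S.l 1 (σ := s.re - ε) (by linarith)
      (by linarith)).const_mul K) ?_
  · filter_upwards [ae_restrict_mem measurableSet_openSquare] with p hp
    have h := (S.differentiable_kernel A 0 0 0 hp).sub (S.zero.differentiable_kernel A 0 0 0 hp)
    refine Differentiable.differentiableOn ?_
    simp only [diffKernel_eq]
    exact h
  · filter_upwards [ae_restrict_mem measurableSet_openSquare] with p hp w hw
    have hw' := mem_ball_iff_norm.1 hw
    have := (abs_re_le_norm (w - s)).trans_lt hw'
    rw [sub_re, abs_lt] at this
    refine hK w ⟨by linarith, by linarith⟩ ?_ p hp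
    have := norm_add_le s (w - s)
    rw [add_sub_cancel] at this
    linarith

end Datum

end TwoPuiseux

/-! ### Linearisation in `t` and the residue of the difference. -/

namespace TwoPuiseux

/-- Mean value estimate with slope taken at `F`, not at an endpoint: replacing `y^(σ-1)` by
`F^(σ-1)` costs a second derivative times `|y - F| ≤ η`. -/
theorem abs_rpow_sub_rpow_sub_le {c F a b σ η : ℝ} (hc : 0 < c) (hF : 0 < F) (hc1 : c ≤ 1)
    (ha : c * F ≤ a) (hab : a ≤ b) (hη : ∀ y ∈ Icc a b, |y - F| ≤ η) (hσ : σ < 0) :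
    |b ^ σ - a ^ σ - σ * F ^ (σ - 1) * (b - a)| ≤
      |σ| * (|σ - 1| * (c * F) ^ (σ - 2) * η) * (b - a) := by
  have hcF : 0 < c * F := mul_pos hc hF
  have hcFF : c * F ≤ F := mul_le_of_le_one_left hF.le hc1
  have h1 : ∀ y ∈ Icc a b, |y ^ (σ - 1) - F ^ (σ - 1)| ≤ |σ - 1| * (c * F) ^ (σ - 2) * η := by
    intro y hy
    have h2 : ‖y ^ (σ - 1) - F ^ (σ - 1)‖ ≤ |σ - 1| * (c * F) ^ (σ - 2) * ‖y - F‖ := by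
      refine Convex.norm_image_sub_le_of_norm_hasDerivWithin_le (f := fun x : ℝ => x ^ (σ - 1))
        (f' := fun x => (σ - 1) * x ^ (σ - 1 - 1)) (s := Ici (c * F)) (fun x hx => ?_)
        (fun x hx => ?_) (convex_Ici _) hcFF (ha.trans hy.1)
      · exact (Real.hasDerivAt_rpow_const (Or.inl (hcF.trans_le hx).ne')).hasDerivWithinAt
      · have hx0 : 0 < x := hcF.trans_le hx
        rw [norm_mul, Real.norm_eq_abs, Real.norm_of_nonneg (Real.rpow_nonneg hx0.le _),
          show σ - 1 - 1 = σ - 2 by ring]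
        exact mul_le_mul_of_nonneg_left (Real.rpow_le_rpow_of_nonpos hcF hx (by linarith))
          (abs_nonneg _)
    exact h2.trans (mul_le_mul_of_nonneg_left (hη y hy)
      (mul_nonneg (abs_nonneg _) (Real.rpow_nonneg hcF.le _)))
  have h3 := norm_image_sub_le_of_norm_deriv_le_segment' (a := a) (b := b)
    (f := fun y : ℝ => y ^ σ - σ * F ^ (σ - 1) * y)
    (f' := fun y => σ * y ^ (σ - 1) - σ * F ^ (σ - 1) * 1)
    (C := |σ| * (|σ - 1| * (c * F) ^ (σ - 2) * η)) (fun y hy => ?_) (fun y hy => ?_) b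
    (right_mem_Icc.2 hab)
  · rw [Real.norm_eq_abs] at h3
    convert h3 using 2
    ring
  · have hy0 : 0 < y := hcF.trans_le (ha.trans hy.1)
    exact ((Real.hasDerivAt_rpow_const (Or.inl hy0.ne')).sub
      ((hasDerivAt_id y).const_mul _)).hasDerivWithinAt
  · rw [mul_one, ← mul_sub, norm_mul, Real.norm_eq_abs, Real.norm_eq_abs]
    exact mul_le_mul_of_nonneg_left (h1 y (Ico_subset_Icc_self hy)) (abs_nonneg _)

theorem one_sub_pow_le_mul {j : ℕ} {u : ℝ} (h0 : 0 ≤ u) : 1 - u ^ j ≤ j * (1 - u) := by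
  have := one_add_mul_sub_le_pow (show (-1 : ℝ) ≤ u by linarith) j
  linarith

theorem abs_pow_sub_pow_le {i j : ℕ} {u : ℝ} (h0 : 0 ≤ u) (h1 : u ≤ 1) :
    |u ^ i - u ^ j| ≤ (i + j) * (1 - u) := by
  have a1 := one_sub_pow_le_mul (j := i) h0
  have a2 := one_sub_pow_le_mul (j := j) h0
  have b1 := pow_le_one₀ (n := i) h0 h1
  have b2 := pow_le_one₀ (n := j) h0 h1
  have c1 : 0 ≤ (i : ℝ) * (1 - u) := mul_nonneg (Nat.cast_nonneg _) (by linarith)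
  have c2 : 0 ≤ (j : ℝ) * (1 - u) := mul_nonneg (Nat.cast_nonneg _) (by linarith)
  rw [abs_le]
  constructor <;> linarith

/-- Moves the exponent from `σ` down to `α` at the price of a constant, so that one dominating
function serves all `σ`. -/
theorem rpow_sub_le_mul_rpow {F α σ : ℝ} (hF : 0 < F) (hF2 : F ≤ 2) (hσ : α < σ) (hσ0 : σ < 0)
    (j : ℝ) : F ^ (σ - j) ≤ 2 ^ (-α) * F ^ (α - j) := by
  have h1 : F ^ (σ - α) ≤ 2 ^ (-α) :=
    (Real.rpow_le_rpow hF.le hF2 (by linarith)).trans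
      (Real.rpow_le_rpow_of_exponent_le (by norm_num) (by linarith))
  calc F ^ (σ - j) = F ^ (σ - α) * F ^ (α - j) := by rw [← Real.rpow_add hF]; congr 1; ring
    _ ≤ _ := by have := Real.rpow_nonneg hF.le (α - j); gcongr

namespace Datum

variable (S : Datum)

theorem diffKernel_ofReal (A : ℕ) (σ : ℝ) {p : ℝ × ℝ} (hp : p ∈ openSquare) :
    S.diffKernel A σ p =
      ((p.1 ^ (S.M * σ + A) * (S.f p.1 p.2 ^ σ - S.zero.f p.1 p.2 ^ σ) : ℝ) : ℂ) := by
  have h1 := (S.f_pos hp.1.1 hp.1.2.le hp.2.1.le hp.2.2.le).le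
  have h2 := (S.zero.f_pos hp.1.1 hp.1.2.le hp.2.1.le hp.2.2.le).le
  rw [diffKernel, ofReal_mul, ofReal_sub, ofReal_cpow hp.1.1.le, ofReal_cpow h1, ofReal_cpow h2]
  push_cast
  rfl

/-- Three replacements are made: `u^b` by `1`, the perturbed base by the model, and `u^c` by
`u^(m-1)`. They raise the weight, which is `0` at `α` for the linear part, by `q`, `k` and `q`. So
the errors are integrable at `α` itself. -/
theorem exists_integrable_bound_diffKernel_sub_model (A : ℕ) {α : ℝ} (hα0 : α < 0)
    (hA : 0 < S.M * α + (A + S.e : ℕ) + 1)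
    (hα : S.n * (S.M * α + A + 1) + S.q + S.n * S.q * α + S.k = 0) :
    ∃ E : ℝ × ℝ → ℝ, IntegrableOn E openSquare ∧ ∀ σ ∈ Ioo α 0, ∀ p ∈ openSquare,
      |p.1 ^ (S.M * σ + A) * (S.f p.1 p.2 ^ σ - S.zero.f p.1 p.2 ^ σ) -
        σ * S.t / S.m * modelIntegrand S.m S.n S.q S.l (S.M * σ + (A + S.e : ℕ)) (σ - 1) p| ≤
      E p := by
  have hw : (S.n : ℝ) * S.e + S.q * S.l = S.n * S.q + S.k := by exact_mod_cast S.weight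
  have hn : (0 : ℝ) < S.n := by exact_mod_cast S.hn
  have hq : (0 : ℝ) < S.q := by exact_mod_cast S.hq
  have hk : (0 : ℝ) < S.k := by exact_mod_cast S.hk
  have hm : (0 : ℝ) < S.m := by exact_mod_cast S.hm
  have he : (0 : ℝ) < S.e := by exact_mod_cast S.he
  have ht := S.ht
  push_cast at hA
  set c : ℝ := (1 / 2 : ℝ) ^ (S.b + S.n + 1) with hc
  have hc0 : 0 < c := by positivity
  have hc1 : c ≤ 1 := pow_le_one₀ (by norm_num) (by norm_num)
  set K₁ : ℝ := |α| * (|α - 1| * (c ^ (α - 2) * 2 ^ (-α))) * S.t with hK₁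
  set K₂ : ℝ := |α| * S.t * (S.c + (S.m - 1 : ℕ)) * 2 ^ (-α) with hK₂
  have hK₁0 : 0 ≤ K₁ := by positivity
  have hK₂0 : 0 ≤ K₂ := by positivity
  set T : ℝ → ℕ → ℝ → ℝ × ℝ → ℝ := fun a B r p =>
    p.1 ^ a * (1 - p.2 ^ S.m) ^ B * modelF S.m S.n S.q p.1 p.2 ^ r with hT
  refine ⟨fun p => K₁ * (S.b * T (S.M * α + A + S.q + S.e) (S.l + 1) (α - 2) p +
    S.t * T (S.M * α + A + S.e + S.e) (S.l + S.l) (α - 2) p) +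
    K₂ * T (S.M * α + A + S.e) (S.l + 1) (α - 1) p, ?_, ?_⟩
  · have i1 : IntegrableOn (T (S.M * α + A + S.q + S.e) (S.l + 1) (α - 2)) openSquare := by
      refine integrableOn_model S.hm S.hn S.hq _ (by linarith) (by linarith) ?_
      push_cast
      nlinarith
    have i2 : IntegrableOn (T (S.M * α + A + S.e + S.e) (S.l + S.l) (α - 2)) openSquare := by
      refine integrableOn_model S.hm S.hn S.hq _ (by linarith) (by linarith) ?_
      push_cast
      nlinarith
    have i3 : IntegrableOn (T (S.M * α + A + S.e) (S.l + 1) (α - 1)) openSquare := by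
      refine integrableOn_model S.hm S.hn S.hq _ (by linarith) (by linarith) ?_
      push_cast
      nlinarith
    exact (((i1.const_mul _).add (i2.const_mul _)).const_mul _).add (i3.const_mul _)
  · rintro σ ⟨hσα, hσ0⟩ ⟨z, u⟩ ⟨⟨hz, hz1⟩, hu, hu1⟩
    dsimp only at hz hz1 hu hu1 ⊢
    set g : ℝ := 1 - u ^ S.m with hgdef
    set F : ℝ := modelF S.m S.n S.q z u with hFdef
    have hg : 0 ≤ g := one_sub_pow_nonneg hu.le hu1.le
    have hug : 1 - u ≤ g := one_sub_le_one_sub_pow S.hm hu.le hu1.le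
    have hF : 0 < F := modelF_pos hz hu.le hu1.le
    have hF2 : F ≤ 2 := modelF_le_two hz.le hz1.le hu.le hu1.le
    set δ : ℝ := S.t * z ^ S.e * g ^ S.l with hδ
    have hδ0 : 0 ≤ δ := by positivity
    have hfd : S.f z u - S.zero.f z u = δ * u ^ S.c := by
      rw [S.f_eq_zero_f_add z u, add_sub_cancel_left]
    have huc0 : 0 ≤ u ^ S.c := by positivity
    have huc : u ^ S.c ≤ 1 := pow_le_one₀ hu.le hu1.le
    have hle : S.zero.f z u ≤ S.f z u := by
      have := mul_nonneg hδ0 huc0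
      linarith
    have hfle : S.f z u ≤ S.zero.f z u + δ := by
      have := mul_le_of_le_one_right hδ0 huc
      linarith
    have hcF : c * F ≤ S.zero.f z u := S.zero.const_mul_modelF_le hz.le hz1.le hu.le hu1.le
    have hzq : 0 ≤ z ^ S.q := by positivity
    have hf0a : S.zero.f z u ≤ F := by
      rw [zero_f, hFdef, modelF]
      have : u ^ S.b ≤ 1 := pow_le_one₀ hu.le hu1.le
      have := mul_le_of_le_one_right hzq this
      linarith
    have hf0b : F - z ^ S.q * (S.b * g) ≤ S.zero.f z u := by
      rw [zero_f, hFdef, modelF]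
      have h1 := one_sub_pow_le_mul (j := S.b) hu.le
      have h2 : (S.b : ℝ) * (1 - u) ≤ S.b * g := by gcongr
      have := mul_le_mul_of_nonneg_left (h1.trans h2) hzq
      linarith
    -- The first summand measures `1 - u^b`, which vanishes to first order in `g`; the second is the
    -- perturbation itself.
    set η : ℝ := z ^ S.q * (S.b * g) + δ with hη
    have hbg : 0 ≤ z ^ S.q * (S.b * g) := by positivity
    have hηy : ∀ y ∈ Icc (S.zero.f z u) (S.f z u), |y - F| ≤ η := by
      intro y hy
      rw [abs_le]
      constructor <;> linarith [hy.1, hy.2]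
    have main := abs_rpow_sub_rpow_sub_le hc0 hF hc1 hcF hle hηy hσ0
    rw [hfd] at main
    have hσa : |σ| ≤ |α| := by
      rw [abs_of_neg hσ0, abs_of_neg hα0]; linarith
    have hσa1 : |σ - 1| ≤ |α - 1| := by
      rw [abs_of_neg (by linarith), abs_of_neg (by linarith)]; linarith
    have hP : z ^ (S.M * σ + A) ≤ z ^ (S.M * α + A) :=
      Real.rpow_le_rpow_of_exponent_ge hz hz1.le (by gcongr)
    have hP0 : 0 ≤ z ^ (S.M * σ + A) := Real.rpow_nonneg hz.le _
    have hP1 : 0 ≤ z ^ (S.M * α + A) := Real.rpow_nonneg hz.le _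
    have hFa : (c * F) ^ (σ - 2) ≤ c ^ (α - 2) * 2 ^ (-α) * F ^ (α - 2) := by
      rw [Real.mul_rpow hc0.le hF.le, mul_assoc]
      have e1 : c ^ (σ - 2) ≤ c ^ (α - 2) :=
        Real.rpow_le_rpow_of_exponent_ge hc0 hc1 (by linarith)
      have e2 := rpow_sub_le_mul_rpow hF hF2 hσα hσ0 2
      have e3 := Real.rpow_nonneg hF.le (σ - 2)
      gcongr
    have hFb := rpow_sub_le_mul_rpow hF hF2 hσα hσ0 1
    have hFa0 := Real.rpow_nonneg hF.le (α - 2)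
    have hFb0 := Real.rpow_nonneg hF.le (α - 1)
    have hFσ0 := Real.rpow_nonneg hF.le (σ - 1)
    have hcF0 := Real.rpow_nonneg (mul_pos hc0 hF).le (σ - 2)
    have hη0 : 0 ≤ η := by positivity
    have step1 : |S.f z u ^ σ - S.zero.f z u ^ σ - σ * F ^ (σ - 1) * (δ * u ^ S.c)| ≤
        |α| * (|α - 1| * (c ^ (α - 2) * 2 ^ (-α) * F ^ (α - 2)) * η) * δ := by
      refine main.trans ?_
      have := mul_le_of_le_one_right hδ0 huc
      have := mul_nonneg hδ0 huc0
      gcongr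
    have step2 : |σ * F ^ (σ - 1) * (δ * u ^ S.c) - σ * F ^ (σ - 1) * (δ * u ^ (S.m - 1))| ≤
        |α| * (2 ^ (-α) * F ^ (α - 1)) * (δ * ((S.c + (S.m - 1 : ℕ)) * g)) := by
      rw [← mul_sub, ← mul_sub, abs_mul, abs_mul, abs_mul, abs_of_nonneg hFσ0, abs_of_nonneg hδ0]
      have h1 := abs_pow_sub_pow_le (i := S.c) (j := S.m - 1) hu.le hu1.le
      have h2 : ((S.c : ℝ) + (S.m - 1 : ℕ)) * (1 - u) ≤ (S.c + (S.m - 1 : ℕ)) * g := by gcongr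
      have h3 := h1.trans h2
      gcongr
    have hmodel : σ * S.t / S.m * modelIntegrand S.m S.n S.q S.l (S.M * σ + (A + S.e : ℕ)) (σ - 1)
        (z, u) = z ^ (S.M * σ + A) * (σ * F ^ (σ - 1) * (δ * u ^ (S.m - 1))) := by
      have : z ^ (S.M * σ + (A + S.e : ℕ)) = z ^ (S.M * σ + A) * z ^ S.e := by
        rw [Nat.cast_add, ← add_assoc, Real.rpow_add hz, Real.rpow_natCast]
      simp only [modelIntegrand]
      rw [this]
      field_simp
      ring
    rw [hmodel, ← mul_sub, abs_mul, abs_of_nonneg hP0]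
    have step3 := (abs_sub_le (S.f z u ^ σ - S.zero.f z u ^ σ) (σ * F ^ (σ - 1) * (δ * u ^ S.c))
      (σ * F ^ (σ - 1) * (δ * u ^ (S.m - 1)))).trans (add_le_add step1 step2)
    refine (mul_le_mul hP step3 (abs_nonneg _) hP1).trans (le_of_eq ?_)
    have e1 : z ^ (S.M * α + A + S.q + S.e) = z ^ (S.M * α + A) * z ^ S.q * z ^ S.e := by
      rw [Real.rpow_add hz, Real.rpow_add hz (S.M * α + A), Real.rpow_natCast, Real.rpow_natCast]
    have e2 : z ^ (S.M * α + A + S.e + S.e) = z ^ (S.M * α + A) * z ^ S.e * z ^ S.e := by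
      rw [Real.rpow_add hz, Real.rpow_add hz (S.M * α + A), Real.rpow_natCast]
    have e3 : z ^ (S.M * α + A + S.e) = z ^ (S.M * α + A) * z ^ S.e := by
      rw [Real.rpow_add hz (S.M * α + A), Real.rpow_natCast]
    simp only [hT, e1, e2, e3, ← hgdef, ← hFdef]
    rw [pow_succ, pow_add, hη, hδ, hK₁, hK₂]
    ring

theorem tendsto_sub_mul_integral_diffKernel (A : ℕ) (hl : S.l < S.n) {α : ℝ} (hα0 : α < 0)
    (hα : S.n * (S.M * α + A + 1) + S.q + S.n * S.q * α + S.k = 0) :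
    Tendsto (fun σ : ℝ => ((σ : ℂ) - α) * ∫ p in openSquare, S.diffKernel A σ p) (𝓝[>] α)
      (𝓝 ((α : ℂ) * S.t / (S.m * (S.n * (S.M + S.q))) *
        betaIntegral ((S.l + 1) / S.n) (-α + 1 - (S.l + 1) / S.n))) := by
  have hw : (S.n : ℝ) * S.e + S.q * S.l = S.n * S.q + S.k := by exact_mod_cast S.weight
  have hn : (0 : ℝ) < S.n := by exact_mod_cast S.hn
  have hq : (0 : ℝ) < S.q := by exact_mod_cast S.hq
  have hm : (0 : ℝ) < S.m := by exact_mod_cast S.hm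
  have hl' : (S.l : ℝ) + 1 ≤ S.n := by exact_mod_cast hl
  set P : ℝ := (S.l + 1) / S.n with hP
  set P' : ℝ := -α + 1 - P with hP'
  have hnP : (S.l : ℝ) + 1 = S.n * P := by rw [hP]; field_simp
  have hP0 : 0 < P := by positivity
  have hP1 : P ≤ 1 := by rw [hP, div_le_one hn]; exact hl'
  -- The bound `l < n` enters here: it gives `P ≤ 1`, and `α < 0` does the rest.
  have hP'0 : 0 < P' := by linarith
  -- The vanishing of the weight at `α` identifies the exponent of `z` with the one in the beta
  -- boundary integral.
  have hexp : S.M * α + (A + S.e : ℕ) = S.q * P' - 1 := by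
    have : S.n * (S.M * α + (A + S.e : ℕ) + 1) = S.n * (S.q * P') := by
      push_cast
      rw [hP', show (S.n : ℝ) * (S.q * (-α + 1 - P)) =
        -S.n * S.q * α + S.n * S.q - S.q * (S.n * P) by ring, ← hnP]
      linear_combination hα + hw
    linarith [mul_left_cancel₀ hn.ne' this]
  have hA : 0 < S.M * α + (A + S.e : ℕ) + 1 := by
    rw [hexp, sub_add_cancel]
    positivity
  obtain ⟨E, hE, hEb⟩ := S.exists_integrable_bound_diffKernel_sub_model A hα0 hA hα
  have hWzero : S.n * (S.M * α + (A + S.e : ℕ) + 1) + S.q * (S.l + 1) + S.n * S.q * (α - 1) = 0 := by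
    push_cast
    linear_combination hα + hw
  have hlim := tendsto_sub_mul_integral_modelIntegrand (l := S.l) S.hm S.hn S.hq (M := S.M)
    (A := (A + S.e : ℕ)) hα0 hA hWzero
  have hmem : Ioo α 0 ∈ 𝓝[>] α := Ioo_mem_nhdsGT hα0
  set I : ℝ → ℝ := fun σ => ∫ p in openSquare,
    modelIntegrand S.m S.n S.q S.l (S.M * σ + (A + S.e : ℕ)) (σ - 1) p with hI
  set Dr : ℝ → ℝ × ℝ → ℝ := fun σ p =>
    p.1 ^ (S.M * σ + A) * (S.f p.1 p.2 ^ σ - S.zero.f p.1 p.2 ^ σ) with hDr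
  have hDint : ∀ σ : ℝ, ∫ p in openSquare, S.diffKernel A σ p =
      ((∫ p in openSquare, Dr σ p : ℝ) : ℂ) := by
    intro σ
    rw [← integral_complex_ofReal]
    exact setIntegral_congr_fun measurableSet_openSquare fun p hp => S.diffKernel_ofReal A σ hp
  have hid : Tendsto (fun σ : ℝ => σ) (𝓝[>] α) (𝓝 α) := nhdsWithin_le_nhds
  -- The error integral is bounded independently of `σ`, so the factor `σ - α` kills it.
  have herr : Tendsto (fun σ : ℝ => (σ - α) * ((∫ p in openSquare, Dr σ p) - σ * S.t / S.m * I σ))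
      (𝓝[>] α) (𝓝 0) := by
    have h0 : Tendsto (fun σ : ℝ => (σ - α) * ∫ p in openSquare, E p) (𝓝[>] α) (𝓝 0) := by
      have := (hid.sub_const α).mul_const (∫ p in openSquare, E p)
      rwa [sub_self, zero_mul] at this
    refine squeeze_zero_norm' ?_ h0
    filter_upwards [hmem] with σ hσ
    have hσα : 0 < σ - α := by linarith [hσ.1]
    have hMσ : S.M * α ≤ S.M * σ := by have := hσ.1.le; gcongr
    have hWσ : (S.n * (S.M * σ + (A + S.e : ℕ) + 1) + S.q * (S.l + 1) + S.n * S.q * (σ - 1) : ℝ) =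
        S.n * (S.M + S.q) * (σ - α) := by linear_combination hWzero
    have hWpos : 0 < (S.n : ℝ) * (S.M + S.q) * (σ - α) := by positivity
    have i1 : IntegrableOn (modelIntegrand S.m S.n S.q S.l (S.M * σ + (A + S.e : ℕ)) (σ - 1))
        openSquare := by
      refine integrableOn_modelIntegrand S.hm S.hn S.hq (by linarith [hσ.2]) (by linarith) ?_
      rw [hWσ]; exact hWpos
    have i2 : IntegrableOn (Dr σ) openSquare := by
      have h := (S.integrableOn_diffKernel A (s := σ) (by
        rw [X_re, ofReal_re]; linarith) (by
        rw [W_re, ofReal_re, Nat.cast_one, hWσ]; exact hWpos)).re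
      refine h.congr ?_
      filter_upwards [ae_restrict_mem measurableSet_openSquare] with p hp
      rw [S.diffKernel_ofReal A σ hp, RCLike.re_eq_complex_re, ofReal_re]
    rw [hI, ← integral_const_mul, ← integral_sub i2 (i1.const_mul _), norm_mul,
      Real.norm_of_nonneg hσα.le]
    refine mul_le_mul_of_nonneg_left (norm_integral_le_of_norm_le hE ?_) hσα.le
    filter_upwards [ae_restrict_mem measurableSet_openSquare] with p hp
    exact hEb σ hσ p hp
  have hmain := ((hid.mul_const S.t).div_const (S.m : ℝ)).mul hlim
  have hsum := herr.add hmain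
  rw [zero_add] at hsum
  have hbeta := add_bdry_model_eq_betaIntegral S.hm S.hn S.hq hP0 hP'0 hnP
  have hexp2 : -(P + P') = α - 1 := by rw [hP']; ring
  rw [hexp2, ← hexp] at hbeta
  have hPc : ((S.l : ℂ) + 1) / S.n = (P : ℂ) := by rw [hP]; push_cast; rfl
  have hP'c : -(α : ℂ) + 1 - (P : ℂ) = (P' : ℂ) := by rw [hP']; push_cast; rfl
  rw [hPc, hP'c, ← hbeta]
  have hcast := (continuous_ofReal.tendsto _).comp hsum
  convert hcast using 2
  · rename_i σ
    simp only [Function.comp]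
    rw [hDint, ← ofReal_sub, ← ofReal_mul]
    congr 1
    ring
  · push_cast
    field_simp

end Datum

end TwoPuiseux

/-! ### Residues of the continuations. -/

namespace TwoPuiseux

theorem continuousAt_Gamma_affine {p r α : ℂ} (h : ∀ j : ℕ, p * α + r ≠ -j) :
    ContinuousAt (fun s => Gamma (p * s + r)) α :=
  ContinuousAt.comp (f := fun s => p * s + r) (differentiableAt_Gamma _ h).continuousAt
    (by fun_prop)

/-- The Gamma function of an affine function has at most simple poles. -/
theorem exists_tendsto_sub_mul_Gamma_affine {p : ℂ} (hp : p ≠ 0) (r α : ℂ) :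
    ∃ c, Tendsto (fun s => (s - α) * Gamma (p * s + r)) (𝓝[≠] α) (𝓝 c) := by
  by_cases h : ∀ j : ℕ, p * α + r ≠ -j
  · refine ⟨(α - α) * Gamma (p * α + r), ?_⟩
    have h1 : ContinuousAt (fun s : ℂ => s - α) α := by fun_prop
    exact (h1.mul (continuousAt_Gamma_affine h)).tendsto.mono_left nhdsWithin_le_nhds
  · push Not at h
    obtain ⟨j, hj⟩ := h
    have hv : ∀ s, p * s + r = p * (s - α) - j := fun s => by linear_combination hj
    -- At a pole `-j` one writes `Γ(v) = Γ(v + j + 1) / (v (v + 1) ⋯ (v + j))`; the numerator is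
    -- regular and the last factor is `p (s - α)`.
    have hc1 : ContinuousAt (fun s => Gamma (p * s + (r + (j + 1 : ℕ)))) α := by
      refine continuousAt_Gamma_affine fun i hi => ?_
      have : ((1 + i : ℕ) : ℂ) = 0 := by push_cast at hi ⊢; linear_combination hi - hj
      exact absurd (Nat.cast_eq_zero.1 this) (by omega)
    have hne : ∏ i ∈ Finset.range j, (p * α + r + (i : ℂ)) ≠ 0 := by
      refine Finset.prod_ne_zero_iff.2 fun i hi h0 => ?_
      rw [hj, neg_add_eq_zero, Nat.cast_inj] at h0
      exact absurd (Finset.mem_range.1 hi) (by omega)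
    have hc2 : ContinuousAt (fun s => ∏ i ∈ Finset.range j, (p * s + r + (i : ℂ))) α := by
      fun_prop
    have hc := hc1.div ((continuousAt_const (y := p)).mul hc2) (mul_ne_zero hp hne)
    refine ⟨_, (hc.tendsto.mono_left nhdsWithin_le_nhds).congr' ?_⟩
    filter_upwards [self_mem_nhdsWithin,
      (hc2.eventually_ne hne).filter_mono nhdsWithin_le_nhds] with s hs hs'
    have hs : s - α ≠ 0 := sub_ne_zero.2 hs
    have hj0 : p * s + r + j = p * (s - α) := by rw [hv s]; ring
    have hall : ∀ i < j + 1, p * s + r + (i : ℕ) ≠ 0 := by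
      intro i hi
      rcases Nat.lt_succ_iff_lt_or_eq.1 hi with hi | rfl
      · exact Finset.prod_ne_zero_iff.1 hs' i (Finset.mem_range.2 hi)
      · rw [hj0]; exact mul_ne_zero hp hs
    have := Gamma_add_nat_eq_prod_of_ne_zero hall
    rw [Finset.prod_range_succ, hj0, add_assoc] at this
    simp only [Pi.div_apply, Pi.mul_apply, this]
    field_simp

/-- A meromorphic function with a limit along a filter finer than `𝓝[≠] α` has this limit
at `α`. -/
theorem tendsto_of_meromorphicAt {Φ : ℂ → ℂ} {α c : ℂ} (hΦ : MeromorphicAt Φ α) {F : Filter ℂ}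
    [F.NeBot] (hF : F ≤ 𝓝[≠] α) (h : Tendsto Φ F (𝓝 c)) : Tendsto Φ (𝓝[≠] α) (𝓝 c) := by
  -- At a pole the norm tends to infinity along every approach, which a finite limit along `F`
  -- excludes.
  by_cases ho : meromorphicOrderAt Φ α < 0
  · have h1 := (tendsto_cobounded_of_meromorphicOrderAt_neg ho).mono_left hF
    exact absurd h.norm (not_tendsto_nhds_of_tendsto_atTop (tendsto_norm_atTop_iff_cobounded.2 h1) _)
  · obtain ⟨c', hc'⟩ := tendsto_nhds_of_meromorphicOrderAt_nonneg hΦ (not_lt.1 ho)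
    rwa [tendsto_nhds_unique h (hc'.mono_left hF)]

theorem meromorphic_Gamma_comp {v : ℂ → ℂ} (hv : Differentiable ℂ v) :
    Meromorphic fun s => Gamma (v s) := by
  have h : Meromorphic fun s => (Gamma (v s))⁻¹ := fun s =>
    (((differentiable_one_div_Gamma.comp hv).analyticAt s).meromorphicAt)
  simpa using h.fun_inv

theorem tendsto_ofReal_nhdsGT_nhdsNE (α : ℝ) :
    Tendsto (fun σ : ℝ => (σ : ℂ)) (𝓝[>] α) (𝓝[≠] (α : ℂ)) := by
  refine tendsto_nhdsWithin_iff.2 ⟨(continuous_ofReal.tendsto α).mono_left nhdsWithin_le_nhds, ?_⟩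
  filter_upwards [self_mem_nhdsWithin] with σ hσ
  simpa using (ne_of_gt hσ : σ ≠ α)

namespace Datum

variable (S : Datum)

/-- The continuation of `S.zero.J` has at most a simple pole at points `α` with `n α ∉ ℤ`. -/
theorem exists_tendsto_zero (A : ℕ) {H : ℂ → ℂ} (hH : Differentiable ℂ H) {α : ℂ}
    (hα : ∀ z : ℤ, S.n * α ≠ z) :
    ∃ c, Tendsto (fun s => (s - α) * (Gamma (S.zero.x A s) * Gamma (S.zero.w A 0 0 s) * H s))
      (𝓝[≠] α) (𝓝 c) := by
  have hq : (S.q : ℂ) ≠ 0 := by exact_mod_cast S.hq.ne'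
  have hn : (S.n : ℂ) ≠ 0 := by exact_mod_cast S.hn.ne'
  have hM : (S.M : ℂ) ≠ 0 := by exact_mod_cast S.hM.ne'
  have hMq : (S.M + S.q : ℂ) ≠ 0 := by
    have := S.hq
    exact_mod_cast (by omega : S.M + S.q ≠ 0)
  have hxz : ∀ s, S.zero.x A s = S.M / S.q * s + (A + 1) / S.q := fun s => by
    simp only [x, X, zero]; field_simp; ring
  have hwz : ∀ s, S.zero.w A 0 0 s =
      S.n * (S.M + S.q) / S.q * s + (S.n * (A + 1) + S.q) / S.q := fun s => by
    simp only [w, W, X, zero]; push_cast; field_simp; ring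
  -- If both Gamma factors had a pole at `α`, with `x = -j` and `w = -i`, this relation would give
  -- `n α = n j - 1 - i`, an integer. It relies on `d = q`.
  have hrel : ∀ s, S.zero.w A 0 0 s = S.n * S.zero.x A s + 1 + S.n * s := fun s => by
    rw [hxz, hwz]; field_simp; ring
  have hHc : Tendsto H (𝓝[≠] α) (𝓝 (H α)) :=
    (hH.continuous.tendsto α).mono_left nhdsWithin_le_nhds
  by_cases h : ∀ j : ℕ, S.zero.x A α ≠ -j
  · simp only [hxz] at h
    have h1 := (continuousAt_Gamma_affine h).tendsto.mono_left (nhdsWithin_le_nhds (s := {α}ᶜ))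
    obtain ⟨c, hc⟩ := exists_tendsto_sub_mul_Gamma_affine
      (div_ne_zero (mul_ne_zero hn hMq) hq) ((S.n * (A + 1) + S.q) / S.q) α
    refine ⟨_, ((h1.mul hc).mul hHc).congr fun s => ?_⟩
    rw [hxz, hwz]; ring
  · push Not at h
    obtain ⟨j, hj⟩ := h
    have h' : ∀ i : ℕ, S.zero.w A 0 0 α ≠ -i := by
      intro i hi
      refine hα (S.n * j - 1 - i) ?_
      rw [hrel, hj] at hi
      push_cast
      linear_combination hi
    simp only [hwz] at h'
    have h1 := (continuousAt_Gamma_affine h').tendsto.mono_left (nhdsWithin_le_nhds (s := {α}ᶜ))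
    obtain ⟨c, hc⟩ := exists_tendsto_sub_mul_Gamma_affine (div_ne_zero hM hq) ((A + 1) / S.q) α
    refine ⟨_, ((h1.mul hc).mul hHc).congr fun s => ?_⟩
    rw [hxz, hwz]; ring

/-- The residues of the continuations of `J` for the given `t` and for `t = 0` differ by a
multiple of a beta value. -/
theorem tendsto_sub_mul_continuation (A : ℕ) {H H₀ : ℂ → ℂ} (hH : Differentiable ℂ H)
    (hH₀ : Differentiable ℂ H₀)
    (hJ : ∀ s, 0 < (S.X A s).re → 0 < (S.W A 0 0 s).re →
      S.J A 0 0 0 s = Gamma (S.x A s) * Gamma (S.w A 0 0 s) * H s)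
    (hJ₀ : ∀ s, 0 < (S.zero.X A s).re → 0 < (S.zero.W A 0 0 s).re →
      S.zero.J A 0 0 0 s = Gamma (S.zero.x A s) * Gamma (S.zero.w A 0 0 s) * H₀ s)
    (hl : S.l < S.n) {α : ℝ} (hα0 : α < 0)
    (hα : S.n * (S.M * α + A + 1) + S.q + S.n * S.q * α + S.k = 0) {c₀ : ℂ}
    (hc₀ : Tendsto (fun s => (s - α) * (Gamma (S.zero.x A s) * Gamma (S.zero.w A 0 0 s) * H₀ s))
      (𝓝[≠] (α : ℂ)) (𝓝 c₀)) :
    Tendsto (fun s => (s - α) * (Gamma (S.x A s) * Gamma (S.w A 0 0 s) * H s))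
      (𝓝[≠] (α : ℂ)) (𝓝 (c₀ + (α : ℂ) * S.t / (S.m * (S.n * (S.M + S.q))) *
        betaIntegral ((S.l + 1) / S.n) (-α + 1 - (S.l + 1) / S.n))) := by
  have hw : (S.n : ℝ) * S.e + S.q * S.l = S.n * S.q + S.k := by exact_mod_cast S.weight
  have hn : (0 : ℝ) < S.n := by exact_mod_cast S.hn
  have hq : (0 : ℝ) < S.q := by exact_mod_cast S.hq
  have hM : (0 : ℝ) < S.M := by exact_mod_cast S.hM
  have hl' : (S.l : ℝ) + 1 ≤ S.n := by exact_mod_cast hl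
  set V : ℂ → ℂ := fun s => (Gamma (S.x A s))⁻¹ * (Gamma (S.w A 0 0 s))⁻¹ with hV
  set V₀ : ℂ → ℂ := fun s => (Gamma (S.zero.x A s))⁻¹ * (Gamma (S.zero.w A 0 0 s))⁻¹ with hV₀
  have hVd : Differentiable ℂ V := (differentiable_one_div_Gamma.comp (S.differentiable_x A)).mul
    (differentiable_one_div_Gamma.comp (S.differentiable_w A 0 0))
  have hV₀d : Differentiable ℂ V₀ :=
    (differentiable_one_div_Gamma.comp (S.zero.differentiable_x A)).mul
    (differentiable_one_div_Gamma.comp (S.zero.differentiable_w A 0 0))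
  set I : ℂ → ℂ := fun s => ∫ p in openSquare, S.diffKernel A s p with hI
  have hXα : 0 < S.M * α + (A + S.e) + 1 := by
    have : S.n * (S.M * α + (A + S.e) + 1) = S.q * (S.n - 1 - S.l) + S.n * S.q * (-α) := by
      linear_combination hα + hw
    have h2 : 0 < S.n * S.q * (-α) := mul_pos (mul_pos hn hq) (by linarith)
    have h3 : 0 ≤ S.q * ((S.n : ℝ) - 1 - S.l) := mul_nonneg hq.le (by linarith)
    exact pos_of_mul_pos_right (by rw [this]; linarith) hn.le
  set U : Set ℂ := {s | α < s.re} with hU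
  have hUo : IsOpen U := isOpen_lt continuous_const continuous_re
  have hUp : IsPreconnected U := (convex_halfSpace_re_gt α).isPreconnected
  have hId : DifferentiableOn ℂ I U := by
    intro s hs
    have hs : α < s.re := hs
    have hMs : S.M * α < S.M * s.re := by gcongr
    refine (S.differentiableAt_integral_diffKernel A ?_ ?_).differentiableWithinAt
    · rw [X_re]; push_cast; linarith
    · rw [W_re]
      push_cast
      have : S.n * (S.M * s.re + (A + S.e) + 1) + S.q * (S.l + 1) + S.n * S.q * (s.re - 1) =
        S.n * (S.M + S.q) * (s.re - α) := by linear_combination hα + hw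
      rw [this]
      have : 0 < s.re - α := by linarith
      positivity
  set T : ℝ := max (max (S.abscissa A 0 0) (S.zero.abscissa A 0 0)) α with hT
  have hreg : ∀ s : ℂ, T < s.re → (0 < (S.X A s).re ∧ 0 < (S.W A 0 0 s).re) ∧
      (0 < (S.zero.X A s).re ∧ 0 < (S.zero.W A 0 0 s).re) := by
    intro s hs
    rw [hT, max_lt_iff, max_lt_iff] at hs
    exact ⟨(S.abscissa_lt_iff _ _ _ _).1 hs.1.1, (S.zero.abscissa_lt_iff _ _ _ _).1 hs.1.2⟩
  have hGx : ∀ s : ℂ, T < s.re → (Gamma (S.x A s) ≠ 0 ∧ Gamma (S.w A 0 0 s) ≠ 0) ∧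
      (Gamma (S.zero.x A s) ≠ 0 ∧ Gamma (S.zero.w A 0 0 s) ≠ 0) := by
    intro s hs
    obtain ⟨⟨h1, h2⟩, h3, h4⟩ := hreg s hs
    exact ⟨⟨Gamma_ne_zero_of_re_pos (S.x_re_pos.2 h1), Gamma_ne_zero_of_re_pos (S.w_re_pos.2 h2)⟩,
      Gamma_ne_zero_of_re_pos (S.zero.x_re_pos.2 h3),
      Gamma_ne_zero_of_re_pos (S.zero.w_re_pos.2 h4)⟩
  -- The relation between difference and continuations is multiplied by the entire reciprocals of
  -- the Gamma factors, so that it can be extended by the identity theorem without meeting poles.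
  have hfar : ∀ s : ℂ, T < s.re → V s * V₀ s * I s = V₀ s * H s - V s * H₀ s := by
    intro s hs
    obtain ⟨⟨h1, h2⟩, h3, h4⟩ := hreg s hs
    obtain ⟨⟨g1, g2⟩, g3, g4⟩ := hGx s hs
    simp only [hV, hV₀, hI]
    rw [S.integral_diffKernel A h1 h2, hJ s h1 h2, hJ₀ s h3 h4]
    field_simp
  have hid : EqOn (fun s => V s * V₀ s * I s) (fun s => V₀ s * H s - V s * H₀ s) U := by
    have hA1 : AnalyticOnNhd ℂ (fun s => V s * V₀ s * I s) U :=
      (((hVd.mul hV₀d).differentiableOn).mul hId).analyticOnNhd hUo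
    have hA2 : AnalyticOnNhd ℂ (fun s => V₀ s * H s - V s * H₀ s) U :=
      ((hV₀d.mul hH).sub (hVd.mul hH₀)).differentiableOn.analyticOnNhd hUo
    refine hA1.eqOn_of_preconnected_of_eventuallyEq hA2 hUp (z₀ := ((T + 1 : ℝ) : ℂ)) ?_ ?_
    · have : α ≤ T := le_max_right _ _
      show α < ((T + 1 : ℝ) : ℂ).re
      rw [ofReal_re]
      linarith
    · have : {s : ℂ | T < s.re} ∈ 𝓝 ((T + 1 : ℝ) : ℂ) :=
        (isOpen_lt continuous_const continuous_re).mem_nhds (by simp)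
      filter_upwards [this] with s hs using hfar s hs
  have hEne : ∀ᶠ s in 𝓝[≠] (α : ℂ), V s * V₀ s ≠ 0 := by
    have hA : AnalyticOnNhd ℂ (fun s => V s * V₀ s) univ :=
      (hVd.mul hV₀d).differentiableOn.analyticOnNhd isOpen_univ
    rcases (hA (α : ℂ) (mem_univ _)).eventually_eq_zero_or_eventually_ne_zero with h | h
    · have h0 := hA.eqOn_zero_of_preconnected_of_eventuallyEq_zero isPreconnected_univ
        (mem_univ _) h
      obtain ⟨⟨g1, g2⟩, g3, g4⟩ := hGx ((T + 1 : ℝ) : ℂ) (by rw [ofReal_re]; linarith)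
      refine absurd (h0 (mem_univ ((T + 1 : ℝ) : ℂ))) ?_
      simp only [hV, hV₀]
      positivity
    · exact h
  set G : ℂ → ℂ := fun s => Gamma (S.x A s) * Gamma (S.w A 0 0 s) * H s with hG
  set G₀ : ℂ → ℂ := fun s => Gamma (S.zero.x A s) * Gamma (S.zero.w A 0 0 s) * H₀ s with hG₀
  have hGm : Meromorphic fun s => (s - α) * (G s - G₀ s) := by
    have hHm : Meromorphic H := fun s => (hH.analyticAt s).meromorphicAt
    have hH₀m : Meromorphic H₀ := fun s => (hH₀.analyticAt s).meromorphicAt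
    have h1 : Meromorphic G := ((meromorphic_Gamma_comp (S.differentiable_x A)).fun_mul
      (meromorphic_Gamma_comp (S.differentiable_w A 0 0))).fun_mul hHm
    have h2 : Meromorphic G₀ := ((meromorphic_Gamma_comp (S.zero.differentiable_x A)).fun_mul
      (meromorphic_Gamma_comp (S.zero.differentiable_w A 0 0))).fun_mul hH₀m
    have h3 : Meromorphic fun s : ℂ => s - (α : ℂ) := fun s =>
      ((differentiable_id.sub_const _).analyticAt s).meromorphicAt
    exact h3.fun_mul (h1.fun_sub h2)
  have hlim := S.tendsto_sub_mul_integral_diffKernel A hl hα0 hα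
  have hR := tendsto_ofReal_nhdsGT_nhdsNE α
  have hdiff : Tendsto (fun s => (s - α) * (G s - G₀ s)) (𝓝[≠] (α : ℂ))
      (𝓝 ((α : ℂ) * S.t / (S.m * (S.n * (S.M + S.q))) *
        betaIntegral ((S.l + 1) / S.n) (-α + 1 - (S.l + 1) / S.n))) := by
    -- A limit along the real axis from the right is enough: there the difference is still given by
    -- its convergent integral.
    refine tendsto_of_meromorphicAt (hGm α) (F := map (fun σ : ℝ => (σ : ℂ)) (𝓝[>] α)) hR ?_
    rw [tendsto_map'_iff]
    refine hlim.congr' ?_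
    filter_upwards [hR.eventually hEne, self_mem_nhdsWithin] with σ h1 h2
    have h3 := hid (show (σ : ℂ) ∈ U by simpa [hU] using h2)
    have h4 : I σ = G σ - G₀ σ := by
      refine mul_left_cancel₀ h1 (h3.trans ?_)
      simp only [hV, hV₀, mul_ne_zero_iff, ne_eq, inv_eq_zero] at h1
      obtain ⟨⟨g1, g2⟩, g3, g4⟩ := h1
      simp only [hV, hV₀, hG, hG₀]
      field_simp
    simp only [Function.comp, ← h4, hI]
  refine (hc₀.add hdiff).congr fun s => ?_
  ring

end Datum

end TwoPuiseux

/-! ### Changes of variables and the signed strip near `u = 1`. -/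

namespace TwoPuiseux

/-- The triangular map `(z, u) ↦ (g z, a z + b z * u)`. -/
def triangularMap (g a b : ℝ → ℝ) (p : ℝ × ℝ) : ℝ × ℝ := (g p.1, a p.1 + b p.1 * p.2)

section

variable {E : Type*} [NormedAddCommGroup E] [NormedSpace ℝ E] {g a b g' a' b' : ℝ → ℝ}
  {s : Set (ℝ × ℝ)}

theorem hasFDerivAt_triangularMap {p : ℝ × ℝ} (hg : HasDerivAt g (g' p.1) p.1)
    (ha : HasDerivAt a (a' p.1) p.1) (hb : HasDerivAt b (b' p.1) p.1) :
    HasFDerivAt (triangularMap g a b) (Matrix.toLin (.finTwoProd ℝ) (.finTwoProd ℝ)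
      !![g' p.1, 0; a' p.1 + b' p.1 * p.2, b p.1]).toContinuousLinearMap p := by
  rw [Matrix.toLin_finTwoProd_toContinuousLinearMap]
  have hf : HasFDerivAt (Prod.fst : ℝ × ℝ → ℝ) (ContinuousLinearMap.fst ℝ ℝ ℝ) p := hasFDerivAt_fst
  have h1 := hg.comp_hasFDerivAt p hf
  have h2 := ha.comp_hasFDerivAt p hf
  have h3 := (hb.comp_hasFDerivAt p hf).mul
    (hasFDerivAt_snd : HasFDerivAt Prod.snd (ContinuousLinearMap.snd ℝ ℝ ℝ) p)
  have h4 := h1.prodMk (h2.add h3)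
  refine h4.congr_fderiv ?_
  ext <;> simp
  ring

theorem abs_det_triangularMap (x y z : ℝ) :
    |(Matrix.toLin (.finTwoProd ℝ) (.finTwoProd ℝ)
      !![x, 0; y, z]).toContinuousLinearMap.det| = |x * z| := by
  simp [Matrix.det_fin_two_of]

theorem integral_image_triangularMap (hs : MeasurableSet s)
    (hg : ∀ p ∈ s, HasDerivAt g (g' p.1) p.1) (ha : ∀ p ∈ s, HasDerivAt a (a' p.1) p.1)
    (hb : ∀ p ∈ s, HasDerivAt b (b' p.1) p.1) (hinj : InjOn (triangularMap g a b) s)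
    (F : ℝ × ℝ → E) : ∫ p in triangularMap g a b '' s, F p =
      ∫ p in s, |g' p.1 * b p.1| • F (triangularMap g a b p) := by
  rw [integral_image_eq_integral_abs_det_fderiv_smul volume hs (fun p hp =>
    (hasFDerivAt_triangularMap (hg p hp) (ha p hp) (hb p hp)).hasFDerivWithinAt) hinj]
  simp only [abs_det_triangularMap]

theorem integrableOn_image_triangularMap (hs : MeasurableSet s)
    (hg : ∀ p ∈ s, HasDerivAt g (g' p.1) p.1) (ha : ∀ p ∈ s, HasDerivAt a (a' p.1) p.1)
    (hb : ∀ p ∈ s, HasDerivAt b (b' p.1) p.1) (hinj : InjOn (triangularMap g a b) s)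
    (F : ℝ × ℝ → E) : IntegrableOn F (triangularMap g a b '' s) ↔
      IntegrableOn (fun p => |g' p.1 * b p.1| • F (triangularMap g a b p)) s := by
  rw [integrableOn_image_iff_integrableOn_abs_det_fderiv_smul volume hs (fun p hp =>
    (hasFDerivAt_triangularMap (hg p hp) (ha p hp) (hb p hp)).hasFDerivWithinAt) hinj]
  simp only [abs_det_triangularMap]

theorem injOn_triangularMap {t : Set ℝ} (hg : InjOn g t) (hs : ∀ p ∈ s, p.1 ∈ t)
    (hb : ∀ p ∈ s, b p.1 ≠ 0) : InjOn (triangularMap g a b) s := by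
  rintro ⟨z, u⟩ hp ⟨z', u'⟩ hp' h
  simp only [triangularMap, Prod.mk.injEq] at h
  obtain ⟨h1, h2⟩ := h
  have hz : z = z' := hg (hs _ hp) (hs _ hp') h1
  subst hz
  have := mul_left_cancel₀ (hb _ hp) (add_left_cancel h2)
  rw [this]

end

/-- The region `0 < z ≤ 1`, `0 ≤ u ≤ U z`. -/
def regionU (U : ℝ → ℝ) : Set (ℝ × ℝ) := {p | (0 < p.1 ∧ p.1 ≤ 1) ∧ 0 ≤ p.2 ∧ p.2 ≤ U p.1}

/-- The part of the half-open unit square above the graph of `U`. -/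
def regionBelowOne (U : ℝ → ℝ) : Set (ℝ × ℝ) := {p | (0 < p.1 ∧ p.1 ≤ 1) ∧ U p.1 < p.2 ∧ p.2 ≤ 1}

/-- The part of `regionU` above the half-open unit square. -/
def regionAboveOne (U : ℝ → ℝ) : Set (ℝ × ℝ) := {p | (0 < p.1 ∧ p.1 ≤ 1) ∧ 1 < p.2 ∧ p.2 ≤ U p.1}

section

variable {U V : ℝ → ℝ}

theorem measurableSet_regionU (hU : Measurable U) : MeasurableSet (regionU U) := by
  exact (measurableSet_Ioc.preimage measurable_fst).inter
    ((measurableSet_Ici.preimage measurable_snd).inter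
      (measurableSet_le measurable_snd (hU.comp measurable_fst)))

theorem measurableSet_regionBelowOne (hU : Measurable U) : MeasurableSet (regionBelowOne U) := by
  exact (measurableSet_Ioc.preimage measurable_fst).inter
    ((measurableSet_lt (hU.comp measurable_fst) measurable_snd).inter
      (measurableSet_Iic.preimage measurable_snd))

theorem measurableSet_regionAboveOne (hU : Measurable U) : MeasurableSet (regionAboveOne U) := by
  exact (measurableSet_Ioc.preimage measurable_fst).inter
    ((measurableSet_Ioi.preimage measurable_snd).inter
      (measurableSet_le measurable_snd (hU.comp measurable_fst)))

theorem regionU_union_regionBelowOne (hU : ∀ z, 0 < z → z ≤ 1 → 0 < U z) :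
    regionU U ∪ regionBelowOne U = Ioc 0 1 ×ˢ Icc 0 1 ∪ regionAboveOne U := by
  ext ⟨z, u⟩
  simp only [regionU, regionBelowOne, regionAboveOne, mem_union, mem_prod, mem_Ioc, mem_Icc]
  constructor
  · rintro (⟨hz, h0, h1⟩ | ⟨hz, h0, h1⟩)
    · rcases le_or_gt u 1 with h | h
      · exact Or.inl ⟨hz, h0, h⟩
      · exact Or.inr ⟨hz, h, h1⟩
    · exact Or.inl ⟨hz, ((hU z hz.1 hz.2).trans h0).le, h1⟩
  · rintro (⟨hz, h0, h1⟩ | ⟨hz, h0, h1⟩)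
    · rcases le_or_gt u (U z) with h | h
      · exact Or.inl ⟨hz, h0, h⟩
      · exact Or.inr ⟨hz, h, h1⟩
    · exact Or.inl ⟨hz, zero_le_one.trans h0.le, h1⟩

theorem disjoint_regionU_regionBelowOne : Disjoint (regionU U) (regionBelowOne U) := by
  rw [Set.disjoint_left]
  rintro p ⟨_, _, h⟩ ⟨_, h', _⟩
  exact absurd h (not_le.2 h')

theorem disjoint_square_regionAboveOne :
    Disjoint (Ioc (0 : ℝ) 1 ×ˢ Icc (0 : ℝ) 1) (regionAboveOne U) := by
  rw [Set.disjoint_left]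
  rintro p ⟨_, _, h⟩ ⟨_, h', _⟩
  exact absurd h (not_le.2 h')

theorem regionBelowOne_eq_image (hUV : ∀ z, U z = 1 - V z) : regionBelowOne U =
    triangularMap (fun z => z) (fun _ => 1) (fun z => -V z) ''
      ({p | 0 < V p.1} ∩ Ioc 0 1 ×ˢ Ico 0 1) := by
  ext ⟨z, u⟩
  simp only [regionBelowOne, triangularMap, mem_image, Prod.exists, Prod.mk.injEq, hUV]
  constructor
  · rintro ⟨hz, h0, h1⟩
    dsimp only at hz h0 h1
    have hV : 0 < V z := by linarith
    refine ⟨z, (1 - u) / V z, ⟨hV, hz, div_nonneg (by linarith) hV.le, ?_⟩, rfl, ?_⟩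
    · rw [div_lt_one hV]; linarith
    · field_simp; ring
  · rintro ⟨z, θ, ⟨hV, hz, h0, h1⟩, rfl, rfl⟩
    have hV : 0 < V z := hV
    dsimp only at h0 h1
    refine ⟨hz, ?_, ?_⟩ <;> dsimp only <;> nlinarith

theorem regionAboveOne_eq_image (hUV : ∀ z, U z = 1 - V z) : regionAboveOne U =
    triangularMap (fun z => z) (fun _ => 1) (fun z => -V z) ''
      ({p | V p.1 < 0} ∩ Ioc 0 1 ×ˢ Ioc 0 1) := by
  ext ⟨z, u⟩
  simp only [regionAboveOne, triangularMap, mem_image, Prod.exists, Prod.mk.injEq, hUV]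
  constructor
  · rintro ⟨hz, h0, h1⟩
    dsimp only at hz h0 h1
    have hV : 0 < -V z := by linarith
    refine ⟨z, (u - 1) / -V z, ⟨neg_pos.1 hV, hz, div_pos (by linarith) hV, ?_⟩, rfl, ?_⟩
    · rw [div_le_one hV]; linarith
    · have := (neg_pos.1 hV).ne
      field_simp; ring
  · rintro ⟨z, θ, ⟨hV, hz, h0, h1⟩, rfl, rfl⟩
    have hV : V z < 0 := hV
    dsimp only at h0 h1
    refine ⟨hz, ?_, ?_⟩ <;> dsimp only <;> nlinarith

/-- An integral over the region below the graph of `U = 1 - V` is the integral over the unit square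
plus the integral over the signed strip between the graph and the line `u = 1`. -/
theorem integral_regionU (hV : ∀ z, HasDerivAt V (deriv V z) z) (hUV : ∀ z, U z = 1 - V z)
    (hU : ∀ z, 0 < z → z ≤ 1 → 0 < U z) {F : ℝ × ℝ → ℂ} (hF : IntegrableOn F openSquare)
    (hFV : IntegrableOn (fun p => V p.1 • F (p.1, 1 - V p.1 * p.2)) openSquare) :
    IntegrableOn F (regionU U) ∧ ∫ p in regionU U, F p = (∫ p in openSquare, F p) -
      ∫ p in openSquare, V p.1 • F (p.1, 1 - V p.1 * p.2) := by
  have hVc : Continuous V := continuous_iff_continuousAt.2 fun z => (hV z).continuousAt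
  have hUm : Measurable U := by
    rw [show U = fun z => 1 - V z from funext hUV]
    exact (continuous_const.sub hVc).measurable
  have hV1 : MeasurableSet {p : ℝ × ℝ | 0 < V p.1} :=
    measurableSet_lt measurable_const (hVc.measurable.comp measurable_fst)
  have hV2 : MeasurableSet {p : ℝ × ℝ | V p.1 < 0} :=
    measurableSet_lt (hVc.measurable.comp measurable_fst) measurable_const
  have hsq1 : (Ioc 0 1 ×ˢ Icc 0 1 : Set (ℝ × ℝ)) =ᵐ[volume] openSquare :=
    (Measure.set_prod_ae_eq Ioo_ae_eq_Ioc Ioo_ae_eq_Icc).symm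
  have hsq2 : (Ioc 0 1 ×ˢ Ico 0 1 : Set (ℝ × ℝ)) =ᵐ[volume] openSquare :=
    (Measure.set_prod_ae_eq Ioo_ae_eq_Ioc Ioo_ae_eq_Ico).symm
  have hsq3 : (Ioc 0 1 ×ˢ Ioc 0 1 : Set (ℝ × ℝ)) =ᵐ[volume] openSquare :=
    (Measure.set_prod_ae_eq Ioo_ae_eq_Ioc Ioo_ae_eq_Ioc).symm
  -- The Jacobian `|V|` is replaced by `V`: where `V > 0` the strip is cut off the square, where `V
  -- < 0` it is added, and the sign accounts for both.
  set Φ : ℝ × ℝ → ℂ := fun p => V p.1 • F (p.1, 1 - V p.1 * p.2) with hΦ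
  have hm1 : MeasurableSet ({p : ℝ × ℝ | 0 < V p.1} ∩ Ioc 0 1 ×ˢ Ico 0 1) :=
    hV1.inter (measurableSet_Ioc.prod measurableSet_Ico)
  have hm2 : MeasurableSet ({p : ℝ × ℝ | V p.1 < 0} ∩ Ioc 0 1 ×ˢ Ioc 0 1) :=
    hV2.inter (measurableSet_Ioc.prod measurableSet_Ioc)
  have hmap : ∀ p : ℝ × ℝ, triangularMap (fun z => z) (fun _ => 1) (fun z => -V z) p =
      (p.1, 1 - V p.1 * p.2) := fun p => by simp [triangularMap]; ring
  have hg : ∀ z : ℝ, HasDerivAt (fun z : ℝ => z) ((fun _ => 1 : ℝ → ℝ) z) z := hasDerivAt_id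
  have ha : ∀ z : ℝ, HasDerivAt (fun _ : ℝ => (1 : ℝ)) ((fun _ => 0 : ℝ → ℝ) z) z :=
    fun z => hasDerivAt_const z 1
  have hb : ∀ z : ℝ, HasDerivAt (fun z : ℝ => -V z) ((fun z => -deriv V z) z) z :=
    fun z => (hV z).neg
  have hi1 : InjOn (triangularMap (fun z => z) (fun _ => 1) (fun z => -V z))
      ({p : ℝ × ℝ | 0 < V p.1} ∩ Ioc 0 1 ×ˢ Ico 0 1) :=
    injOn_triangularMap (injOn_id univ) (fun _ _ => mem_univ _)
      fun p hp => neg_ne_zero.2 (ne_of_gt hp.1)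
  have hi2 : InjOn (triangularMap (fun z => z) (fun _ => 1) (fun z => -V z))
      ({p : ℝ × ℝ | V p.1 < 0} ∩ Ioc 0 1 ×ˢ Ioc 0 1) :=
    injOn_triangularMap (injOn_id univ) (fun _ _ => mem_univ _)
      fun p hp => neg_ne_zero.2 (ne_of_lt hp.1)
  have e1 : EqOn (fun p : ℝ × ℝ => |(fun _ => 1 : ℝ → ℝ) p.1 * (fun z => -V z) p.1| •
      F (triangularMap (fun z => z) (fun _ => 1) (fun z => -V z) p)) Φ
      ({p : ℝ × ℝ | 0 < V p.1} ∩ Ioc 0 1 ×ˢ Ico 0 1) := by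
    intro p hp
    have h0 : 0 < V p.1 := hp.1
    simp only [hΦ, hmap, one_mul, abs_neg, abs_of_pos h0]
  have e2 : EqOn (fun p : ℝ × ℝ => |(fun _ => 1 : ℝ → ℝ) p.1 * (fun z => -V z) p.1| •
      F (triangularMap (fun z => z) (fun _ => 1) (fun z => -V z) p)) (fun p => -Φ p)
      ({p : ℝ × ℝ | V p.1 < 0} ∩ Ioc 0 1 ×ˢ Ioc 0 1) := by
    intro p hp
    have h0 : V p.1 < 0 := hp.1
    simp only [hΦ, hmap, one_mul, abs_neg, abs_of_neg h0, neg_smul]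
  have hΦ1 : IntegrableOn Φ ({p : ℝ × ℝ | 0 < V p.1} ∩ Ioc 0 1 ×ˢ Ico 0 1) :=
    (hFV.congr_set_ae hsq2).mono_set inter_subset_right
  have hΦ2 : IntegrableOn Φ ({p : ℝ × ℝ | V p.1 < 0} ∩ Ioc 0 1 ×ˢ Ioc 0 1) :=
    (hFV.congr_set_ae hsq3).mono_set inter_subset_right
  have hB : IntegrableOn F (regionBelowOne U) := by
    rw [regionBelowOne_eq_image hUV, integrableOn_image_triangularMap
      (g' := fun _ => 1) (a' := fun _ => 0) (b' := fun z => -deriv V z) hm1 (fun p _ => hg p.1)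
      (fun p _ => ha p.1) (fun p _ => hb p.1) hi1, integrableOn_congr_fun e1 hm1]
    exact hΦ1
  have hA : IntegrableOn F (regionAboveOne U) := by
    rw [regionAboveOne_eq_image hUV, integrableOn_image_triangularMap
      (g' := fun _ => 1) (a' := fun _ => 0) (b' := fun z => -deriv V z) hm2 (fun p _ => hg p.1)
      (fun p _ => ha p.1) (fun p _ => hb p.1) hi2, integrableOn_congr_fun e2 hm2]
    exact hΦ2.neg
  have iB : ∫ p in regionBelowOne U, F p = ∫ p in {p : ℝ × ℝ | 0 < V p.1} ∩ openSquare, Φ p := by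
    rw [regionBelowOne_eq_image hUV, integral_image_triangularMap
      (g' := fun _ => 1) (a' := fun _ => 0) (b' := fun z => -deriv V z) hm1 (fun p _ => hg p.1)
      (fun p _ => ha p.1) (fun p _ => hb p.1) hi1, setIntegral_congr_fun hm1 e1]
    exact setIntegral_congr_set (ae_eq_set_inter (ae_eq_refl _) hsq2)
  have iA : ∫ p in regionAboveOne U, F p =
      -∫ p in {p : ℝ × ℝ | V p.1 < 0} ∩ openSquare, Φ p := by
    rw [regionAboveOne_eq_image hUV, integral_image_triangularMap
      (g' := fun _ => 1) (a' := fun _ => 0) (b' := fun z => -deriv V z) hm2 (fun p _ => hg p.1)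
      (fun p _ => ha p.1) (fun p _ => hb p.1) hi2, setIntegral_congr_fun hm2 e2, integral_neg]
    exact congrArg Neg.neg (setIntegral_congr_set (ae_eq_set_inter (ae_eq_refl _) hsq3))
  have iΦ : ∫ p in openSquare, Φ p = (∫ p in {p : ℝ × ℝ | 0 < V p.1} ∩ openSquare, Φ p) +
      ∫ p in {p : ℝ × ℝ | V p.1 < 0} ∩ openSquare, Φ p := by
    rw [← setIntegral_union _ (hV2.inter measurableSet_openSquare)
      (hFV.mono_set inter_subset_right) (hFV.mono_set inter_subset_right)]
    · refine setIntegral_eq_of_subset_of_forall_sdiff_eq_zero measurableSet_openSquare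
        (union_subset inter_subset_right inter_subset_right) ?_
      rintro p ⟨hp, hp'⟩
      have : V p.1 = 0 := by
        rcases lt_trichotomy (V p.1) 0 with h | h | h
        · exact absurd (Or.inr ⟨h, hp⟩) hp'
        · exact h
        · exact absurd (Or.inl ⟨h, hp⟩) hp'
      simp [hΦ, this]
    · rw [Set.disjoint_left]
      rintro p ⟨h, _⟩ ⟨h', _⟩
      exact lt_asymm (show 0 < V p.1 from h) h'
  have hS : IntegrableOn F (Ioc 0 1 ×ˢ Icc 0 1) := hF.congr_set_ae hsq1
  have hu := regionU_union_regionBelowOne hU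
  have hR : IntegrableOn F (regionU U) :=
    (hS.union hA).mono_set (hu ▸ subset_union_left)
  refine ⟨hR, ?_⟩
  have h1 := setIntegral_union disjoint_regionU_regionBelowOne
    (measurableSet_regionBelowOne hUm) hR hB
  rw [hu, setIntegral_union disjoint_square_regionAboveOne (measurableSet_regionAboveOne hUm) hS hA,
    setIntegral_congr_set hsq1, iA, iB] at h1
  rw [iΦ]
  linear_combination -h1

end

end TwoPuiseux

/-! ### The integrand on the strip. -/

namespace TwoPuiseux

theorem ofReal_pow_cpow {z : ℝ} (hz : 0 < z) (n : ℕ) (s : ℂ) :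
    ((z ^ n : ℝ) : ℂ) ^ s = (z : ℂ) ^ ((n : ℂ) * s) := by
  rw [cpow_def_of_ne_zero (by exact_mod_cast (pow_pos hz n).ne'),
    cpow_def_of_ne_zero (by exact_mod_cast hz.ne'), ← ofReal_log (pow_pos hz n).le,
    ← ofReal_log hz.le, Real.log_pow]
  congr 1
  push_cast
  ring

theorem ofReal_mul_cpow {x y : ℝ} (hx : 0 < x) (hy : 0 < y) (s : ℂ) :
    ((x * y : ℝ) : ℂ) ^ s = (x : ℂ) ^ s * (y : ℂ) ^ s := by
  rw [ofReal_mul, mul_cpow_ofReal_nonneg hx.le hy.le]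

namespace Datum

variable (S : Datum) (c : ℕ) (T : Polynomial ℝ)

/-- The ordinate of the point of the strip between `u = 1` and `u = 1 - z^c T(z)` with parameters
`(z, θ)`. -/
noncomputable def stripU (p : ℝ × ℝ) : ℝ := 1 - p.1 ^ c * T.eval p.1 * p.2

/-- The quotient of `1 - u^m` by `z^c` on the strip. -/
noncomputable def stripG (p : ℝ × ℝ) : ℝ :=
  T.eval p.1 * p.2 * ∑ i ∈ Finset.range S.m, stripU c T p ^ i

/-- The quotient of `f` by `z^q` on the strip. -/
noncomputable def stripQ (p : ℝ × ℝ) : ℝ :=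
  p.1 ^ (S.n * c - S.q) * S.stripG c T p ^ S.n + stripU c T p ^ S.b +
    S.t * p.1 ^ (S.e + c * S.l - S.q) * S.stripG c T p ^ S.l * stripU c T p ^ S.c

variable {c T}

theorem one_sub_stripU_pow (p : ℝ × ℝ) : 1 - stripU c T p ^ S.m = p.1 ^ c * S.stripG c T p := by
  rw [← mul_neg_geom_sum, stripG, stripU]
  ring

/-- From `n c > q` and the weight relation, `n (e + c l) ≥ n e + q l = n q + k > n q`. Both other
terms of `f` are therefore divisible by `z^q` with a positive power of `z` to spare. -/
theorem q_lt_e_add (hc : S.q < S.n * c) : S.q < S.e + c * S.l := by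
  have hw := S.weight
  have hk := S.hk
  have h : S.n * S.q < S.n * (S.e + c * S.l) := by
    have : S.q * S.l ≤ S.n * c * S.l := Nat.mul_le_mul_right _ hc.le
    nlinarith
  exact Nat.lt_of_mul_lt_mul_left h

theorem f_stripU (hc : S.q < S.n * c) (p : ℝ × ℝ) :
    S.f p.1 (stripU c T p) = p.1 ^ S.q * S.stripQ c T p := by
  obtain ⟨i, hi⟩ := Nat.exists_eq_add_of_lt hc
  obtain ⟨j, hj⟩ := Nat.exists_eq_add_of_lt (S.q_lt_e_add hc)
  have hi' : S.n * c - S.q = i + 1 := by omega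
  have hj' : S.e + c * S.l - S.q = j + 1 := by omega
  have e1 : (p.1 ^ c) ^ S.n = p.1 ^ S.q * p.1 ^ (i + 1) := by
    rw [← pow_mul, ← pow_add, mul_comm c, hi]; rfl
  have e2 : p.1 ^ S.e * (p.1 ^ c) ^ S.l = p.1 ^ S.q * p.1 ^ (j + 1) := by
    rw [← pow_mul, ← pow_add, ← pow_add, hj]; rfl
  rw [f, one_sub_stripU_pow, mul_pow, mul_pow, e1, stripQ, hi', hj']
  linear_combination S.t * S.stripG c T p ^ S.l * stripU c T p ^ S.c * e2

theorem contDiff_eval_fst : ContDiff ℝ ∞ fun p : ℝ × ℝ => T.eval p.1 := by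
  have := (T.contDiff_aeval (𝕜 := ℝ) ∞).comp (contDiff_fst (𝕜 := ℝ) (E := ℝ) (F := ℝ))
  simpa [Function.comp_def] using this

theorem contDiff_stripU : ContDiff ℝ ∞ (stripU c T) := by
  have hT := contDiff_eval_fst (T := T)
  unfold stripU
  fun_prop

theorem contDiff_stripQ : ContDiff ℝ ∞ (S.stripQ c T) := by
  have hU := contDiff_stripU (c := c) (T := T)
  have hT := contDiff_eval_fst (T := T)
  have hG : ContDiff ℝ ∞ (S.stripG c T) := by
    unfold stripG
    exact (hT.mul contDiff_snd).mul (ContDiff.sum fun i _ => hU.pow i)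
  unfold stripQ
  fun_prop

/-- At `z = 0` only `u^b` survives, with `u = 1`, so the value is `1`. For `z > 0` the sign is that
of `f`, which is positive automatically for `u ≤ 1`; only the part `u > 1` needs the assumption on
the domain. -/
theorem stripQ_pos (hc : S.q < S.n * c)
    (hpos : ∀ z, 0 < z → z ≤ 1 → ∀ u, 0 ≤ u → u ≤ 1 - z ^ c * T.eval z → 0 < S.f z u)
    (hU : ∀ z, 0 < z → z ≤ 1 → 0 < 1 - z ^ c * T.eval z) :
    ∀ p ∈ closedSquare, 0 < S.stripQ c T p := by
  rintro ⟨z, θ⟩ ⟨⟨hz, hz1⟩, hθ, hθ1⟩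
  dsimp only at hz hz1 hθ hθ1
  rcases hz.eq_or_lt with rfl | hz
  · have hc0 : c ≠ 0 := by rintro rfl; simp at hc
    have h1 : S.n * c - S.q ≠ 0 := by omega
    have h2 : S.e + c * S.l - S.q ≠ 0 := by have := S.q_lt_e_add hc; omega
    simp [stripQ, stripU, h1, h2, hc0]
  · have hV := hU z hz hz1
    have hu0 : 0 ≤ stripU c T (z, θ) := by
      simp only [stripU]; nlinarith
    have hf : 0 < S.f z (stripU c T (z, θ)) := by
      rcases le_or_gt (stripU c T (z, θ)) 1 with h | h
      · exact S.f_pos hz hz1 hu0 h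
      · refine hpos z hz hz1 _ hu0 ?_
        simp only [stripU] at h ⊢
        have : z ^ c * T.eval z ≤ 0 := by
          by_contra! hcon
          nlinarith
        nlinarith
    have := S.f_stripU (T := T) hc (z, θ)
    rw [this] at hf
    exact pos_of_mul_pos_right hf (by positivity)

/-- On the strip, `f = z^q Q` and the Jacobian `z^c T` combine to `z^((M + q) s + A + c) T Q^s`, an
integral of the smooth positive kind. -/
theorem integral_regionU_kernel (hc : S.q < S.n * c)
    (hpos : ∀ z, 0 < z → z ≤ 1 → ∀ u, 0 ≤ u → u ≤ 1 - z ^ c * T.eval z → 0 < S.f z u)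
    (hU : ∀ z, 0 < z → z ≤ 1 → 0 < 1 - z ^ c * T.eval z) (A : ℕ) {s : ℂ} (hX : 0 < (S.X A s).re)
    (hW : 0 < (S.W A 0 0 s).re) (hK : 0 < (S.M + S.q : ℕ) * s.re + (A + c : ℕ) + 1) :
    IntegrableOn (S.kernel A 0 0 0 s) (regionU fun z => 1 - z ^ c * T.eval z) ∧
      ∫ p in regionU fun z => 1 - z ^ c * T.eval z, S.kernel A 0 0 0 s p =
        S.J A 0 0 0 s - unitIntegral (S.M + S.q) (S.stripQ c T) (fun p => T.eval p.1) 0 (A + c) s := by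
  have hQpos := S.stripQ_pos hc hpos hU
  have hEq : EqOn (fun p : ℝ × ℝ => (p.1 ^ c * T.eval p.1) •
      S.kernel A 0 0 0 s (p.1, 1 - p.1 ^ c * T.eval p.1 * p.2))
      (unitKernel (S.M + S.q) (S.stripQ c T) (fun p => T.eval p.1) 0 (A + c) s) openSquare := by
    rintro p hp
    have hz : 0 < p.1 := hp.1.1
    have hz' : (p.1 : ℂ) ≠ 0 := by exact_mod_cast hz.ne'
    have hQ := hQpos p (openSquare_subset_closedSquare hp)
    have hf := S.f_stripU (T := T) hc p
    simp only [stripU] at hf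
    simp only [kernel, unitKernel, hf, ofReal_mul_cpow (pow_pos hz S.q) hQ, ofReal_pow_cpow hz,
      pow_zero, mul_one, ofReal_one, Nat.cast_zero, sub_zero, real_smul]
    have e : (p.1 : ℂ) ^ (((S.M + S.q : ℕ) : ℂ) * s + (A + c : ℕ)) =
        (p.1 : ℂ) ^ ((S.M : ℂ) * s + A) * (p.1 : ℂ) ^ ((S.q : ℂ) * s) * (p.1 : ℂ) ^ c := by
      rw [← cpow_add _ _ hz', ← cpow_natCast, ← cpow_add _ _ hz']
      congr 1
      push_cast
      ring
    rw [e]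
    push_cast
    ring
  have hV : ∀ z, HasDerivAt (fun z => z ^ c * T.eval z) (deriv (fun z => z ^ c * T.eval z) z) z := by
    intro z
    exact ((differentiableAt_id.pow c).mul T.differentiableAt).hasDerivAt
  have hint := integrableOn_unitKernel (D := S.M + S.q) S.contDiff_stripQ hQpos
    (contDiff_eval_fst (T := T)) 0 (A + c) hK
  have h := integral_regionU hV (fun _ => rfl) hU (S.integrableOn_kernel A 0 0 0 hX hW)
    ((integrableOn_congr_fun hEq measurableSet_openSquare).2 hint)
  rw [setIntegral_congr_fun measurableSet_openSquare hEq] at h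
  exact h

end Datum

end TwoPuiseux

/-! ### From the domain of the theorem to the `(z, u)` coordinates. -/

namespace TwoPuiseux

section

variable {n₁ m n₂ q : ℕ} {R : Polynomial ℝ}

theorem branchY_pow (hm : 0 < m) (hR : IsBranch n₁ m n₂ q R) {z : ℝ} (hz : 0 ≤ z) :
    branchY n₁ m R (z ^ m) = z ^ n₁ * R.divX.eval z ^ n₁ := by
  have h : R.eval z = R.divX.eval z * z := by
    conv_lhs => rw [← R.divX_mul_X_add, hR.coeff_zero]
    simp
  rw [branchY, one_div, Real.pow_rpow_inv_natCast hz hm.ne', h, ← mul_pow, mul_comm]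

/-- The order condition says that `Y = x^(n₁/m) (1 - z^c T(z))` with `z = x^(1/m)` and
`c > q / n₂`. -/
theorem IsBranch.exists_strip (hm : 0 < m) (hR : IsBranch n₁ m n₂ q R) :
    ∃ T : Polynomial ℝ, ∀ z, R.divX.eval z ^ n₁ = 1 - z ^ (q / n₂ + 1) * T.eval z := by
  have h0 : R = R.divX * Polynomial.X := by
    conv_lhs => rw [← R.divX_mul_X_add, hR.coeff_zero]
    simp
  set V : Polynomial ℝ := R.divX ^ n₁ with hV
  have hV0 : V.coeff 0 = 1 := by
    rw [hV, Polynomial.coeff_zero_eq_eval_zero, Polynomial.eval_pow,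
      ← Polynomial.coeff_zero_eq_eval_zero, Polynomial.coeff_divX, zero_add, hR.coeff_one, one_pow]
  have h1 : ((Polynomial.X : Polynomial ℝ) ^ m) ^ n₁ - (R ^ n₁) ^ m =
      (1 - V ^ m) * Polynomial.X ^ (m * n₁) := by
    conv_lhs => rw [h0]
    rw [mul_pow, mul_pow, ← hV, ← pow_mul, ← pow_mul, mul_comm n₁ m]
    ring
  -- After division by `z^(m n₁)` the order condition kills all coefficients of `1 - V^m` of degree
  -- `d` with `n₂ d ≤ q`, that is, `d ≤ q / n₂` with integer division.
  have h2 : Polynomial.X ^ (q / n₂ + 1) ∣ (1 - V) * ∑ i ∈ Finset.range m, V ^ i := by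
    rw [mul_neg_geom_sum, Polynomial.X_pow_dvd_iff]
    intro d hd
    have := hR.order (d + m * n₁) (by
      have := Nat.mul_le_of_le_div n₂ d q (Nat.lt_succ_iff.1 hd)
      unfold bigD
      nlinarith)
    rwa [h1, Polynomial.coeff_mul_X_pow] at this
  -- The cofactor of `1 - V` in `1 - V^m` takes the value `m ≠ 0` at `0`, so the whole power of `X`
  -- divides `1 - V`.
  have h3 : ¬ Polynomial.X ∣ ∑ i ∈ Finset.range m, V ^ i := by
    rw [Polynomial.X_dvd_iff, Polynomial.coeff_zero_eq_eval_zero, Polynomial.eval_finsetSum]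
    simp only [Polynomial.eval_pow, ← Polynomial.coeff_zero_eq_eval_zero, hV0, one_pow]
    simpa using hm.ne'
  obtain ⟨T, hT⟩ := Polynomial.prime_X.pow_dvd_of_dvd_mul_right _ h3 h2
  refine ⟨T, fun z => ?_⟩
  have := congrArg (Polynomial.eval z) hT
  simp only [Polynomial.eval_sub, Polynomial.eval_one, Polynomial.eval_mul, Polynomial.eval_pow,
    Polynomial.eval_X, hV] at this
  linarith

theorem IsBranch.eval_divX_pos (hm : 0 < m) (hR : IsBranch n₁ m n₂ q R) {z : ℝ} (hz : 0 < z)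
    (hz1 : z ≤ 1) : 0 < R.divX.eval z ^ n₁ := by
  have := hR.pos (z ^ m) (pow_pos hz m) (pow_le_one₀ hz.le hz1)
  rw [branchY_pow hm hR hz.le] at this
  exact pos_of_mul_pos_right this (by positivity)

theorem mem_domainD_of_mem_regionU (hm : 0 < m) (hR : IsBranch n₁ m n₂ q R) {p : ℝ × ℝ}
    (hp : p ∈ regionU fun z => R.divX.eval z ^ n₁) : (p.1 ^ m, p.1 ^ n₁ * p.2) ∈ domainD n₁ m R := by
  obtain ⟨⟨hz, hz1⟩, h0, h1⟩ := hp
  refine ⟨by positivity, pow_le_one₀ hz.le hz1, by positivity, ?_⟩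
  dsimp only
  rw [branchY_pow hm hR hz.le]
  dsimp only at h1
  gcongr

theorem image_regionU (hm : 0 < m) (hR : IsBranch n₁ m n₂ q R) :
    triangularMap (fun z => z ^ m) (fun _ => 0) (fun z => z ^ n₁) ''
      regionU (fun z => R.divX.eval z ^ n₁) = domainD n₁ m R ∩ {p | p.1 ≠ 0} := by
  ext ⟨x, y⟩
  constructor
  · rintro ⟨p, hp, h⟩
    simp only [triangularMap, zero_add, Prod.mk.injEq] at h
    obtain ⟨rfl, rfl⟩ := h
    exact ⟨mem_domainD_of_mem_regionU hm hR hp, (pow_pos hp.1.1 m).ne'⟩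
  · rintro ⟨⟨hx, hx1, hy, hyY⟩, hx0⟩
    dsimp only at hx hx1 hy hyY hx0
    have hx : 0 < x := lt_of_le_of_ne hx (Ne.symm hx0)
    set z : ℝ := x ^ ((m : ℝ)⁻¹) with hz
    have hz0 : 0 < z := by positivity
    have hzm : z ^ m = x := Real.rpow_inv_natCast_pow hx.le hm.ne'
    have hz1 : z ≤ 1 := Real.rpow_le_one hx.le hx1 (by positivity)
    rw [← hzm, branchY_pow hm hR hz0.le] at hyY
    refine ⟨(z, y / z ^ n₁), ⟨⟨hz0, hz1⟩, by positivity, ?_⟩, ?_⟩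
    · dsimp only
      rw [div_le_iff₀ (by positivity), mul_comm]
      exact hyY
    · simp only [triangularMap, hzm, zero_add, Prod.mk.injEq, true_and]
      field_simp

theorem domainD_ae_eq_image (hm : 0 < m) (hR : IsBranch n₁ m n₂ q R) :
    domainD n₁ m R =ᵐ[volume] triangularMap (fun z => z ^ m) (fun _ => 0) (fun z => z ^ n₁) ''
      regionU (fun z => R.divX.eval z ^ n₁) := by
  rw [image_regionU hm hR]
  have h : ∀ᵐ p : ℝ × ℝ, p.1 ≠ 0 :=
    Measure.quasiMeasurePreserving_fst.ae (Measure.ae_ne volume (0 : ℝ))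
  filter_upwards [h] with p hp
  exact propext ⟨fun h => ⟨h, hp⟩, fun h => h.1⟩

/-- The substitution `x = z^m`, `y = z^n₁ u`. -/
theorem integral_domainD (hm : 0 < m) (hR : IsBranch n₁ m n₂ q R) (F : ℝ × ℝ → ℂ) :
    (IntegrableOn F (domainD n₁ m R) ↔
      IntegrableOn (fun p => ((m * p.1 ^ (m + n₁ - 1) : ℝ) : ℂ) * F (p.1 ^ m, p.1 ^ n₁ * p.2))
        (regionU fun z => R.divX.eval z ^ n₁)) ∧
    ∫ p in domainD n₁ m R, F p = ∫ p in regionU fun z => R.divX.eval z ^ n₁,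
      ((m * p.1 ^ (m + n₁ - 1) : ℝ) : ℂ) * F (p.1 ^ m, p.1 ^ n₁ * p.2) := by
  set A := regionU fun z => R.divX.eval z ^ n₁ with hA
  have hAm : MeasurableSet A := measurableSet_regionU (by fun_prop)
  have hg : ∀ p ∈ A, HasDerivAt (fun z : ℝ => z ^ m) ((fun z : ℝ => m * z ^ (m - 1)) p.1) p.1 :=
    fun p _ => hasDerivAt_pow m p.1
  have ha : ∀ p ∈ A, HasDerivAt (fun _ : ℝ => (0 : ℝ)) ((fun _ => 0 : ℝ → ℝ) p.1) p.1 :=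
    fun p _ => hasDerivAt_const p.1 0
  have hb : ∀ p ∈ A, HasDerivAt (fun z : ℝ => z ^ n₁) ((fun z : ℝ => n₁ * z ^ (n₁ - 1)) p.1) p.1 :=
    fun p _ => hasDerivAt_pow n₁ p.1
  have hinj : InjOn (triangularMap (fun z => z ^ m) (fun _ => 0) (fun z => z ^ n₁)) A := by
    refine injOn_triangularMap (t := Ici 0) (fun x hx y hy h => ?_) (fun p hp => hp.1.1.le)
      fun p hp => (pow_pos hp.1.1 n₁).ne'
    exact (pow_left_inj₀ hx hy hm.ne').1 h
  have heq : EqOn (fun p : ℝ × ℝ => |(fun z : ℝ => m * z ^ (m - 1)) p.1 * (fun z => z ^ n₁) p.1| •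
      F (triangularMap (fun z => z ^ m) (fun _ => 0) (fun z => z ^ n₁) p))
      (fun p => ((m * p.1 ^ (m + n₁ - 1) : ℝ) : ℂ) * F (p.1 ^ m, p.1 ^ n₁ * p.2)) A := by
    intro p hp
    have hz : 0 < p.1 := hp.1.1
    have e : m + n₁ - 1 = m - 1 + n₁ := by omega
    simp only [triangularMap, zero_add, real_smul]
    rw [abs_of_nonneg (by positivity), e, pow_add, mul_assoc]
  refine ⟨?_, ?_⟩
  · rw [integrableOn_congr_set_ae (domainD_ae_eq_image hm hR),
      integrableOn_image_triangularMap (g' := fun z => m * z ^ (m - 1)) (a' := fun _ => 0)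
        (b' := fun z => n₁ * z ^ (n₁ - 1)) hAm hg ha hb hinj, integrableOn_congr_fun heq hAm]
  · rw [setIntegral_congr_set (domainD_ae_eq_image hm hR),
      integral_image_triangularMap (g' := fun z => m * z ^ (m - 1)) (a' := fun _ => 0)
        (b' := fun z => n₁ * z ^ (n₁ - 1)) hAm hg ha hb hinj, setIntegral_congr_fun hAm heq]

end

/-- The condition on `a, b` makes `x^a y^b` exceed the common factor `z^(m n₁ n₂)` by exactly `z^q`.
-/
theorem fMinus_pow (n₁ m n₂ q a b a' b' l e : ℕ) (hab : a * m + b * n₁ = m * n₁ * n₂ + q)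
    (he : m * n₁ * n₂ + e = m * n₁ * l + a' * m + b' * n₁) (t z u : ℝ) :
    fMinus n₁ m n₂ a b a' b' l t (z ^ m) (z ^ n₁ * u) = z ^ (m * n₁ * n₂) *
      ((1 - u ^ m) ^ n₂ + z ^ q * u ^ b + t * z ^ e * (1 - u ^ m) ^ l * u ^ b') := by
  have e1 : (z ^ m) ^ n₁ - (z ^ n₁ * u) ^ m = z ^ (m * n₁) * (1 - u ^ m) := by
    rw [mul_pow, ← pow_mul, ← pow_mul, mul_comm n₁ m]; ring
  have e2 : (z ^ m) ^ a * (z ^ n₁) ^ b = z ^ (m * n₁ * n₂) * z ^ q := by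
    rw [← pow_mul, ← pow_mul, ← pow_add, ← pow_add, ← hab]; ring_nf
  have e3 : (z ^ (m * n₁)) ^ l * (z ^ m) ^ a' * (z ^ n₁) ^ b' = z ^ (m * n₁ * n₂) * z ^ e := by
    rw [← pow_mul, ← pow_mul, ← pow_mul, ← pow_add, ← pow_add, ← pow_add, he]; ring_nf
  have e4 : (z ^ (m * n₁)) ^ n₂ = z ^ (m * n₁ * n₂) := (pow_mul _ _ _).symm
  rw [fMinus, e1, mul_pow, mul_pow, mul_pow, mul_pow, e4]
  linear_combination u ^ b * e2 + t * (1 - u ^ m) ^ l * u ^ b' * e3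

end TwoPuiseux

/-! ### Arithmetic of the exponents and of the semigroup. -/

namespace TwoPuiseux

section

variable {n₁ m n₂ q : ℕ}

/-- Every integer `≥ m n₁` is of the form `a m + b n₁` with natural `a` and `b`. -/
theorem exists_mul_add_mul_eq (hn₁ : 1 < n₁) (hm : 1 < m) (hmn : Nat.gcd m n₁ = 1) {r : ℕ}
    (hr : m * n₁ ≤ r) : ∃ a b : ℕ, a * m + b * n₁ = r := by
  have h := frobeniusNumber_pair hmn hm hn₁
  by_contra! hcon
  have h1 : r ∉ AddSubmonoid.closure ({m, n₁} : Set ℕ) := by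
    rw [AddSubmonoid.mem_closure_pair]
    rintro ⟨a, b, hab⟩
    exact hcon a b (by simpa using hab)
  have h2 := (frobeniusNumber_iff.1 h).2 r (by
    have : 0 < m * n₁ := by positivity
    omega)
  exact h1 h2

/-- As `D` is prime to `n₂`, some `l < n₂` satisfies `l D ≡ k` modulo `n₂`. What is left is at least
`D`, so its quotient by `n₂` is at least `m n₁` and is representable by `m` and `n₁`. -/
theorem exists_weight_eq (hn₁ : 1 < n₁) (hm : 1 < m) (hmn : Nat.gcd m n₁ = 1) (hn₂ : 0 < n₂)
    (hqn : Nat.gcd q n₂ = 1) (k : ℕ) :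
    ∃ a' b' l : ℕ, (a' * m + b' * n₁) * n₂ + l * (m * n₁ * n₂ + q) =
      (m * n₁ * n₂ + q) * n₂ + k := by
  set D := m * n₁ * n₂ + q with hD
  have hcop : Nat.Coprime D n₂ := by
    rw [hD, Nat.coprime_mul_right_add_left]
    exact hqn
  obtain ⟨l, hl, hlk⟩ : ∃ l < n₂, l * D ≡ k [MOD n₂] := by
    obtain ⟨l, hl, h⟩ := Nat.exists_mul_mod_eq_of_coprime k hcop hn₂.ne'
    exact ⟨l, hl, by rwa [mul_comm]⟩
  have hle : l * D + D ≤ D * n₂ := by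
    calc l * D + D = (l + 1) * D := by ring
      _ ≤ n₂ * D := Nat.mul_le_mul_right _ hl
      _ = D * n₂ := mul_comm _ _
  have hdvd : n₂ ∣ D * n₂ + k - l * D := by
    refine (Nat.modEq_iff_dvd' (by omega)).1 (hlk.trans ?_)
    simp [Nat.ModEq]
  obtain ⟨r, hr⟩ := hdvd
  have hr' : m * n₁ ≤ r := by
    by_contra! hcon
    have : n₂ * r ≤ n₂ * (m * n₁) := Nat.mul_le_mul_left _ hcon.le
    have : n₂ * r < n₂ * (m * n₁) := Nat.mul_lt_mul_of_pos_left hcon hn₂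
    have : n₂ * (m * n₁) = m * n₁ * n₂ := mul_comm _ _
    omega
  obtain ⟨a', b', hab⟩ := exists_mul_add_mul_eq hn₁ hm hmn hr'
  refine ⟨a', b', l, ?_⟩
  rw [hab, mul_comm r]
  omega

theorem numer_sub_notMem_semigroupΓ {α : ℚ} (hα : α ∈ A₂₂ n₁ m n₂ q) {k : ℕ}
    (hk : α = candidate n₁ m n₂ q k) : (m + n₁) * n₂ + k ∉ semigroupΓ n₁ m n₂ q := by
  intro h
  refine hα.2 ⟨hα.1, k, hk, ?_⟩
  convert h using 1
  unfold numer
  omega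

theorem combination_mem_semigroupΓ (i j r : ℕ) :
    (i * m + j * n₁) * n₂ + r * (m * n₁ * n₂ + q) ∈ semigroupΓ n₁ m n₂ q := by
  have h1 : n₁ * n₂ ∈ semigroupΓ n₁ m n₂ q := AddSubmonoid.subset_closure (by simp)
  have h2 : m * n₂ ∈ semigroupΓ n₁ m n₂ q := AddSubmonoid.subset_closure (by simp)
  have h3 : bigD n₁ m n₂ q ∈ semigroupΓ n₁ m n₂ q := AddSubmonoid.subset_closure (by simp)
  have := add_mem (add_mem (nsmul_mem h2 i) (nsmul_mem h1 j)) (nsmul_mem h3 r)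
  convert this using 1
  simp only [smul_eq_mul, bigD]
  ring

/-- If `l ≥ n₂`, then `N_k - q = ((a' + 1) m + (b' + 1) n₁) n₂ + (l - n₂) D` would lie in the
semigroup; if `k = 0`, then `N_k - q = (m + n₁) n₂` would. -/
theorem lt_and_pos_of_mem_A₂₂ {α : ℚ} (hα : α ∈ A₂₂ n₁ m n₂ q) {k : ℕ}
    (hk : α = candidate n₁ m n₂ q k) {a' b' l : ℕ}
    (h : (a' * m + b' * n₁) * n₂ + l * (m * n₁ * n₂ + q) = (m * n₁ * n₂ + q) * n₂ + k) :
    l < n₂ ∧ 0 < k := by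
  have hn := numer_sub_notMem_semigroupΓ hα hk
  constructor
  · by_contra! hcon
    obtain ⟨r, rfl⟩ := Nat.exists_eq_add_of_le hcon
    have := combination_mem_semigroupΓ (n₁ := n₁) (m := m) (n₂ := n₂) (q := q) (a' + 1) (b' + 1) r
    refine hn ?_
    convert this using 1
    linear_combination -h
  · refine Nat.pos_of_ne_zero fun hk0 => hn ?_
    have := combination_mem_semigroupΓ (n₁ := n₁) (m := m) (n₂ := n₂) (q := q) 1 1 0
    convert this using 1
    rw [hk0]; ring

/-- The exponents of `f_{-t}` after the substitution `x = z^m`, `y = z^n₁ u`. -/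
noncomputable def datumOf (hn₁ : 1 < n₁) (hm : n₁ < m) (hq : 0 < q) (hn₂ : 1 < n₂) (b : ℕ) {k : ℕ}
    {a' b' l : ℕ}
    (h : (a' * m + b' * n₁) * n₂ + l * (m * n₁ * n₂ + q) = (m * n₁ * n₂ + q) * n₂ + k)
    (hl : l < n₂) (hk : 0 < k) (t : ℝ) (ht : 0 ≤ t) : Datum :=
  have key : n₂ * (m * n₁ * n₂) + q * n₂ + k = n₂ * (m * n₁ * l + a' * m + b' * n₁) + q * l := by
    linear_combination -h
  -- This makes the truncated subtraction defining `e` exact and `e` positive; it follows from `l <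
  -- n₂` and `k > 0`.
  have hlt : m * n₁ * n₂ < m * n₁ * l + a' * m + b' * n₁ := by
    have : q * l ≤ q * n₂ := Nat.mul_le_mul_left _ hl.le
    exact Nat.lt_of_mul_lt_mul_left (a := n₂) (by omega)
  { m := m
    n := n₂
    q := q
    b := b
    e := m * n₁ * l + a' * m + b' * n₁ - m * n₁ * n₂
    l := l
    c := b'
    k := k
    M := m * n₁ * n₂
    d := 1
    t := t
    hm := by omega
    hn := by omega
    hq := hq
    he := by omega
    hk := hk
    hM := Nat.mul_pos (Nat.mul_pos (by omega) (by omega)) (by omega)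
    hd := one_pos
    ht := ht
    weight := by
      rw [Nat.mul_sub]
      have : n₂ * (m * n₁ * n₂) ≤ n₂ * (m * n₁ * l + a' * m + b' * n₁) :=
        Nat.mul_le_mul_left _ hlt.le
      have : n₂ * q = q * n₂ := mul_comm _ _
      omega
    dvd_q := one_dvd _
    dvd_e := one_dvd _
    dvd_k := one_dvd _ }

end

end TwoPuiseux

/-! ### Assembling the integral on its half-plane; simple poles. -/

namespace TwoPuiseux

/-- On its half-plane of convergence the integral is a combination of the integral over the unit
square and a Gamma factor times an entire function. -/
theorem Datum.exists_integralI_eq (S : Datum) {n₁ : ℕ} (hn₁ : 1 < n₁) (hm : 1 < S.m)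
    (hM : S.M = S.m * n₁ * S.n) {R : Polynomial ℝ} (hR : IsBranch n₁ S.m S.n S.q R)
    {f : ℝ → ℝ → ℝ} (hf : ∀ z u, f (z ^ S.m) (z ^ n₁ * u) = z ^ S.M * S.f z u)
    (hpos : ∀ p ∈ domainD n₁ S.m R, p ≠ (0, 0) → 0 < f p.1 p.2) :
    ∃ H : ℂ → ℂ, Differentiable ℂ H ∧ ∃ c : ℕ, ∀ s : ℂ,
      -(((S.m : ℝ) + n₁) / ((S.m : ℝ) * n₁ * S.n)) < s.re →
      (0 < (S.X (S.m + n₁ - 1) s).re ∧ 0 < (S.W (S.m + n₁ - 1) 0 0 s).re) ∧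
      IntegrableOn (integrand n₁ S.m R f 1 1 0 s) (domainD n₁ S.m R) ∧
      integralI n₁ S.m R f 1 1 0 s = S.m * (S.J (S.m + n₁ - 1) 0 0 0 s -
        Gamma ((S.M + S.q : ℕ) * s + (S.m + n₁ - 1 + c : ℕ) + 1) * H s) := by
  obtain ⟨T, hT⟩ := hR.exists_strip S.hm
  set c := S.q / S.n + 1 with hc
  have hqc : S.q < S.n * c := by
    rw [hc]
    have := Nat.div_add_mod S.q S.n
    have := Nat.mod_lt S.q S.hn
    nlinarith
  have hU : ∀ z, 0 < z → z ≤ 1 → 0 < 1 - z ^ c * T.eval z := fun z hz hz1 => by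
    rw [← hT]; exact hR.eval_divX_pos S.hm hz hz1
  have hreg : (regionU fun z => R.divX.eval z ^ n₁) = regionU fun z => 1 - z ^ c * T.eval z := by
    simp only [hT]
  have hposU : ∀ p ∈ regionU fun z => 1 - z ^ c * T.eval z, 0 < S.f p.1 p.2 := by
    intro p hp
    have hz : 0 < p.1 := hp.1.1
    have h := hpos _ (mem_domainD_of_mem_regionU S.hm hR (hreg ▸ hp))
      fun h => (pow_pos hz S.m).ne' (Prod.mk.inj h).1
    dsimp only at h
    rw [hf] at h
    exact pos_of_mul_pos_right h (by positivity)
  have hpos' : ∀ z, 0 < z → z ≤ 1 → ∀ u, 0 ≤ u → u ≤ 1 - z ^ c * T.eval z → 0 < S.f z u :=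
    fun z hz hz1 u hu hu1 => hposU (z, u) ⟨⟨hz, hz1⟩, hu, hu1⟩
  obtain ⟨H, hH, hK⟩ := exists_entire_unitIntegral (D := S.M + S.q) (by have := S.hM; omega)
    S.contDiff_stripQ (S.stripQ_pos hqc hpos' hU) (Datum.contDiff_eval_fst (T := T)) 0
    (S.m + n₁ - 1 + c)
  refine ⟨H, hH, c, fun s hs => ?_⟩
  have hn : (0 : ℝ) < S.n := by exact_mod_cast S.hn
  have hq : (0 : ℝ) < S.q := by exact_mod_cast S.hq
  have hm0 : (0 : ℝ) < S.m := by exact_mod_cast S.hm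
  have hn₁0 : (0 : ℝ) < n₁ := by exact_mod_cast (by omega : 0 < n₁)
  have hA : ((S.m + n₁ - 1 : ℕ) : ℝ) + 1 = S.m + n₁ := by
    rw [← Nat.cast_succ, ← Nat.cast_add]
    congr 1
    omega
  have hMr : (S.M : ℝ) = S.m * n₁ * S.n := by exact_mod_cast hM
  rw [neg_lt, ← sub_pos] at hs
  have hXr : 0 < S.M * s.re + (S.m + n₁ - 1 : ℕ) + 1 := by
    rw [add_assoc, hA, hMr]
    have : (S.m : ℝ) * n₁ * S.n * s.re + (S.m + n₁) =
        S.m * n₁ * S.n * ((S.m + n₁) / (S.m * n₁ * S.n) - -s.re) := by field_simp; ring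
    rw [this]
    positivity
  -- The given half-plane is `X > 0`. Since `m + n₁ ≤ m n₁`, it also gives `n Re s > -1`, whence `W
  -- = n X + q (1 + n s)` has positive real part, and so does `q s + c` because `n c > q`.
  have hns : 0 < 1 + S.n * s.re := by
    have h1 : (S.m : ℝ) + n₁ ≤ S.m * n₁ := by
      have : S.m + n₁ ≤ S.m * n₁ := by nlinarith
      exact_mod_cast this
    rw [add_assoc, hA, hMr] at hXr
    have : 0 < S.m * n₁ * (1 + S.n * s.re) := by linarith
    exact pos_of_mul_pos_right this (by positivity)
  have hX : 0 < (S.X (S.m + n₁ - 1) s).re := by rw [S.X_re]; exact hXr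
  have hW : 0 < (S.W (S.m + n₁ - 1) 0 0 s).re := by
    rw [S.W_re]
    have : (0 : ℝ) < S.n * (S.M * s.re + (S.m + n₁ - 1 : ℕ) + 1) + S.q * (1 + S.n * s.re) := by
      positivity
    push_cast at this ⊢
    linarith
  have hKr : 0 < (S.M + S.q : ℕ) * s.re + (S.m + n₁ - 1 + c : ℕ) + 1 := by
    have h1 : (S.q : ℝ) < S.n * c := by exact_mod_cast hqc
    have h2 : 0 < S.n * (S.q * s.re + c) := by nlinarith
    have h3 : 0 < S.q * s.re + c := pos_of_mul_pos_right h2 hn.le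
    rw [Nat.cast_add (S.m + n₁ - 1)]
    rw [Nat.cast_add]
    linarith
  have hEq : EqOn (fun p : ℝ × ℝ => ((S.m * p.1 ^ (S.m + n₁ - 1) : ℝ) : ℂ) *
      integrand n₁ S.m R f 1 1 0 s (p.1 ^ S.m, p.1 ^ n₁ * p.2))
      (fun p => (S.m : ℂ) * S.kernel (S.m + n₁ - 1) 0 0 0 s p)
      (regionU fun z => 1 - z ^ c * T.eval z) := by
    intro p hp
    have hz : 0 < p.1 := hp.1.1
    have hz' : (p.1 : ℂ) ≠ 0 := by exact_mod_cast hz.ne'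
    simp only [integrand, hf, Datum.kernel, ofReal_mul_cpow (pow_pos hz S.M) (hposU p hp),
      ofReal_pow_cpow hz, pow_zero, mul_one, ofReal_one, Nat.cast_zero, sub_zero,
      Nat.sub_self, cpow_add _ _ hz', cpow_natCast]
    push_cast
    ring
  have hmeas : MeasurableSet (regionU fun z => 1 - z ^ c * T.eval z) :=
    measurableSet_regionU (by fun_prop)
  obtain ⟨hi, hI⟩ := S.integral_regionU_kernel hqc hpos' hU (S.m + n₁ - 1) hX hW hKr
  obtain ⟨c1, c2⟩ := integral_domainD S.hm hR (integrand n₁ S.m R f 1 1 0 s)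
  rw [hreg] at c1 c2
  refine ⟨⟨hX, hW⟩, ?_, ?_⟩
  · rw [c1, integrableOn_congr_fun hEq hmeas]
    exact hi.const_mul _
  · rw [integralI, c2, setIntegral_congr_fun hmeas hEq, integral_const_mul, hI, hK s hKr]

theorem betaIntegral_ofReal_ne_zero {x y : ℝ} (hx : 0 < x) (hy : 0 < y) :
    betaIntegral x y ≠ 0 := by
  have h := Gamma_mul_Gamma_eq_betaIntegral (s := x) (t := y) (by simpa) (by simpa)
  intro h0
  rw [h0, mul_zero] at h
  exact mul_ne_zero (Gamma_ne_zero_of_re_pos (by simpa)) (Gamma_ne_zero_of_re_pos (by simpa)) h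

/-- A nonzero limit of `(s - α) F s` means a simple pole. -/
theorem meromorphicOrderAt_eq_neg_one {F : ℂ → ℂ} {α c : ℂ} (hF : MeromorphicAt F α)
    (h : Tendsto (fun s => (s - α) * F s) (𝓝[≠] α) (𝓝 c)) (hc : c ≠ 0) :
    meromorphicOrderAt F α = -1 := by
  have hid : MeromorphicAt (fun s : ℂ => s - α) α := by fun_prop
  have h1 : meromorphicOrderAt (fun s : ℂ => s - α) α = 1 := by
    have := (meromorphicOrderAt_eq_int_iff (n := 1) hid).2
      ⟨fun _ => 1, analyticAt_const, one_ne_zero, Eventually.of_forall fun s => by simp⟩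
    exact_mod_cast this
  have h2 := (tendsto_ne_zero_iff_meromorphicOrderAt_eq_zero (hid.fun_mul hF)).1 ⟨c, hc, h⟩
  have h3 := meromorphicOrderAt_mul hid hF
  rw [show (fun s : ℂ => s - α) * F = fun s => (s - α) * F s from rfl, h2, h1] at h3
  revert h3
  cases meromorphicOrderAt F α with
  | top => intro h; exact absurd h (by decide)
  | coe n =>
    intro h
    have : (0 : ℤ) = 1 + n := by exact_mod_cast h
    have : n = -1 := by omega
    rw [this]; rfl

end TwoPuiseux
-- The candidate `α` and the main theorem.
namespace TwoPuiseux

section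

variable {n₁ m n₂ q : ℕ}

theorem candidate_identity (hn₂ : 1 < n₂) (hq : 0 < q) {α : ℚ} {k : ℕ}
    (hk : α = candidate n₁ m n₂ q k) :
    (n₂ : ℝ) * (m * n₁ * n₂ + q) * α + (m + n₁) * n₂ + q + k = 0 := by
  have hn : (n₂ : ℚ) ≠ 0 := by exact_mod_cast (by omega : n₂ ≠ 0)
  have hD : (bigD n₁ m n₂ q : ℚ) ≠ 0 := by
    have : bigD n₁ m n₂ q ≠ 0 := by unfold bigD; omega
    exact_mod_cast this
  have h : (n₂ : ℚ) * (m * n₁ * n₂ + q) * α + (m + n₁) * n₂ + q + k = 0 := by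
    have : (n₂ : ℚ) * bigD n₁ m n₂ q * α + numer n₁ m n₂ q k = 0 := by
      rw [hk, candidate]; field_simp; ring
    simp only [bigD, numer] at this
    push_cast at this
    linear_combination this
  exact_mod_cast h

theorem candidate_neg (hn₂ : 1 < n₂) (hq : 0 < q) {α : ℚ} {k : ℕ}
    (hk : α = candidate n₁ m n₂ q k) : (α : ℝ) < 0 := by
  have h := candidate_identity hn₂ hq hk
  have hq' : (0 : ℝ) < q := by exact_mod_cast hq
  have hn : (0 : ℝ) < n₂ := by exact_mod_cast (by omega : 0 < n₂)
  by_contra! hcon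
  have h1 : 0 ≤ (n₂ : ℝ) * (m * n₁ * n₂ + q) * α := by positivity
  have h2 : (0 : ℝ) ≤ (m + n₁) * n₂ := by positivity
  have h3 : (0 : ℝ) ≤ k := by positivity
  linarith

end

end TwoPuiseux

open TwoPuiseux

theorem mainTheorem6 (n₁ m n₂ q : ℕ) (hn₁ : 1 < n₁) (hm : n₁ < m) (hmn : Nat.gcd m n₁ = 1)
    (hq : 0 < q) (hn₂ : 1 < n₂) (hqn : Nat.gcd q n₂ = 1)
    (a b : ℕ) (hab : a * m + b * n₁ = m * n₁ * n₂ + q)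
    (α : ℚ) (hα : α ∈ TwoPuiseux.A₂₂ n₁ m n₂ q)
    (k : ℕ) (hk : α = TwoPuiseux.candidate n₁ m n₂ q k) :
    (∃ a' b' l : ℕ, (a' * m + b' * n₁) * n₂ + l * (m * n₁ * n₂ + q) =
      (m * n₁ * n₂ + q) * n₂ + k) ∧
    ∀ a' b' l : ℕ, (a' * m + b' * n₁) * n₂ + l * (m * n₁ * n₂ + q) =
      (m * n₁ * n₂ + q) * n₂ + k →
    ∃ P : Polynomial ℂ,
      P.natDegree = 1 ∧
      P.coeff 1 = (α : ℂ) / ((n₂ : ℂ) * ((m : ℂ) * n₁ * n₂ + q)) *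
        Complex.betaIntegral (((l : ℂ) + 1) / n₂) (-(α : ℂ) + 1 - ((l : ℂ) + 1) / n₂) ∧
      ∀ R : Polynomial ℝ, TwoPuiseux.IsBranch n₁ m n₂ q R →
      ∀ t : ℝ, 0 < t →
        (∀ p ∈ TwoPuiseux.domainD n₁ m R, p ≠ (0, 0) →
          0 < TwoPuiseux.fMinus n₁ m n₂ a b a' b' l t p.1 p.2) →
        ∃ F : ℂ → ℂ,
          TwoPuiseux.IsContinuation n₁ m R (TwoPuiseux.fMinus n₁ m n₂ a b a' b' l t) 1 1 0
            (-(((m : ℝ) + n₁) / ((m : ℝ) * n₁ * n₂))) F ∧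
          Filter.Tendsto (fun s : ℂ => (s - (α : ℂ)) * F s)
            (nhdsWithin (α : ℂ) {(α : ℂ)}ᶜ) (nhds (P.eval (t : ℂ))) ∧
          (P.eval (t : ℂ) ≠ 0 → meromorphicOrderAt F (α : ℂ) = -1) := by

  refine ⟨exists_weight_eq hn₁ (hn₁.trans hm) hmn (zero_lt_one.trans hn₂) hqn k, ?_⟩
  intro a' b' l h
  obtain ⟨hl, hk0⟩ := lt_and_pos_of_mem_A₂₂ hα hk h
  have hα0 := candidate_neg hn₂ hq hk
  have hid := candidate_identity hn₂ hq hk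
  have hm0 : (m : ℂ) ≠ 0 := by exact_mod_cast (by omega : m ≠ 0)
  have hn0 : (n₂ : ℂ) ≠ 0 := by exact_mod_cast (by omega : n₂ ≠ 0)
  have hD0 : (m : ℂ) * n₁ * n₂ + q ≠ 0 := by
    exact_mod_cast (by omega : m * n₁ * n₂ + q ≠ 0)
  have hcast : ((α : ℝ) : ℂ) = (α : ℂ) := by norm_cast
  have hA : ((m + n₁ - 1 : ℕ) : ℝ) + 1 = m + n₁ := by
    exact_mod_cast (by omega : m + n₁ - 1 + 1 = m + n₁)
  set S : ∀ t : ℝ, 0 ≤ t → Datum := datumOf hn₁ hm hq hn₂ b h hl hk0 with hS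
  -- Passing to `zero` discards `t`, so the same `H₀` and `c₀` serve every `t`; `R` does not occur
  -- in them either. This is what makes `P` independent of both.
  obtain ⟨H₀, hH₀, hJ₀⟩ := (S 0 le_rfl).zero.exists_entire_J (m + n₁ - 1) 0 0 0
  obtain ⟨c₀, hc₀⟩ := (S 0 le_rfl).exists_tendsto_zero (m + n₁ - 1) hH₀ (α := (α : ℂ)) (by
    intro z hz
    refine hα.1.2.1 ⟨z, ?_⟩
    have hz' : (n₂ : ℂ) * (α : ℂ) = z := hz
    exact_mod_cast hz')
  set β := betaIntegral (((l : ℂ) + 1) / n₂) (-(α : ℂ) + 1 - ((l : ℂ) + 1) / n₂) with hβ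
  have hβ0 : β ≠ 0 := by
    have hn : (0 : ℝ) < n₂ := by exact_mod_cast (by omega : 0 < n₂)
    have h1 : ((l : ℝ) + 1) / n₂ ≤ 1 := by
      rw [div_le_one hn]
      exact_mod_cast hl
    have := betaIntegral_ofReal_ne_zero (x := ((l : ℝ) + 1) / n₂)
      (y := -α + 1 - ((l : ℝ) + 1) / n₂) (by positivity) (by linarith)
    push_cast at this
    exact this
  set c₁ : ℂ := (α : ℂ) / ((n₂ : ℂ) * ((m : ℂ) * n₁ * n₂ + q)) * β with hc₁
  have hc₁0 : c₁ ≠ 0 := by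
    refine mul_ne_zero (div_ne_zero ?_ (mul_ne_zero hn0 hD0)) hβ0
    rw [← hcast]
    exact_mod_cast hα0.ne
  refine ⟨Polynomial.C c₁ * Polynomial.X + Polynomial.C (m * c₀),
    Polynomial.natDegree_linear hc₁0, by simp, ?_⟩
  intro R hR t ht hpos
  set T := S t ht.le with hT
  have hTf : ∀ z u, fMinus n₁ m n₂ a b a' b' l t (z ^ m) (z ^ n₁ * u) =
      z ^ T.M * T.f z u := by
    refine fMinus_pow n₁ m n₂ q a b a' b' l T.e hab ?_ t
    have h1 : 0 < T.e := T.he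
    have h2 : T.e = m * n₁ * l + a' * m + b' * n₁ - m * n₁ * n₂ := rfl
    omega
  obtain ⟨K, hK, c, hint⟩ := T.exists_integralI_eq hn₁ (hn₁.trans hm) rfl hR hTf hpos
  obtain ⟨H, hH, hJ⟩ := T.exists_entire_J (m + n₁ - 1) 0 0 0
  set v : ℂ → ℂ := fun s => ((T.M + T.q : ℕ) : ℂ) * s + (((m + n₁ - 1 + c : ℕ) : ℂ) + 1) with hv
  have hvd : Differentiable ℂ v := by fun_prop
  set F : ℂ → ℂ := fun s =>
    m * (Gamma (T.x (m + n₁ - 1) s) * Gamma (T.w (m + n₁ - 1) 0 0 s) * H s - Gamma (v s) * K s)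
    with hF
  have hHm : Meromorphic H := fun s => (hH.analyticAt s).meromorphicAt
  have hKm : Meromorphic K := fun s => (hK.analyticAt s).meromorphicAt
  have hmc : Meromorphic fun _ : ℂ => (m : ℂ) := fun s => analyticAt_const.meromorphicAt
  have hFm : Meromorphic F := hmc.fun_mul
    ((((meromorphic_Gamma_comp (T.differentiable_x _)).fun_mul
      (meromorphic_Gamma_comp (T.differentiable_w _ 0 0))).fun_mul hHm).fun_sub
      ((meromorphic_Gamma_comp hvd).fun_mul hKm))
  have hlim : Tendsto (fun s : ℂ => (s - (α : ℂ)) * F s) (𝓝[≠] (α : ℂ))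
      (𝓝 ((Polynomial.C c₁ * Polynomial.X + Polynomial.C (m * c₀)).eval (t : ℂ))) := by
    have h1 := T.tendsto_sub_mul_continuation (m + n₁ - 1) hH hH₀ hJ hJ₀ hl hα0 (by
      have e1 : (T.M : ℝ) = m * n₁ * n₂ := by
        have : T.M = m * n₁ * n₂ := rfl
        rw [this]; push_cast; ring
      have e2 : (T.n : ℝ) = n₂ := rfl
      have e3 : (T.q : ℝ) = q := rfl
      have e4 : (T.k : ℝ) = k := rfl
      rw [e1, e2, e3, e4, add_assoc (m * n₁ * n₂ * (α : ℝ)), hA]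
      linear_combination hid) (c₀ := c₀) (by rw [hcast]; exact hc₀)
    -- A pole of the strip term at `α` would make `D α` an integer, which membership in `A₂`
    -- forbids.
    have hvα : ∀ j : ℕ, ((T.M + T.q : ℕ) : ℂ) * (α : ℂ) + (((m + n₁ - 1 + c : ℕ) : ℂ) + 1) ≠ -j := by
      intro j hj
      refine hα.1.2.2 ⟨-j - (m + n₁ - 1 + c : ℕ) - 1, ?_⟩
      have : ((bigD n₁ m n₂ q : ℕ) : ℂ) * (α : ℂ) =
          ((-j - (m + n₁ - 1 + c : ℕ) - 1 : ℤ) : ℂ) := by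
        have e : T.M + T.q = bigD n₁ m n₂ q := rfl
        rw [e] at hj
        push_cast at hj ⊢
        linear_combination hj
      exact_mod_cast this
    have h2 : Tendsto (fun s => (s - (α : ℂ)) * (Gamma (v s) * K s)) (𝓝[≠] (α : ℂ)) (𝓝 0) := by
      have hc1 : ContinuousAt (fun s : ℂ => s - (α : ℂ)) (α : ℂ) := by fun_prop
      have := hc1.mul ((continuousAt_Gamma_affine hvα).mul hK.continuous.continuousAt)
      have := this.tendsto.mono_left (nhdsWithin_le_nhds (s := {(α : ℂ)}ᶜ))
      rwa [Pi.mul_apply, sub_self, zero_mul] at this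
    rw [hcast] at h1
    -- The Jacobian factor `m` cancels the `m` in the denominator of the residue of the difference,
    -- leaving `c₁ t`, and turns `c₀` into the constant term `m c₀`.
    have h3 := (h1.sub h2).const_mul (m : ℂ)
    convert h3 using 2
    · simp only [hF]; ring
    · have e1 : (T.M : ℂ) = m * n₁ * n₂ := by
        have : T.M = m * n₁ * n₂ := rfl
        rw [this]; push_cast; ring
      have e2 : (T.n : ℂ) = n₂ := rfl
      have e3 : (T.q : ℂ) = q := rfl
      have e4 : (T.l : ℂ) = l := rfl
      have e5 : (T.m : ℂ) = m := rfl
      have e6 : T.t = t := rfl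
      simp only [e1, e2, e3, e4, e5, e6, ← hβ, Polynomial.eval_add, Polynomial.eval_mul,
        Polynomial.eval_C, Polynomial.eval_X, hc₁]
      field_simp
      ring
  refine ⟨F, ⟨hFm, fun s hs => ?_⟩, hlim, fun hP => meromorphicOrderAt_eq_neg_one (hFm _) hlim hP⟩
  obtain ⟨⟨hX, hW⟩, hi, hI⟩ := hint s hs
  refine ⟨hi, ?_⟩
  have hJs := hJ s hX hW
  have hI' : integralI n₁ m R (fMinus n₁ m n₂ a b a' b' l t) 1 1 0 s = m * (T.J (m + n₁ - 1) 0 0 0 s -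
    Gamma ((T.M + T.q : ℕ) * s + (m + n₁ - 1 + c : ℕ) + 1) * K s) := hI
  rw [hI', hJs]
  simp only [hF, hv, add_assoc]
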